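/- Let $M$ be Minkowski spacetime: an affine space over a 4-dimensional real vector space $W$ with an inner product $\eta$ of signature $(-,+,+,+)$, an orientation and a time orientation. A reference frame $(o,\{e_a\})$ is an origin $o\in M$ with a positively oriented basis $e_0,\dots,e_3$ such that $\eta(e_a,e_b)=\eta_{ab}:=\mathrm{diag}(-1,1,1,1)_{ab}$ and $e_0$ is future directed. A proper orthochronous Poincaré transformation is a map $P:M\to M$ with $P(p+w)=P(p)+\Lambda w$, where $\Lambda$ is a linear automorphism of $W$ preserving $\eta$, the orientation and the time orientation. In a frame, $P$ is represented by the $5\times5$ matrix $\begin{pmatrix}\Lambda&-\bar b\\0&1\end{pmatrix}$ that maps $(\bar x,1)$ to $(\bar x',1)$, where $\bar x$, $\bar x'$ are the coordinates of a point in the frame and in its image $(P(o),\{\Lambda e_a\})$ (so $P(o)-o$ has components $\Lambda^{-1}\bar b$). A Killing field $\mathcal P$ (an affine vector field on $M$ with $\eta$-skew linear part) is represented in a frame by the matrix $\begin{pmatrix}F&-\bar w\\0&0\end{pmatrix}$ if its components at the point of coordinates $\bar x$ are $-F\bar x+\bar w$; we write $P=\exp\mathcal P$ if the exponential of the matrix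 of $\mathcal P$ is the matrix of $P$. Let $(M^{ab})^c{}_d=\eta^{ac}\delta^b_d-\eta^{bc}\delta^a_d$ and $J^{ab}=\begin{pmatrix}M^{ab}&0\\0&0\end{pmatrix}$, $K^i=J^{0i}$, $J^1=J^{23}$, $J^3=J^{12}$, and let $H$ be the $5\times 5$ matrix whose only nonzero entry is $-1$, in the upper right corner. Thus $$aK^1+\omega J^1+H=\begin{pmatrix}0&-a&0&0&-1\\-a&0&0&0&0\\0&0&0&\omega&0\\0&0&-\omega&0&0\\0&0&0&0&0\end{pmatrix},\qquad aK^2-\omega J^3+H=\begin{pmatrix}0&0&-a&0&-1\\0&0&-\omega&0&0\\-a&\omega&0&0&0\\0&0&0&0&0\\0&0&0&0&0\end{pmatrix}.$$ **Theorem.** Let $P$ be a proper orthochronous Poincaré transformation that sends some point $q$ into its chronological future $I^+(q)$ (the points reached from $q$ along future directed timelike $C^1$ curves). 1. There are a reference frame and real numbers $a,\omega,\tau$ with $\tau>0$ such that $P$ is represented by one of the following matrices. (a) with $a\ge 0$: $$\exp[(aK^1+\omega J^1+H)\tau]=\begin{pmatrix}\cosh a\tau&-\sinh a\tau&0&0&-\frac1a\sinh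 a\tau\\-\sinh a\tau&\cosh a\tau&0&0&\frac1a[\cosh a\tau-1]\\0&0&\cos\omega\tau&\sin\omega\tau&0\\0&0&-\sin\omega\tau&\cos\omega\tau&0\\0&0&0&0&1\end{pmatrix},$$ where for $a=0$ the quantities $\frac1a\sinh a\tau$ and $\frac1a[\cosh a\tau-1]$ mean their limits $\tau$ and $0$; (b) with $a=\omega\ne0$: $$\exp[(aK^2-\omega J^3+H)\tau]=\begin{pmatrix}1+\frac{(a\tau)^2}2&-\frac{(a\tau)^2}2&-a\tau&0&-\tau-\frac{a^2\tau^3}6\\\frac{(a\tau)^2}2&1-\frac{(a\tau)^2}2&-a\tau&0&-\frac{a^2\tau^3}6\\-a\tau&a\tau&1&0&\frac{a\tau^2}2\\0&0&0&1&0\\0&0&0&0&1\end{pmatrix};$$ (c) with $0\le\omega<a$; writing $\gamma=1/\sqrt{1-(\omega/a)^2}$, $r=\omega/a$, $C=\cosh(a\tau/\gamma)$, $s=\sinh(a\tau/\gamma)$: $$\exp[(aK^2-\omega J^3+H)\tau]=\begin{pmatrix}1+\gamma^2(C-1)&-r\gamma^2(C-1)&-\gamma s&0&r^2\gamma^2\tau-\frac1a\gamma^3s\\r\gamma^2(C-1)&1-r^2\gamma^2(C-1)&-r\gamma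 s&0&r\gamma^2\tau-\frac{\omega}{a^2}\gamma^3s\\-\gamma s&r\gamma s&C&0&\frac1a\gamma^2(C-1)\\0&0&0&1&0\\0&0&0&0&1\end{pmatrix}.$$ The displayed matrix identities hold for all $\tau>0$ and all $a,\omega$ in the stated ranges. 2. The freedom in $a,\omega,\tau$ is the following. Let $\mathcal P$ be any Killing field with $\exp\mathcal P=P$, with matrix $\begin{pmatrix}F&-\bar w\\0&0\end{pmatrix}$ in some frame. With $F^{ab}=F^a{}_c\eta^{cb}$, $\tilde F_{cd}=\frac12\epsilon_{abcd}F^{ab}$, $\epsilon_{0123}=1$, put $$I_1=-\tfrac14\operatorname{Tr}F^2,\quad I_2=-\tfrac14\tilde F_{cd}F^{cd},\quad I_3=\tilde F_{ab}w^b\,\tilde F^a{}_cw^c,\quad I_4=w^aw_a .$$ (i) For real $a,\omega$ and $\tau>0$, there is a frame in which $\mathcal P$ has the matrix $(aK^1+\omega J^1+H)\tau$ if and only if $(a^2-\omega^2)\tau^2=-2I_1$, $a\omega\tau^2=I_2$, and moreover $\omega^2\tau^4=I_3$ if $I_2=0$, and $\tau^2=-I_4$ if $F=0$. (ii) For real $a,\omega$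 and $\tau>0$, there is a frame in which $\mathcal P$ has the matrix $(aK^2-\omega J^3+H)\tau$ if and only if $I_2=0$, $(a^2-\omega^2)\tau^2=-2I_1$, $\omega^2\tau^4=I_3$, and moreover $\tau^2=-I_4$ if $F=0$. (iii) If $I_2=0$ and $I_1>0$, or if $F=0$ (pure rotation), then $\mathcal P$ has in some frame the matrix $(\omega J^1+H)\tau$ for some $\omega\ge0$, $\tau>0$, with $\omega=2I_1/\sqrt{I_3}$ if $I_1>0$; and whenever $\mathcal P$ has in some frame the matrix of one of the exponents in (a), (b), (c), with parameters $a',\omega',\tau'$ in the corresponding range, then $a'=0$, $|\omega'|=\omega$, $\tau'=\tau$. (iv) Otherwise, for every $\tau>0$ there are $a\ge 0$ and $\omega$ such that $\mathcal P$ has in some frame the matrix of one of the exponents in (a), (b), (c) with parameters $a,\omega,\tau$ in the corresponding range, and, for this $\tau$, $|a|$ and $|\omega|$ are uniquely determined. -/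

import Mathlib

namespace Chasles

/-- The Minkowski metric coefficients `η_{ab} = diag(-1,1,1,1)` (equal to `η^{ab}`). -/
def etaMat : Matrix (Fin 4) (Fin 4) ℝ := Matrix.diagonal ![-1, 1, 1, 1]

/-- The data `(W, η, or, ↑)`: a 4-dimensional real vector space with an inner product of
signature `(-,+,+,+)`, an orientation, and a time orientation, i.e. a choice of one of the
two cones of timelike vectors as the future cone. -/
structure Minkowski (W : Type*) [AddCommGroup W] [Module ℝ W] where
  η : LinearMap.BilinForm ℝ W
  orientation : Orientation ℝ W (Fin 4)
  /-- the set of future directed timelike vectors -/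
  future : Set W
  signature : ∃ e : Module.Basis (Fin 4) ℝ W, ∀ a b, η (e a) (e b) = etaMat a b
  future_cone : ∃ t, η t t < 0 ∧ future = {v | η v v < 0 ∧ η t v < 0}

namespace Minkowski

variable {W : Type*} [AddCommGroup W] [Module ℝ W]

/-- `Λ` is in the proper orthochronous Lorentz group: it preserves the inner product, the
orientation and the time orientation. -/
def IsLorentz (S : Minkowski W) (Λ : W ≃ₗ[ℝ] W) : Prop :=
  (∀ u v, S.η (Λ u) (Λ v) = S.η u v) ∧
  Orientation.map (Fin 4) Λ S.orientation = S.orientation ∧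
  ∀ v ∈ S.future, Λ v ∈ S.future

/-- `P : M → M` is in the inhomogeneous proper orthochronous Lorentz group (the proper
orthochronous Poincaré group): `P (p + w) = P p + Λ w` with `Λ` proper orthochronous. -/
def IsPoincare (S : Minkowski W) {M : Type*} [AddTorsor W M] (P : M → M) : Prop :=
  ∃ Λ : W ≃ₗ[ℝ] W, S.IsLorentz Λ ∧ ∀ (p : M) (w : W), P (w +ᵥ p) = Λ w +ᵥ P p

/-- `k` is in the Lie algebra of the Poincaré group, viewed as the algebra of Killing vector
fields of `M`: affine vector fields with skew-symmetric linear part. -/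
def IsKilling (S : Minkowski W) {M : Type*} [AddTorsor W M] (k : M → W) : Prop :=
  ∃ F : W →ₗ[ℝ] W, (∀ u v, S.η u (F v) + S.η (F u) v = 0) ∧
    ∀ (p : M) (w : W), k (w +ᵥ p) = F w + k p

/-- The chronological future `I⁺(q)`: the points that can be reached from `q` along a `C¹`
curve `γ : [0,1] → M` whose velocity `v` is everywhere timelike and future directed.  (As `W`
is finite-dimensional, derivatives may be tested on linear functionals.) -/
def chronologicalFuture (S : Minkowski W) {M : Type*} [AddTorsor W M] (q : M) : Set M :=
  {p | ∃ (γ : ℝ → M) (v : ℝ → W), γ 0 = q ∧ γ 1 = p ∧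
    (∀ t ∈ Set.Icc (0 : ℝ) 1, v t ∈ S.future) ∧
    ∀ φ : Module.Dual ℝ W, ContinuousOn (fun t => φ (v t)) (Set.Icc 0 1) ∧
      ∀ t ∈ Set.Icc (0 : ℝ) 1,
        HasDerivWithinAt (fun s => φ (γ s -ᵥ q)) (φ (v t)) (Set.Icc 0 1) t}

/-- A reference frame: an origin together with a positively oriented orthonormal basis
`e_0, e_1, e_2, e_3` with `e_0` timelike and future directed. -/
structure Frame (S : Minkowski W) (M : Type*) [AddTorsor W M] where
  origin : M
  basis : Module.Basis (Fin 4) ℝ W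
  orthonormal : ∀ a b, S.η (basis a) (basis b) = etaMat a b
  oriented : basis.orientation = S.orientation
  future : basis 0 ∈ S.future

namespace Frame

variable {S : Minkowski W} {M : Type*} [AddTorsor W M]

/-- The coordinates of `p` in the frame: `p = o + x^a e_a`. -/
noncomputable def coord (f : S.Frame M) (p : M) : Fin 4 → ℝ :=
  fun a => f.basis.repr (p -ᵥ f.origin) a

/-- The coordinate column `(x̄, 1)`. -/
noncomputable def hcoord (f : S.Frame M) (p : M) : Fin 5 → ℝ :=
  ![f.coord p 0, f.coord p 1, f.coord p 2, f.coord p 3, 1]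

/-- `P` has matrix `N` with respect to the frame `(o, e_a)`: `N` is the matrix of the coordinate
change `(x̄', 1) = N (x̄, 1)`, where `x̄` are the coordinates in the frame and `x̄'` those in
the image frame `(P o, Λ e_a)`.  The image-frame coordinates of `P p` are the original
coordinates of `p`, so (`P` being surjective) this is the condition below.  In particular, if
`N` has blocks `Λ`, `-b̄`, then `P o - o` has components `Λ⁻¹ b̄`. -/
def Represents (f : S.Frame M) (P : M → M) (N : Matrix (Fin 5) (Fin 5) ℝ) : Prop :=
  ∀ p, f.hcoord p = N.mulVec (f.hcoord (P p))

/-- The Killing field `k` has the matrix `X`, with blocks `F`, `-w̄` and zero last row, with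
respect to the frame: its components at the point of coordinates `x̄` are `-F x̄ + w̄`. -/
def RepresentsField (f : S.Frame M) (k : M → W) (X : Matrix (Fin 5) (Fin 5) ℝ) : Prop :=
  ∀ p, X.mulVec (f.hcoord p) =
    ![-(f.basis.repr (k p) 0), -(f.basis.repr (k p) 1), -(f.basis.repr (k p) 2),
      -(f.basis.repr (k p) 3), 0]

end Frame

end Minkowski

/-! ### Generators -/

/-- The `5 × 5` matrix with blocks `F`, `v` and zero last row. -/
def block (F : Matrix (Fin 4) (Fin 4) ℝ) (v : Fin 4 → ℝ) : Matrix (Fin 5) (Fin 5) ℝ :=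
  !![F 0 0, F 0 1, F 0 2, F 0 3, v 0;
     F 1 0, F 1 1, F 1 2, F 1 3, v 1;
     F 2 0, F 2 1, F 2 2, F 2 3, v 2;
     F 3 0, F 3 1, F 3 2, F 3 3, v 3;
     0, 0, 0, 0, 0]

/-- `J^{ab}`, with `(M^{ab})^c_d = η^{ac} δ^b_d - η^{bc} δ^a_d`. -/
def genJJ (a b : Fin 4) : Matrix (Fin 5) (Fin 5) ℝ :=
  block (Matrix.of fun c d =>
    etaMat a c * (if b = d then 1 else 0) - etaMat b c * (if a = d then 1 else 0)) 0

/-- `P^a`, with `(m̄^a)^c = η^{ac}`. -/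
def genP (a : Fin 4) : Matrix (Fin 5) (Fin 5) ℝ := block 0 (fun c => etaMat a c)

/-- The generator `H = P^0` of time translations. -/
def genH : Matrix (Fin 5) (Fin 5) ℝ := genP 0

/-- The generator `K^i = J^{0i}` of boosts (used for `i = 1, 2, 3`). -/
def genK (i : Fin 4) : Matrix (Fin 5) (Fin 5) ℝ := genJJ 0 i

/-- The generator of rotations `J^1 = J^{23}`. -/
def genJ1 : Matrix (Fin 5) (Fin 5) ℝ := genJJ 2 3

/-- The generator of rotations `J^3 = J^{12}`. -/
def genJ3 : Matrix (Fin 5) (Fin 5) ℝ := genJJ 1 2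

/-- `a K^1 + ω J^1 + H`: acceleration and angular velocity aligned. -/
noncomputable def alignedGen (a ω : ℝ) : Matrix (Fin 5) (Fin 5) ℝ :=
  a • genK 1 + ω • genJ1 + genH

/-- `a K^2 - ω J^3 + H`: acceleration and angular velocity perpendicular. -/
noncomputable def perpGen (a ω : ℝ) : Matrix (Fin 5) (Fin 5) ℝ :=
  a • genK 2 - ω • genJ3 + genH

/-! ### Explicit matrix forms -/

/-- `sinh (a τ) / a`, understood as its limit `τ` for `a = 0`. -/
noncomputable def sinhDiv (a τ : ℝ) : ℝ := if a = 0 then τ else 1 / a * Real.sinh (a * τ)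

/-- `(cosh (a τ) - 1) / a`, understood as its limit `0` for `a = 0`. -/
noncomputable def coshDiv (a τ : ℝ) : ℝ := if a = 0 then 0 else 1 / a * (Real.cosh (a * τ) - 1)

open Real in
noncomputable def matA (a ω τ : ℝ) : Matrix (Fin 5) (Fin 5) ℝ :=
  !![cosh (a * τ), -sinh (a * τ), 0, 0, -sinhDiv a τ;
     -sinh (a * τ), cosh (a * τ), 0, 0, coshDiv a τ;
     0, 0, cos (ω * τ), sin (ω * τ), 0;
     0, 0, -sin (ω * τ), cos (ω * τ), 0;
     0, 0, 0, 0, 1]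

noncomputable def matB (a τ : ℝ) : Matrix (Fin 5) (Fin 5) ℝ :=
  !![1 + (a * τ) ^ 2 / 2, -(a * τ) ^ 2 / 2, -(a * τ), 0, -τ - a ^ 2 * τ ^ 3 / 6;
     (a * τ) ^ 2 / 2, 1 - (a * τ) ^ 2 / 2, -(a * τ), 0, -(a ^ 2 * τ ^ 3 / 6);
     -(a * τ), a * τ, 1, 0, a * τ ^ 2 / 2;
     0, 0, 0, 1, 0;
     0, 0, 0, 0, 1]

/-- `γ(a, ω) = 1 / √(1 - (ω/a)²)`. -/
noncomputable def gam (a ω : ℝ) : ℝ := 1 / √(1 - (ω / a) ^ 2)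

open Real in
noncomputable def matC (a ω τ : ℝ) : Matrix (Fin 5) (Fin 5) ℝ :=
  let γ := gam a ω
  let r := ω / a
  let C := cosh (a * τ / γ)
  let s := sinh (a * τ / γ)
  !![1 + γ ^ 2 * (C - 1), -(r * γ ^ 2 * (C - 1)), -(γ * s), 0,
        r ^ 2 * γ ^ 2 * τ - 1 / a * γ ^ 3 * s;
     r * γ ^ 2 * (C - 1), 1 - r ^ 2 * γ ^ 2 * (C - 1), -(r * γ * s), 0,
        r * γ ^ 2 * τ - ω / a ^ 2 * γ ^ 3 * s;
     -(γ * s), r * γ * s, C, 0, 1 / a * γ ^ 2 * (C - 1);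
     0, 0, 0, 1, 0;
     0, 0, 0, 0, 1]

/-- `Y` is one of the canonical generators multiplied by `τ > 0`, in the allowed ranges:
(a) `(a K^1 + ω J^1 + H) τ` with `a ≥ 0`;
(b) `(a K^2 - ω J^3 + H) τ` with `a = ω ≠ 0`;
(c) `(a K^2 - ω J^3 + H) τ` with `0 ≤ ω < a`. -/
def IsCanonical (a ω τ : ℝ) (Y : Matrix (Fin 5) (Fin 5) ℝ) : Prop :=
  0 < τ ∧
  ((0 ≤ a ∧ Y = τ • alignedGen a ω) ∨
   (a = ω ∧ a ≠ 0 ∧ Y = τ • perpGen a ω) ∨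
   (0 ≤ ω ∧ ω < a ∧ Y = τ • perpGen a ω))

/-! ### Invariants of a Lie algebra element with blocks `F`, `-w̄` -/

/-- The homogeneous part `F^a_b`. -/
def linPart (X : Matrix (Fin 5) (Fin 5) ℝ) : Matrix (Fin 4) (Fin 4) ℝ :=
  X.submatrix Fin.castSucc Fin.castSucc

/-- The vector `w^a`. -/
def wPart (X : Matrix (Fin 5) (Fin 5) ℝ) : Fin 4 → ℝ := fun a => -X a.castSucc (Fin.last 4)

/-- The Levi-Civita symbol, `ε_{0123} = 1`. -/
def leviCivita (a b c d : Fin 4) : ℝ :=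
  Matrix.det (Matrix.of fun i j : Fin 4 => if ![a, b, c, d] i = j then (1 : ℝ) else 0)

/-- `F^{ab} = F^a_c η^{cb}`. -/
def upper (F : Matrix (Fin 4) (Fin 4) ℝ) : Matrix (Fin 4) (Fin 4) ℝ := F * etaMat

/-- The dual `F̃_{cd} = ½ ε_{abcd} F^{ab}`. -/
noncomputable def dual (F : Matrix (Fin 4) (Fin 4) ℝ) : Matrix (Fin 4) (Fin 4) ℝ :=
  Matrix.of fun c d => 1 / 2 * ∑ a, ∑ b, leviCivita a b c d * upper F a b

/-- `I₁ = -¼ Tr F²`. -/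
noncomputable def I1 (X : Matrix (Fin 5) (Fin 5) ℝ) : ℝ :=
  -(1 / 4) * (linPart X * linPart X).trace

/-- `I₂ = -¼ F̃_{cd} F^{cd} = -⅛ ε_{abcd} F^{ab} F^{cd}`, normalized so that a boost of rapidity
`φ` along and a rotation of angle `θ` around the same axis give `I₂ = θ φ`. -/
noncomputable def I2 (X : Matrix (Fin 5) (Fin 5) ℝ) : ℝ :=
  -(1 / 4) * ∑ c, ∑ d, dual (linPart X) c d * upper (linPart X) c d

/-- `I₃ = F̃_{ab} w^b F̃^a_c w^c`. -/
noncomputable def I3 (X : Matrix (Fin 5) (Fin 5) ℝ) : ℝ :=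
  let z := (dual (linPart X)).mulVec (wPart X)
  ∑ a, ∑ b, etaMat a b * z a * z b

/-- `I₄ = w^a w_a` (used when `F = 0`). -/
noncomputable def I4 (X : Matrix (Fin 5) (Fin 5) ℝ) : ℝ :=
  ∑ a, ∑ b, etaMat a b * wPart X a * wPart X b

/-- The case of pure rotation: `I₂ = 0` and `I₁ > 0`, or `F = 0`. -/
def IsPureRotation (X : Matrix (Fin 5) (Fin 5) ℝ) : Prop :=
  (I2 X = 0 ∧ 0 < I1 X) ∨ linPart X = 0

end Chasles

namespace Chasles

namespace Minkowski

variable {W : Type*} [AddCommGroup W] [Module ℝ W] {S : Minkowski W}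

/-! ### Orthonormal bases and the future cone in coordinates -/

/-! The map `P` is first written as the time-one flow of a Killing field, and the normal forms are
then found for the field. If the Lorentz part `Λ` has no eigenvalue `-1`, its Cayley transform `C =
(Λ - 1)(Λ + 1)⁻¹` is `η`-skew. A skew map is either null, or has parallel electric and magnetic
parts in a suitable frame (`exists_aligned_of_not_null`), so `Λ` is either `1 + 2C + 2C²` with `C³ =
0` or a boost and rotation along a common axis. If `-1` is an eigenvalue, there is a second
eigenvector and `Λ` is a boost times a half turn. Moving the origin, or solving for the translation
part in the null case, gives a logarithm of `P` (`IsPoincare.exists_log`).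

For a Killing field `k` with linear part `F`, both canonical generators describe a frame whose
origin is a point where `k = τ e₀`, the electric and magnetic parts of `F` being parallel or
orthogonal there. At such a point `I₁`, `I₂`, `I₃` are `(|B|² - |E|²)/2`, `E·B` and `τ²|B|²`. Hence,
once `I₂ = 0` and the other invariants match, the perpendicular form exists as soon as `k` takes
somewhere a future directed value of length `τ` (`exists_perp_of_hasValue`). The invariance of these
quantities (`invariants_eq`) gives the converse and the uniqueness.

It remains to find the lengths that `k` attains. The displacement `d = P q - q` is future directed
timelike, and every functional vanishing on the range of `F` has the same value on `d` as on `k`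
(`apply_displacement`). This separates the types of `killing_cases`. If `F = 0`, then `k = d` is
constant. If `F` is null, it has a null vector `l` in its kernel and range with `η(l, k) = η(l, d) <
0`; adding multiples of `l` to `k` gives every length. If boost and rotation are both present, `F`
is invertible and `k` takes every value. For a boost, the components of `k` in the boost plane are
arbitrary and again all lengths occur. For a rotation, the components in the timelike plane are
fixed by `d`; they give a maximal length `m`, attained on the axis, which is the length that
survives in the canonical ranges. This is the case of pure rotation with `F ≠ 0`. -/

theorem eta_apply_of_orthonormal {e : Module.Basis (Fin 4) ℝ W}
    (he : ∀ a b, S.η (e a) (e b) = etaMat a b) (u v : W) :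
    S.η u v = -(e.repr u 0 * e.repr v 0) + e.repr u 1 * e.repr v 1 + e.repr u 2 * e.repr v 2
      + e.repr u 3 * e.repr v 3 := by
  conv_lhs => rw [← e.sum_repr u, ← e.sum_repr v]
  simp only [map_add, LinearMap.add_apply, map_smul, LinearMap.smul_apply, smul_eq_mul, he,
    Fin.sum_univ_four]
  simp [etaMat]
  ring

theorem eta_symm (S : Minkowski W) (u v : W) : S.η u v = S.η v u := by
  obtain ⟨e, he⟩ := S.signature
  rw [eta_apply_of_orthonormal he, eta_apply_of_orthonormal he]
  ring

theorem finrank_eq (S : Minkowski W) : Module.finrank ℝ W = 4 := by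
  obtain ⟨e, -⟩ := S.signature
  simpa using Module.finrank_eq_card_basis e

/-- The reverse Cauchy-Schwarz inequality in the form needed for time orientations. -/
theorem spatial_lt {a₀ a₁ a₂ a₃ b₀ b₁ b₂ b₃ : ℝ} (ha₀ : 0 < a₀)
    (ha : a₁ ^ 2 + a₂ ^ 2 + a₃ ^ 2 ≤ a₀ ^ 2) (hb₀ : 0 < b₀)
    (hb : b₁ ^ 2 + b₂ ^ 2 + b₃ ^ 2 < b₀ ^ 2) : a₁ * b₁ + a₂ * b₂ + a₃ * b₃ < a₀ * b₀ := by
  have hab : 0 < a₀ * b₀ := mul_pos ha₀ hb₀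
  refine lt_of_pow_lt_pow_left₀ 2 hab.le ?_
  have h1 : (a₁ * b₁ + a₂ * b₂ + a₃ * b₃) ^ 2
      ≤ (a₁ ^ 2 + a₂ ^ 2 + a₃ ^ 2) * (b₁ ^ 2 + b₂ ^ 2 + b₃ ^ 2) := by
    nlinarith [sq_nonneg (a₁ * b₂ - a₂ * b₁), sq_nonneg (a₁ * b₃ - a₃ * b₁),
      sq_nonneg (a₂ * b₃ - a₃ * b₂)]
  have h2 : (a₁ ^ 2 + a₂ ^ 2 + a₃ ^ 2) * (b₁ ^ 2 + b₂ ^ 2 + b₃ ^ 2)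
      ≤ a₀ ^ 2 * (b₁ ^ 2 + b₂ ^ 2 + b₃ ^ 2) := by gcongr
  have h3 : a₀ ^ 2 * (b₁ ^ 2 + b₂ ^ 2 + b₃ ^ 2) < a₀ ^ 2 * b₀ ^ 2 := by gcongr
  nlinarith

/-- Two timelike vectors are never orthogonal. -/
theorem eta_ne_zero_of_timelike {u v : W} (hu : S.η u u < 0) (hv : S.η v v < 0) :
    S.η u v ≠ 0 := by
  obtain ⟨e, he⟩ := S.signature
  rw [eta_apply_of_orthonormal he] at hu hv ⊢
  intro h
  set a₀ := e.repr u 0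
  set b₀ := e.repr v 0
  have ha : 0 < |a₀| := by
    refine abs_pos.2 fun h0 => ?_
    rw [h0] at hu
    nlinarith [sq_nonneg (e.repr u 1), sq_nonneg (e.repr u 2), sq_nonneg (e.repr u 3)]
  have hb : 0 < |b₀| := by
    refine abs_pos.2 fun h0 => ?_
    rw [h0] at hv
    nlinarith [sq_nonneg (e.repr v 1), sq_nonneg (e.repr v 2), sq_nonneg (e.repr v 3)]
  have hu' : (e.repr u 1) ^ 2 + (e.repr u 2) ^ 2 + (e.repr u 3) ^ 2 ≤ |a₀| ^ 2 := by
    rw [sq_abs]; nlinarith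
  have hv' : (e.repr v 1) ^ 2 + (e.repr v 2) ^ 2 + (e.repr v 3) ^ 2 < |b₀| ^ 2 := by
    rw [sq_abs]; nlinarith
  have h1 := spatial_lt ha hu' hb hv'
  have h2 := spatial_lt (b₁ := -e.repr v 1) (b₂ := -e.repr v 2) (b₃ := -e.repr v 3) ha hu' hb
    (by nlinarith)
  have h3 : |a₀| * |b₀| = |a₀ * b₀| := (abs_mul _ _).symm
  have h4 : a₀ * b₀ = e.repr u 1 * e.repr v 1 + e.repr u 2 * e.repr v 2
    + e.repr u 3 * e.repr v 3 := by linarith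
  have h5 : |a₀ * b₀| < |a₀| * |b₀| := by rw [h4, abs_lt]; constructor <;> linarith
  exact absurd h3 (ne_of_gt h5)

theorem timelike_of_mem_future {v : W} (hv : v ∈ S.future) : S.η v v < 0 := by
  obtain ⟨t, -, ht'⟩ := S.future_cone
  rw [ht'] at hv
  exact hv.1

theorem mem_future_or_neg_mem {v : W} (hv : S.η v v < 0) : v ∈ S.future ∨ -v ∈ S.future := by
  obtain ⟨t, ht, ht'⟩ := S.future_cone
  rw [ht']
  rcases (eta_ne_zero_of_timelike ht hv).lt_or_gt with h | h
  · exact Or.inl ⟨hv, h⟩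
  · exact Or.inr ⟨by simpa using hv, by simpa using h⟩

theorem smul_mem_future {v : W} (hv : v ∈ S.future) {c : ℝ} (hc : 0 < c) : c • v ∈ S.future := by
  obtain ⟨t, ht, ht'⟩ := S.future_cone
  rw [ht'] at hv ⊢
  refine ⟨?_, ?_⟩
  · simp only [map_smul, LinearMap.smul_apply, smul_eq_mul]
    have := hv.1
    nlinarith [mul_pos hc hc]
  · simp only [map_smul, smul_eq_mul]
    have := hv.2
    nlinarith

theorem linearIndependent_of_orthonormal {v : Fin 4 → W}
    (hv : ∀ a b, S.η (v a) (v b) = etaMat a b) : LinearIndependent ℝ v := by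
  rw [Fintype.linearIndependent_iff]
  intro c hc i
  have h : S.η (v i) (∑ j, c j • v j) = 0 := by rw [hc]; simp
  simp only [map_sum, map_smul, hv, smul_eq_mul] at h
  fin_cases i <;> simpa [Fin.sum_univ_four, etaMat, Matrix.diagonal] using h

variable {M : Type*} [AddTorsor W M]

/-- Orthonormal vectors, the first of them future directed, form a frame after changing the sign
of one spatial vector if necessary. -/
theorem exists_frame_of_orthonormal (o : M) {v : Fin 4 → W}
    (hv : ∀ a b, S.η (v a) (v b) = etaMat a b) (h0 : v 0 ∈ S.future) (i : Fin 4) (hi : i ≠ 0) :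
    ∃ f : S.Frame M, f.origin = o ∧ (∀ j, j ≠ i → f.basis j = v j) ∧
      (f.basis i = v i ∨ f.basis i = -v i) := by
  have hli := linearIndependent_of_orthonormal hv
  let e : Module.Basis (Fin 4) ℝ W :=
    basisOfLinearIndependentOfCardEqFinrank hli (by simp [S.finrank_eq])
  have hev : ∀ j, e j = v j := fun j => by simp [e]
  rcases e.orientation_eq_or_eq_neg S.orientation with h | h
  · exact ⟨⟨o, e, fun a b => by rw [hev, hev, hv], h.symm, by rwa [hev]⟩, rfl,
      fun j _ => hev j, Or.inl (hev i)⟩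
  · let e' := e.unitsSMul (Function.update 1 i (-1))
    have h1 : ∀ j, j ≠ i → e' j = v j := fun j hj => by
      simp [e', Module.Basis.unitsSMul_apply, Function.update_of_ne hj, hev]
    have h2 : e' i = -v i := by
      simp [e', Module.Basis.unitsSMul_apply, hev, Units.smul_def]
    refine ⟨⟨o, e', ?_, ?_, ?_⟩, rfl, h1, Or.inr h2⟩
    · intro a b
      by_cases ha : a = i <;> by_cases hb : b = i
      · subst ha; subst hb; rw [h2]; simp [hv]
      · subst ha; rw [h2, h1 b hb]; simp [hv, etaMat, Matrix.diagonal_apply_ne _ (Ne.symm hb)]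
      · subst hb; rw [h2, h1 a ha]; simp [hv, etaMat, Matrix.diagonal_apply_ne _ ha]
      · rw [h1 a ha, h1 b hb, hv]
    · rw [Module.Basis.orientation_neg_single, h]
    · rw [h1 0 hi.symm]; exact h0

theorem exists_frame (S : Minkowski W) (o : M) : ∃ f : S.Frame M, f.origin = o := by
  obtain ⟨e, he⟩ := S.signature
  have h0 : S.η (e 0) (e 0) < 0 := by rw [he]; simp [etaMat]
  rcases mem_future_or_neg_mem h0 with h | h
  · obtain ⟨f, hf, -⟩ := exists_frame_of_orthonormal o he h 1 (by decide)
    exact ⟨f, hf⟩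
  · have hv : ∀ a b, S.η (-e a) (-e b) = etaMat a b := fun a b => by simp [he]
    obtain ⟨f, hf, -⟩ := exists_frame_of_orthonormal o hv h 1 (by decide)
    exact ⟨f, hf⟩

namespace Frame

variable (f : S.Frame M)

theorem eta_apply (u v : W) : S.η u v = -(f.basis.repr u 0 * f.basis.repr v 0)
    + f.basis.repr u 1 * f.basis.repr v 1 + f.basis.repr u 2 * f.basis.repr v 2
    + f.basis.repr u 3 * f.basis.repr v 3 :=
  eta_apply_of_orthonormal f.orthonormal u v

variable {f}

theorem ext_repr {u v : W} (h0 : f.basis.repr u 0 = f.basis.repr v 0)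
    (h1 : f.basis.repr u 1 = f.basis.repr v 1) (h2 : f.basis.repr u 2 = f.basis.repr v 2)
    (h3 : f.basis.repr u 3 = f.basis.repr v 3) : u = v := by
  apply f.basis.repr.injective
  ext i
  fin_cases i <;> assumption

theorem repr_basis (i j : Fin 4) : f.basis.repr (f.basis i) j = if i = j then 1 else 0 := by
  rw [Module.Basis.repr_self, Finsupp.single_apply]

/-- The vector `t` defining the cone has positive time component because `e₀` is future directed. By
the reverse Cauchy-Schwarz inequality, the sign of `η(t, v)` for timelike `v` is then opposite to
that of the time component of `v`. -/
theorem mem_future_iff {v : W} : v ∈ S.future ↔ 0 < f.basis.repr v 0 ∧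
    f.basis.repr v 1 ^ 2 + f.basis.repr v 2 ^ 2 + f.basis.repr v 3 ^ 2
      < f.basis.repr v 0 ^ 2 := by
  obtain ⟨t, ht, ht'⟩ := S.future_cone
  have he := f.future
  rw [ht'] at he ⊢
  have he2 := he.2
  simp only [Set.mem_ofPred_eq]
  rw [f.eta_apply] at ht he2
  rw [f.eta_apply v v, f.eta_apply t v]
  simp only [repr_basis, Fin.reduceEq, if_true, if_false, mul_one, mul_zero, add_zero,
    Left.neg_neg_iff] at he2
  have ht2 : f.basis.repr t 1 ^ 2 + f.basis.repr t 2 ^ 2 + f.basis.repr t 3 ^ 2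
      ≤ f.basis.repr t 0 ^ 2 := by nlinarith
  constructor
  · rintro ⟨h1, h2⟩
    have h3 : f.basis.repr v 1 ^ 2 + f.basis.repr v 2 ^ 2 + f.basis.repr v 3 ^ 2
      < f.basis.repr v 0 ^ 2 := by nlinarith
    refine ⟨?_, h3⟩
    by_contra hneg
    have h4 : f.basis.repr v 0 ≠ 0 := by
      intro h
      rw [h] at h3
      nlinarith [sq_nonneg (f.basis.repr v 1), sq_nonneg (f.basis.repr v 2),
        sq_nonneg (f.basis.repr v 3)]
    have h5 : 0 < -f.basis.repr v 0 := by
      have := lt_of_le_of_ne (not_lt.1 hneg) h4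
      linarith
    have := spatial_lt (b₁ := -f.basis.repr v 1) (b₂ := -f.basis.repr v 2)
      (b₃ := -f.basis.repr v 3) he2 ht2 h5 (by nlinarith)
    nlinarith
  · rintro ⟨h1, h2⟩
    refine ⟨by nlinarith, ?_⟩
    have := spatial_lt he2 ht2 h1 h2
    nlinarith

/-- There is a frame with prescribed origin and prescribed time direction. -/
theorem exists_frame_of_future (f : S.Frame M) (o : M) {t : W} (ht : t ∈ S.future)
    (ht1 : S.η t t = -1) : ∃ f' : S.Frame M, f'.origin = o ∧ f'.basis 0 = t := by
  obtain ⟨h0, -⟩ := (mem_future_iff (f := f)).1 ht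
  have h := f.eta_apply t t
  rw [ht1] at h
  set a := f.basis.repr t 0
  -- The reflection along `e₀` followed by the reflection along `e₀ + t`, whose square is `-2(1 +
  -- a)`. The first sends `e₀` to `-e₀`, the second sends `-e₀` to `t`.
  let L : W → W := fun v => v + (S.η v (f.basis 0 + t) / (1 + a)) • (f.basis 0 + t)
    - (2 * S.η v (f.basis 0)) • t
  have hea : ∀ v, S.η (f.basis 0) v = -f.basis.repr v 0 := fun v => by
    rw [f.eta_apply]; simp
  have hea' : ∀ v, S.η v (f.basis 0) = -f.basis.repr v 0 := fun v => by
    rw [S.eta_symm, hea]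
  have hee : f.basis.repr (f.basis 0) 0 = 1 := by simp
  have ha1 : 1 + a ≠ 0 := by positivity
  have hL : ∀ u v, S.η (L u) (L v) = S.η u v := by
    intro u v
    simp only [L, map_add, map_sub, map_smul, LinearMap.add_apply, LinearMap.sub_apply,
      LinearMap.smul_apply, smul_eq_mul, hea, hea', hee, ht1, S.eta_symm t v]
    field_simp
    ring
  have hL0 : L (f.basis 0) = t := by
    simp only [L, map_add, hea, hee]
    rw [show (-1 + -f.basis.repr t 0) / (1 + a) = -1 by field_simp; simp only [a]; ring]
    module
  obtain ⟨f', h1, h2, -⟩ := exists_frame_of_orthonormal (S := S) o (v := fun i => L (f.basis i))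
    (fun a b => by rw [hL, f.orthonormal]) (by simpa [hL0] using ht) 1 (by decide)
  exact ⟨f', h1, by rw [h2 0 (by decide), hL0]⟩

end Frame

/-! ### The chronological future -/

/-- The open cone is cut out by linear functionals positive on it. For each of them the mean value
theorem along the curve gives positivity on the displacement, so no integration is needed. -/
theorem sub_mem_future_of_mem_chronologicalFuture {q p : M} (h : p ∈ S.chronologicalFuture q) :
    p -ᵥ q ∈ S.future := by
  obtain ⟨γ, v, hγ0, hγ1, hv, hd⟩ := h
  obtain ⟨f, -⟩ := S.exists_frame q
  have key : ∀ φ : Module.Dual ℝ W, (∀ v ∈ S.future, 0 < φ v) → 0 < φ (p -ᵥ q) := by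
    intro φ hφ
    obtain ⟨-, hd'⟩ := hd φ
    obtain ⟨c, hc, hc'⟩ := exists_hasDerivAt_eq_slope (fun s => φ (γ s -ᵥ q)) (fun t => φ (v t))
      zero_lt_one (fun t ht => (hd' t ht).continuousWithinAt)
      (fun t ht => (hd' t (Set.Ioo_subset_Icc_self ht)).hasDerivAt (Icc_mem_nhds ht.1 ht.2))
    have := hφ _ (hv c (Set.Ioo_subset_Icc_self hc))
    rw [hc'] at this
    simpa [hγ0, hγ1] using this
  rw [Frame.mem_future_iff (f := f)]
  set d := p -ᵥ q
  have h0 : 0 < f.basis.repr d 0 := by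
    refine key (f.basis.coord 0) fun v hv => ?_
    exact ((Frame.mem_future_iff (f := f)).1 hv).1
  refine ⟨h0, ?_⟩
  set r := √(f.basis.repr d 1 ^ 2 + f.basis.repr d 2 ^ 2 + f.basis.repr d 3 ^ 2) with hr
  have hr2 : r ^ 2 = f.basis.repr d 1 ^ 2 + f.basis.repr d 2 ^ 2 + f.basis.repr d 3 ^ 2 :=
    Real.sq_sqrt (by positivity)
  rcases (Real.sqrt_nonneg _ : 0 ≤ r).eq_or_lt with h1 | h1
  · have h2 : r = 0 := h1.symm
    rw [← hr2, h2]
    nlinarith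
  -- This functional is positive on the cone by `spatial_lt`; on `d` it equals `r d₀ - r²`, whence
  -- `r < d₀`.
  · have := key (r • f.basis.coord 0 - f.basis.repr d 1 • f.basis.coord 1
      - f.basis.repr d 2 • f.basis.coord 2 - f.basis.repr d 3 • f.basis.coord 3) fun v hv => by
        have hv' := (Frame.mem_future_iff (f := f)).1 hv
        have := spatial_lt h1 hr2.ge hv'.1 hv'.2
        simp only [LinearMap.sub_apply, LinearMap.smul_apply, Module.Basis.coord_apply,
          smul_eq_mul]
        linarith
    simp only [LinearMap.sub_apply, LinearMap.smul_apply, Module.Basis.coord_apply,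
          smul_eq_mul] at this
    rw [← hr2]
    have h2 : r < f.basis.repr d 0 := by
      by_contra hcon
      nlinarith
    gcongr

end Minkowski

end Chasles

namespace Chasles

/-! ### Orthonormal triples in three-dimensional space -/

/-- Completion of a unit vector `n` by a unit vector orthogonal to it. -/
theorem exists_unit_orthogonal (n : Fin 3 → ℝ) :
    ∃ m : Fin 3 → ℝ, m 0 ^ 2 + m 1 ^ 2 + m 2 ^ 2 = 1 ∧
      n 0 * m 0 + n 1 * m 1 + n 2 * m 2 = 0 := by
  by_cases h : n 0 ^ 2 + n 1 ^ 2 = 0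
  · have h0 : n 0 = 0 := by nlinarith [sq_nonneg (n 0), sq_nonneg (n 1)]
    exact ⟨![1, 0, 0], by simp, by simp [h0]⟩
  · have hp : 0 < n 0 ^ 2 + n 1 ^ 2 := lt_of_le_of_ne (by positivity) (Ne.symm h)
    set r := √(n 0 ^ 2 + n 1 ^ 2)
    have hr : r ^ 2 = n 0 ^ 2 + n 1 ^ 2 := Real.sq_sqrt hp.le
    have hr0 : r ≠ 0 := (Real.sqrt_pos.2 hp).ne'
    refine ⟨![-n 1 / r, n 0 / r, 0], ?_, ?_⟩
    · simp
      field_simp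
      linarith
    · simp
      field_simp
      ring

theorem exists_unit_smul (E : Fin 3 → ℝ) :
    ∃ (n : Fin 3 → ℝ) (a : ℝ), n 0 ^ 2 + n 1 ^ 2 + n 2 ^ 2 = 1 ∧ ∀ i, E i = a * n i := by
  by_cases h : E 0 ^ 2 + E 1 ^ 2 + E 2 ^ 2 = 0
  · have h0 : E 0 = 0 := by nlinarith [sq_nonneg (E 0), sq_nonneg (E 1), sq_nonneg (E 2)]
    have h1 : E 1 = 0 := by nlinarith [sq_nonneg (E 0), sq_nonneg (E 1), sq_nonneg (E 2)]
    have h2 : E 2 = 0 := by nlinarith [sq_nonneg (E 0), sq_nonneg (E 1), sq_nonneg (E 2)]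
    refine ⟨![1, 0, 0], 0, by simp, fun i => ?_⟩
    fin_cases i <;> simp [h0, h1, h2]
  · have hp : 0 < E 0 ^ 2 + E 1 ^ 2 + E 2 ^ 2 := lt_of_le_of_ne (by positivity) (Ne.symm h)
    set r := √(E 0 ^ 2 + E 1 ^ 2 + E 2 ^ 2)
    have hr : r ^ 2 = E 0 ^ 2 + E 1 ^ 2 + E 2 ^ 2 := Real.sq_sqrt hp.le
    have hr0 : r ≠ 0 := (Real.sqrt_pos.2 hp).ne'
    refine ⟨fun i => E i / r, r, ?_, fun i => by field_simp⟩
    field_simp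
    linarith

/-- Parallel vectors are multiples of a common unit vector. -/
theorem exists_common_unit {E B : Fin 3 → ℝ} (h0 : E 1 * B 2 = E 2 * B 1)
    (h1 : E 2 * B 0 = E 0 * B 2) (h2 : E 0 * B 1 = E 1 * B 0) :
    ∃ (n : Fin 3 → ℝ) (a b : ℝ), n 0 ^ 2 + n 1 ^ 2 + n 2 ^ 2 = 1 ∧
      (∀ i, E i = a * n i) ∧ ∀ i, B i = b * n i := by
  obtain ⟨n, a, hn, hE⟩ := exists_unit_smul E
  by_cases ha : a = 0
  · obtain ⟨m, b, hm, hB⟩ := exists_unit_smul B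
    exact ⟨m, 0, b, hm, fun i => by simp [hE, ha], hB⟩
  · rw [hE, hE] at h0 h1 h2
    have h0' : n 1 * B 2 = n 2 * B 1 := mul_left_cancel₀ ha (by linarith)
    have h1' : n 2 * B 0 = n 0 * B 2 := mul_left_cancel₀ ha (by linarith)
    have h2' : n 0 * B 1 = n 1 * B 0 := mul_left_cancel₀ ha (by linarith)
    refine ⟨n, a, B 0 * n 0 + B 1 * n 1 + B 2 * n 2, hn, hE, fun i => ?_⟩
    fin_cases i <;> simp only [Fin.zero_eta, Fin.mk_one, Fin.reduceFinMk]
    · linear_combination (-B 0) * hn + n 2 * h1' - n 1 * h2'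
    · linear_combination (-B 1) * hn - n 2 * h0' + n 0 * h2'
    · linear_combination (-B 2) * hn + n 1 * h0' - n 0 * h1'

/-- Orthogonal vectors are multiples of orthonormal vectors, with prescribed signs. -/
theorem exists_orthonormal_pair {E B : Fin 3 → ℝ} (h : E 0 * B 0 + E 1 * B 1 + E 2 * B 2 = 0)
    {a b : ℝ} (ha : a ^ 2 = E 0 ^ 2 + E 1 ^ 2 + E 2 ^ 2)
    (hb : b ^ 2 = B 0 ^ 2 + B 1 ^ 2 + B 2 ^ 2) :
    ∃ n m : Fin 3 → ℝ, n 0 ^ 2 + n 1 ^ 2 + n 2 ^ 2 = 1 ∧ m 0 ^ 2 + m 1 ^ 2 + m 2 ^ 2 = 1 ∧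
      n 0 * m 0 + n 1 * m 1 + n 2 * m 2 = 0 ∧ (∀ i, E i = a * n i) ∧ ∀ i, B i = b * m i := by
  have key : ∀ (E : Fin 3 → ℝ) (a : ℝ), a ^ 2 = E 0 ^ 2 + E 1 ^ 2 + E 2 ^ 2 → a ≠ 0 →
      ∃ n : Fin 3 → ℝ, n 0 ^ 2 + n 1 ^ 2 + n 2 ^ 2 = 1 ∧ ∀ i, E i = a * n i := by
    intro E a ha h0
    refine ⟨fun i => E i / a, ?_, fun i => by field_simp⟩
    field_simp
    linarith
  have key0 : ∀ (E : Fin 3 → ℝ) (a : ℝ), a ^ 2 = E 0 ^ 2 + E 1 ^ 2 + E 2 ^ 2 → a = 0 →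
      ∀ i, E i = 0 := by
    intro E a ha h0
    rw [h0] at ha
    have h0 : E 0 = 0 := by nlinarith [sq_nonneg (E 0), sq_nonneg (E 1), sq_nonneg (E 2)]
    have h1 : E 1 = 0 := by nlinarith [sq_nonneg (E 0), sq_nonneg (E 1), sq_nonneg (E 2)]
    have h2 : E 2 = 0 := by nlinarith [sq_nonneg (E 0), sq_nonneg (E 1), sq_nonneg (E 2)]
    intro i
    fin_cases i <;> assumption
  by_cases ha0 : a = 0
  · have hE := key0 E a ha ha0
    by_cases hb0 : b = 0
    · have hB := key0 B b hb hb0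
      exact ⟨![1, 0, 0], ![0, 1, 0], by simp, by simp, by simp, by simp [hE, ha0],
        by simp [hB, hb0]⟩
    · obtain ⟨m, hm, hB⟩ := key B b hb hb0
      obtain ⟨n, hn, hnm⟩ := exists_unit_orthogonal m
      exact ⟨n, m, hn, hm, by linarith, by simp [hE, ha0], hB⟩
  · obtain ⟨n, hn, hE⟩ := key E a ha ha0
    by_cases hb0 : b = 0
    · have hB := key0 B b hb hb0
      obtain ⟨m, hm, hnm⟩ := exists_unit_orthogonal n
      exact ⟨n, m, hn, hm, hnm, hE, by simp [hB, hb0]⟩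
    · obtain ⟨m, hm, hB⟩ := key B b hb hb0
      refine ⟨n, m, hn, hm, ?_, hE, hB⟩
      simp only [hE, hB] at h
      exact mul_left_cancel₀ (mul_ne_zero ha0 hb0) (by linear_combination h)

/-! ### Electric and magnetic parts of infinitesimal Lorentz transformations -/

namespace Minkowski

variable {W : Type*} [AddCommGroup W] [Module ℝ W] {S : Minkowski W}

/-- `F` is an infinitesimal Lorentz transformation. -/
def IsSkew (S : Minkowski W) (F : W →ₗ[ℝ] W) : Prop := ∀ u v, S.η u (F v) + S.η (F u) v = 0

namespace Frame

variable {M : Type*} [AddTorsor W M] {f : S.Frame M}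

/-- `F` has the electric components `E` and the magnetic components `B` in the frame `f`. -/
def HasComp (f : S.Frame M) (F : W →ₗ[ℝ] W) (E B : Fin 3 → ℝ) : Prop := ∀ v,
  f.basis.repr (F v) 0
    = E 0 * f.basis.repr v 1 + E 1 * f.basis.repr v 2 + E 2 * f.basis.repr v 3 ∧
  f.basis.repr (F v) 1
    = E 0 * f.basis.repr v 0 + B 1 * f.basis.repr v 3 - B 2 * f.basis.repr v 2 ∧
  f.basis.repr (F v) 2
    = E 1 * f.basis.repr v 0 + B 2 * f.basis.repr v 1 - B 0 * f.basis.repr v 3 ∧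
  f.basis.repr (F v) 3
    = E 2 * f.basis.repr v 0 + B 0 * f.basis.repr v 2 - B 1 * f.basis.repr v 1

theorem repr_expand (f : S.Frame M) (F : W →ₗ[ℝ] W) (v : W) (i : Fin 4) : f.basis.repr (F v) i =
    f.basis.repr v 0 * f.basis.repr (F (f.basis 0)) i
    + f.basis.repr v 1 * f.basis.repr (F (f.basis 1)) i
    + f.basis.repr v 2 * f.basis.repr (F (f.basis 2)) i
    + f.basis.repr v 3 * f.basis.repr (F (f.basis 3)) i := by
  have h : v = f.basis.repr v 0 • f.basis 0 + f.basis.repr v 1 • f.basis 1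
      + f.basis.repr v 2 • f.basis 2 + f.basis.repr v 3 • f.basis 3 := by
    rw [← Fin.sum_univ_four (fun i => f.basis.repr v i • f.basis i), f.basis.sum_repr]
  conv_lhs => rw [h]
  simp only [map_add, map_smul, Finsupp.add_apply, Finsupp.smul_apply, smul_eq_mul]

/-- Skewness on pairs of basis vectors kills the diagonal of `F` and relates opposite entries, with
equal signs for time-space pairs and opposite signs for space-space pairs. -/
theorem exists_hasComp (f : S.Frame M) {F : W →ₗ[ℝ] W} (hF : S.IsSkew F) :
    ∃ E B : Fin 3 → ℝ, f.HasComp F E B := by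
  have h : ∀ i j, S.η (f.basis i) (F (f.basis j)) + S.η (F (f.basis i)) (f.basis j) = 0 :=
    fun i j => hF _ _
  simp only [f.eta_apply, repr_basis] at h
  have h00 := h 0 0
  have h01 := h 0 1
  have h02 := h 0 2
  have h03 := h 0 3
  have h11 := h 1 1
  have h12 := h 1 2
  have h13 := h 1 3
  have h22 := h 2 2
  have h23 := h 2 3
  have h33 := h 3 3
  simp only [Fin.reduceEq, if_true, if_false] at h00 h01 h02 h03 h11 h12 h13 h22 h23 h33
  refine ⟨![f.basis.repr (F (f.basis 0)) 1, f.basis.repr (F (f.basis 0)) 2,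
    f.basis.repr (F (f.basis 0)) 3], ![f.basis.repr (F (f.basis 2)) 3,
    f.basis.repr (F (f.basis 3)) 1, f.basis.repr (F (f.basis 1)) 2], fun v => ⟨?_, ?_, ?_, ?_⟩⟩
  all_goals
    rw [repr_expand]
    simp only [Matrix.cons_val]
  · linear_combination (-f.basis.repr v 0 / 2) * h00 - f.basis.repr v 1 * h01
      - f.basis.repr v 2 * h02 - f.basis.repr v 3 * h03
  · linear_combination (f.basis.repr v 1 / 2) * h11 + f.basis.repr v 2 * h12
  · linear_combination (f.basis.repr v 2 / 2) * h22 + f.basis.repr v 3 * h23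
  · linear_combination (f.basis.repr v 3 / 2) * h33 + f.basis.repr v 1 * h13

theorem HasComp.isSkew {F : W →ₗ[ℝ] W} {E B : Fin 3 → ℝ} (h : f.HasComp F E B) :
    S.IsSkew F := by
  intro u v
  obtain ⟨u0, u1, u2, u3⟩ := h u
  obtain ⟨v0, v1, v2, v3⟩ := h v
  rw [f.eta_apply, f.eta_apply, u0, u1, u2, u3, v0, v1, v2, v3]
  ring

/-- The combination `Σ nᵢ eᵢ` of the spatial vectors of the frame. -/
noncomputable def spatial (f : S.Frame M) (n : Fin 3 → ℝ) : W :=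
  n 0 • f.basis 1 + n 1 • f.basis 2 + n 2 • f.basis 3

theorem repr_spatial (n : Fin 3 → ℝ) : f.basis.repr (f.spatial n) 0 = 0 ∧
    f.basis.repr (f.spatial n) 1 = n 0 ∧ f.basis.repr (f.spatial n) 2 = n 1 ∧
    f.basis.repr (f.spatial n) 3 = n 2 := by
  simp [spatial]

/-- Rotation of a frame to a given orthonormal triple, up to the sign of one vector. -/
theorem exists_rotated (f : S.Frame M) {n m l : Fin 3 → ℝ}
    (hn : n 0 ^ 2 + n 1 ^ 2 + n 2 ^ 2 = 1) (hm : m 0 ^ 2 + m 1 ^ 2 + m 2 ^ 2 = 1)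
    (hl : l 0 ^ 2 + l 1 ^ 2 + l 2 ^ 2 = 1) (hnm : n 0 * m 0 + n 1 * m 1 + n 2 * m 2 = 0)
    (hnl : n 0 * l 0 + n 1 * l 1 + n 2 * l 2 = 0) (hml : m 0 * l 0 + m 1 * l 1 + m 2 * l 2 = 0) :
    ∃ f' : S.Frame M, f'.origin = f.origin ∧ f'.basis 0 = f.basis 0 ∧
      f'.basis 1 = f.spatial n ∧ f'.basis 2 = f.spatial m ∧
      (f'.basis 3 = f.spatial l ∨ f'.basis 3 = -f.spatial l) := by
  obtain ⟨n0, n1, n2, n3⟩ := repr_spatial (f := f) n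
  obtain ⟨m0, m1, m2, m3⟩ := repr_spatial (f := f) m
  obtain ⟨l0, l1, l2, l3⟩ := repr_spatial (f := f) l
  obtain ⟨f', h1, h2, h3⟩ := exists_frame_of_orthonormal (S := S) f.origin
    (v := ![f.basis 0, f.spatial n, f.spatial m, f.spatial l]) (by
      intro a b
      fin_cases a <;> fin_cases b <;>
      simp [f.eta_apply, n0, n1, n2, n3, m0, m1, m2, m3, l0, l1, l2, l3, etaMat] <;>
      linarith) f.future 3 (by decide)
  exact ⟨f', h1, h2 0 (by decide), h2 1 (by decide), h2 2 (by decide), h3⟩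

theorem cross_orthonormal {n m : Fin 3 → ℝ} (hn : n 0 ^ 2 + n 1 ^ 2 + n 2 ^ 2 = 1)
    (hm : m 0 ^ 2 + m 1 ^ 2 + m 2 ^ 2 = 1) (hnm : n 0 * m 0 + n 1 * m 1 + n 2 * m 2 = 0) :
    (n 1 * m 2 - n 2 * m 1) ^ 2 + (n 2 * m 0 - n 0 * m 2) ^ 2 + (n 0 * m 1 - n 1 * m 0) ^ 2
      = 1 := by
  linear_combination (m 0 ^ 2 + m 1 ^ 2 + m 2 ^ 2) * hn + hm
    - (n 0 * m 0 + n 1 * m 1 + n 2 * m 2) * hnm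

/-- If the electric and magnetic parts are parallel, they can be rotated to the first axis. -/
theorem exists_aligned_of_parallel {F : W →ₗ[ℝ] W} {E B : Fin 3 → ℝ} (h : f.HasComp F E B)
    (h0 : E 1 * B 2 = E 2 * B 1) (h1 : E 2 * B 0 = E 0 * B 2) (h2 : E 0 * B 1 = E 1 * B 0) :
    ∃ (f' : S.Frame M) (α β : ℝ), f'.origin = f.origin ∧ f'.basis 0 = f.basis 0 ∧
      f'.HasComp F ![α, 0, 0] ![β, 0, 0] := by
  obtain ⟨n, a, b, hn, hE, hB⟩ := exists_common_unit h0 h1 h2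
  obtain ⟨m, hm, hnm⟩ := exists_unit_orthogonal n
  obtain ⟨f', ho, he0, he1, -, -⟩ := f.exists_rotated (n := n) (m := m)
    (l := ![n 1 * m 2 - n 2 * m 1, n 2 * m 0 - n 0 * m 2, n 0 * m 1 - n 1 * m 0]) hn hm
    (by simpa using cross_orthonormal hn hm hnm) hnm (by simp; ring) (by simp; ring)
  obtain ⟨E', B', h'⟩ := f'.exists_hasComp h.isSkew
  obtain ⟨n0, n1, n2, n3⟩ := repr_spatial (f := f) n
  -- The images of `e₀` and `e₁` determine every component except `B' 0`. That one is left
  -- unspecified, since the sign of the third spatial vector is not controlled.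
  have hF0 : F (f'.basis 0) = a • f'.basis 1 := by
    obtain ⟨q0, q1, q2, q3⟩ := h (f.basis 0)
    rw [he0, he1]
    apply ext_repr (f := f) <;> simp [n0, n1, n2, n3, q0, q1, q2, q3, hE]
  have hF1 : F (f'.basis 1) = a • f'.basis 0 := by
    obtain ⟨q0, q1, q2, q3⟩ := h (f.spatial n)
    rw [he0, he1]
    apply ext_repr (f := f) <;> simp [n0, n1, n2, n3, q0, q1, q2, q3, hE, hB] <;>
      first | ring1 | linear_combination a * hn
  obtain ⟨-, p1, p2, p3⟩ := h' (f'.basis 0)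
  obtain ⟨-, -, r2, r3⟩ := h' (f'.basis 1)
  rw [hF0] at p1 p2 p3
  rw [hF1] at r2 r3
  simp at p1 p2 p3 r2 r3
  refine ⟨f', a, B' 0, ho, he0, ?_⟩
  have hE' : E' = ![a, 0, 0] := by
    ext i; fin_cases i <;> simp [← p1, ← p2, ← p3]
  have hB' : B' = ![B' 0, 0, 0] := by
    ext i; fin_cases i <;> simp [← r2, r3]
  rw [← hB', ← hE']
  exact h'

/-- If the electric and magnetic parts are orthogonal, they can be rotated to the second and
third axes, with prescribed signs. -/
theorem exists_perp_of_orthogonal {F : W →ₗ[ℝ] W} {E B : Fin 3 → ℝ} (h : f.HasComp F E B)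
    (hEB : E 0 * B 0 + E 1 * B 1 + E 2 * B 2 = 0)
    {α β : ℝ} (hα : α ^ 2 = E 0 ^ 2 + E 1 ^ 2 + E 2 ^ 2)
    (hβ : β ^ 2 = B 0 ^ 2 + B 1 ^ 2 + B 2 ^ 2) :
    ∃ f' : S.Frame M, f'.origin = f.origin ∧ f'.basis 0 = f.basis 0 ∧
      f'.HasComp F ![0, α, 0] ![0, 0, -β] := by
  obtain ⟨n, m, hn, hm, hnm, hE, hB⟩ := exists_orthonormal_pair hEB hα
    (b := -β) (by linear_combination hβ)
  have hl := cross_orthonormal hn hm hnm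
  let l : Fin 3 → ℝ := ![n 1 * m 2 - n 2 * m 1, n 2 * m 0 - n 0 * m 2, n 0 * m 1 - n 1 * m 0]
  have l0 : l 0 = n 1 * m 2 - n 2 * m 1 := rfl
  have l1 : l 1 = n 2 * m 0 - n 0 * m 2 := rfl
  have l2 : l 2 = n 0 * m 1 - n 1 * m 0 := rfl
  -- The cross product is placed first, so that the vector of uncontrolled sign is the third one.
  -- The components are then read off from the images of `e₀`, `e₁`, `e₂` alone, and the sign of `β`
  -- is as prescribed.
  obtain ⟨f', ho, he0, he1, he2, -⟩ := f.exists_rotated (n := l) (m := n) (l := m)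
    (by rw [l0, l1, l2]; exact hl) hn hm (by rw [l0, l1, l2]; ring) (by rw [l0, l1, l2]; ring)
    hnm
  obtain ⟨E', B', h'⟩ := f'.exists_hasComp h.isSkew
  obtain ⟨n0, n1, n2, n3⟩ := repr_spatial (f := f) n
  obtain ⟨k0, k1, k2, k3⟩ := repr_spatial (f := f) l
  have hF0 : F (f'.basis 0) = α • f'.basis 2 := by
    obtain ⟨q0, q1, q2, q3⟩ := h (f.basis 0)
    rw [he0, he2]
    apply ext_repr (f := f) <;> simp [n0, n1, n2, n3, q0, q1, q2, q3, hE]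
  have hF1 : F (f'.basis 1) = -β • f'.basis 2 := by
    obtain ⟨q0, q1, q2, q3⟩ := h (f.spatial l)
    rw [he1, he2]
    apply ext_repr (f := f) <;>
      simp only [map_smul, Finsupp.smul_apply, smul_eq_mul, n0, n1, n2, n3, q0, q1, q2, q3, k0, k1,
        k2, k3, hE, hB, l0, l1, l2]
    · ring
    · linear_combination -β * n 0 * hm + β * m 0 * hnm
    · linear_combination -β * n 1 * hm + β * m 1 * hnm
    · linear_combination -β * n 2 * hm + β * m 2 * hnm
  have hF2 : f'.basis.repr (F (f'.basis 2)) 3 = 0 := by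
    have hF2 : F (f'.basis 2) = α • f'.basis 0 + β • f'.basis 1 := by
      obtain ⟨q0, q1, q2, q3⟩ := h (f.spatial n)
      rw [he0, he1, he2]
      apply ext_repr (f := f) <;> simp [n0, n1, n2, n3, q0, q1, q2, q3, hE, hB, k0, k1, k2, k3,
        l0, l1, l2] <;>
        first | ring1 | linear_combination α * hn
    simp [hF2]
  obtain ⟨-, p1, p2, p3⟩ := h' (f'.basis 0)
  obtain ⟨-, -, r2, r3⟩ := h' (f'.basis 1)
  obtain ⟨-, -, -, s3⟩ := h' (f'.basis 2)
  rw [hF0] at p1 p2 p3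
  rw [hF1] at r2 r3
  rw [hF2] at s3
  simp at p1 p2 p3 r2 r3 s3
  refine ⟨f', ho, he0, ?_⟩
  have hE' : E' = ![0, α, 0] := by
    ext i; fin_cases i <;> simp [← p1, ← p2, ← p3]
  have hB' : B' = ![0, 0, -β] := by
    ext i; fin_cases i <;> simp [← r2, r3, ← s3]
  rw [← hB', ← hE']
  exact h'

/-- An infinitesimal Lorentz transformation which is not null has a timelike eigenvector of its
square. -/
theorem exists_aligned_of_not_null {F : W →ₗ[ℝ] W} {E B : Fin 3 → ℝ} (h : f.HasComp F E B)
    (hEB : ¬ (E 0 * B 0 + E 1 * B 1 + E 2 * B 2 = 0 ∧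
      E 0 ^ 2 + E 1 ^ 2 + E 2 ^ 2 = B 0 ^ 2 + B 1 ^ 2 + B 2 ^ 2)) (o : M) :
    ∃ (f' : S.Frame M) (α β : ℝ), f'.origin = o ∧ f'.HasComp F ![α, 0, 0] ![β, 0, 0] := by
  obtain ⟨q, hq⟩ : ∃ x, x = E 0 * B 0 + E 1 * B 1 + E 2 * B 2 := ⟨_, rfl⟩
  rw [← hq] at hEB
  obtain ⟨e, he⟩ : ∃ x, x = E 0 ^ 2 + E 1 ^ 2 + E 2 ^ 2 := ⟨_, rfl⟩
  rw [← he] at hEB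
  obtain ⟨b, hb⟩ : ∃ x, x = B 0 ^ 2 + B 1 ^ 2 + B 2 ^ 2 := ⟨_, rfl⟩
  rw [← hb] at hEB
  have he0 : 0 ≤ e := by rw [he]; positivity
  have hb0 : 0 ≤ b := by rw [hb]; positivity
  obtain ⟨r, hr0⟩ : ∃ x, x = √((e - b) ^ 2 + 4 * q ^ 2) := ⟨_, rfl⟩
  have hr2 : r ^ 2 = (e - b) ^ 2 + 4 * q ^ 2 := by rw [hr0]; exact Real.sq_sqrt (by positivity)
  have hr : 0 < r := by
    rw [hr0]
    refine Real.sqrt_pos.2 (lt_of_le_of_ne (by positivity) fun h0 => hEB ?_)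
    have h1 : q = 0 := by nlinarith [sq_nonneg (e - b), sq_nonneg q]
    have h2 : e - b = 0 := by nlinarith [sq_nonneg (e - b), sq_nonneg q]
    exact ⟨h1, by linarith⟩
  have hr1 : |e - b| ≤ r := hr0 ▸ Real.abs_le_sqrt (by nlinarith [sq_nonneg q])
  obtain ⟨hr3, hr4⟩ := abs_le.1 hr1
  -- The eigenvalues of `F²` are `μ` and `-ν`, the roots of `x² - (e - b) x - q²`; they are distinct
  -- because `r = μ + ν > 0`.
  obtain ⟨μ, hμ⟩ : ∃ x, x = (e - b + r) / 2 := ⟨_, rfl⟩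
  obtain ⟨ν, hν⟩ : ∃ x, x = (-(e - b) + r) / 2 := ⟨_, rfl⟩
  have hμ0 : 0 ≤ μ := by rw [hμ]; linarith
  have hν0 : 0 ≤ ν := by rw [hν]; linarith
  have hμν : μ - ν = e - b := by rw [hμ, hν]; ring
  have hμν' : μ * ν = q ^ 2 := by rw [hμ, hν]; linear_combination hr2 / 4
  have hμν2 : μ + ν = r := by rw [hμ, hν]; ring
  have heν : 0 < e + ν := by
    refine lt_of_le_of_ne (by positivity) fun h0 => ?_
    have h1 : e = 0 := by linarith
    have h2 : ν = 0 := by linarith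
    linarith
  -- Since `(F² - μ)(F² + ν) = 0`, applying `F² + ν` to `e₀` lands in the `μ`-eigenspace of `F²`.
  -- The result turns out to be timelike.
  let u : W := F (F (f.basis 0)) + ν • f.basis 0
  obtain ⟨p0, p1, p2, p3⟩ := h (f.basis 0)
  obtain ⟨q0, q1, q2, q3⟩ := h (F (f.basis 0))
  simp only [repr_basis, Fin.reduceEq, if_true, if_false, mul_one, mul_zero, add_zero, sub_zero]
    at p0 p1 p2 p3
  rw [p1, p2, p3] at q0
  rw [p0, p2, p3] at q1
  rw [p0, p1, p3] at q2
  rw [p0, p1, p2] at q3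
  have u0 : f.basis.repr u 0 = e + ν := by simp [u, q0, he]; ring
  have u1 : f.basis.repr u 1 = B 1 * E 2 - B 2 * E 1 := by simp [u, q1]
  have u2 : f.basis.repr u 2 = B 2 * E 0 - B 0 * E 2 := by simp [u, q2]
  have u3 : f.basis.repr u 3 = B 0 * E 1 - B 1 * E 0 := by simp [u, q3]
  have huu : S.η u u = -((e + ν) * r) := by
    rw [f.eta_apply, u0, u1, u2, u3]
    have : (B 1 * E 2 - B 2 * E 1) ^ 2 + (B 2 * E 0 - B 0 * E 2) ^ 2 + (B 0 * E 1 - B 1 * E 0) ^ 2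
      = e * b - q ^ 2 := by rw [he, hb, hq]; ring
    linear_combination this + hμν' - (e + ν) * hμν2 + e * hμν
  have hneg : 0 < (e + ν) * r := mul_pos heν hr
  have huf : u ∈ S.future := by
    refine mem_future_iff.2 ⟨by rw [u0]; exact heν, ?_⟩
    rw [f.eta_apply] at huu
    simp only [sq]
    linarith
  have hFu : F (F u) = μ • u := by
    obtain ⟨a0, a1, a2, a3⟩ := h u
    obtain ⟨c0, c1, c2, c3⟩ := h (F u)
    rw [a1, a2, a3] at c0
    rw [a0, a2, a3] at c1
    rw [a0, a1, a3] at c2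
    rw [a0, a1, a2] at c3
    have hν' : ν = μ - (e - b) := by linarith
    have hq2 : q ^ 2 = μ ^ 2 - (e - b) * μ := by rw [← hμν', hν']; ring
    apply ext_repr (f := f) <;> simp only [map_smul, Finsupp.smul_apply, smul_eq_mul]
    · rw [c0, u0, u1, u2, u3, hν']
      rw [hq, he, hb] at hq2
      rw [he, hb]
      linear_combination hq2
    · rw [c1, u0, u1, u2, u3, hν', he, hb]
      ring
    · rw [c2, u0, u1, u2, u3, hν', he, hb]
      ring
    · rw [c3, u0, u1, u2, u3, hν', he, hb]
      ring
  obtain ⟨c, hc0⟩ : ∃ x, x = √((e + ν) * r) := ⟨_, rfl⟩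
  have hc : 0 < c := hc0 ▸ Real.sqrt_pos.2 hneg
  have hc2 : c ^ 2 = (e + ν) * r := by rw [hc0]; exact Real.sq_sqrt hneg.le
  obtain ⟨f₁, ho, h0⟩ := f.exists_frame_of_future o (t := c⁻¹ • u)
    (smul_mem_future huf (inv_pos.2 hc)) (by
      simp only [map_smul, LinearMap.smul_apply, smul_eq_mul, huu, ← hc2]
      field_simp)
  obtain ⟨E', B', h'⟩ := f₁.exists_hasComp h.isSkew
  -- In a frame with this time direction, the spatial part of `F² e₀`, which is the cross product of
  -- `E'` and `B'` up to sign, vanishes; so the two are parallel.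
  have hFF : F (F (f₁.basis 0)) = μ • f₁.basis 0 := by
    rw [h0, map_smul, map_smul, hFu, smul_comm]
  obtain ⟨p0, p1, p2, p3⟩ := h' (f₁.basis 0)
  obtain ⟨q0, q1, q2, q3⟩ := h' (F (f₁.basis 0))
  rw [hFF] at q0 q1 q2 q3
  rw [p0, p2, p3] at q1
  rw [p0, p1, p3] at q2
  rw [p0, p1, p2] at q3
  simp at q1 q2 q3
  obtain ⟨f', α, β, ho', -, h''⟩ := exists_aligned_of_parallel h' (by linarith) (by linarith)
    (by linarith)
  exact ⟨f', α, β, ho'.trans ho, h''⟩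

end Frame

end Minkowski

end Chasles

namespace Chasles

/-! ### Exponentials of the generators -/

theorem alignedGen_eq (a ω : ℝ) : alignedGen a ω =
    !![0, -a, 0, 0, -1; -a, 0, 0, 0, 0; 0, 0, 0, ω, 0; 0, 0, -ω, 0, 0; 0, 0, 0, 0, 0] := by
  ext i j
  fin_cases i <;> fin_cases j <;>
    simp [alignedGen, genK, genJ1, genJJ, genH, genP, block, etaMat]

theorem perpGen_eq (a ω : ℝ) : perpGen a ω =
    !![0, 0, -a, 0, -1; 0, 0, -ω, 0, 0; -a, ω, 0, 0, 0; 0, 0, 0, 0, 0; 0, 0, 0, 0, 0] := by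
  ext i j
  fin_cases i <;> fin_cases j <;>
    simp [perpGen, genK, genJ3, genJJ, genH, genP, block, etaMat]

section

open scoped Matrix.Norms.Operator

variable {n : Type*} [Fintype n] [DecidableEq n]

/-- The exponential is characterized by its differential equation. -/
theorem exp_smul_eq_of_hasDerivAt (A : Matrix n n ℝ) (G : ℝ → Matrix n n ℝ) (h0 : G 0 = 1)
    (hd : ∀ t i j, HasDerivAt (fun s => G s i j) ((A * G t) i j) t) (t : ℝ) :
    NormedSpace.exp (t • A) = G t := by
  have hG : ∀ t, HasDerivAt G (A * G t) t := fun t =>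
    hasDerivAt_pi.2 fun i => hasDerivAt_pi.2 fun j => hd t i j
  have hE : ∀ t : ℝ, HasDerivAt (fun u : ℝ => NormedSpace.exp (u • -A))
      (NormedSpace.exp (t • -A) * -A) t := fun t => hasDerivAt_exp_smul_const (-A) t
  have hD : ∀ t, HasDerivAt (fun s => NormedSpace.exp (s • -A) * G s) 0 t := fun t => by
    have := (hE t).mul (hG t)
    refine this.congr_deriv ?_
    noncomm_ring
  have hconst : NormedSpace.exp (t • -A) * G t = 1 := by
    have := is_const_of_deriv_eq_zero (fun t => (hD t).differentiableAt) (fun t => (hD t).deriv) t 0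
    simpa [h0] using this
  have hinv : NormedSpace.exp (t • A) * NormedSpace.exp (t • -A) = 1 := by
    rw [← Matrix.exp_add_of_commute _ _ ((Commute.refl A).neg_right.smul_left t |>.smul_right t)]
    simp
  calc NormedSpace.exp (t • A)
      = NormedSpace.exp (t • A) * (NormedSpace.exp (t • -A) * G t) := by rw [hconst, mul_one]
    _ = G t := by rw [← mul_assoc, hinv, one_mul]

/-- The exponential of a matrix with `A⁴ = 0`. -/
theorem exp_of_pow_four_eq_zero {A : Matrix n n ℝ} (hA : A * (A * (A * A)) = 0) (t : ℝ) :
    NormedSpace.exp (t • A) = 1 + t • A + (t ^ 2 / 2) • (A * A) + (t ^ 3 / 6) • (A * (A * A)) := by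
  refine exp_smul_eq_of_hasDerivAt A
    (fun t => 1 + t • A + (t ^ 2 / 2) • (A * A) + (t ^ 3 / 6) • (A * (A * A))) (by simp) ?_ t
  intro t i j
  simp only [Matrix.mul_add, Matrix.mul_smul, hA, Matrix.add_apply, Matrix.smul_apply, smul_eq_mul,
    mul_one, smul_zero, Matrix.zero_apply]
  have h1 := (hasDerivAt_id' t)
  have h2 := ((hasDerivAt_id' t).pow 2).div_const 2
  have h3 := ((hasDerivAt_id' t).pow 3).div_const 6
  have := (((hasDerivAt_const t ((1 : Matrix n n ℝ) i j)).add (h1.mul_const (A i j))).add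
    (h2.mul_const ((A * A) i j))).add (h3.mul_const ((A * (A * A)) i j))
  refine this.congr_deriv ?_
  simp only [Nat.cast_ofNat, Nat.add_one_sub_one, pow_one]
  ring

/-- The exponential of a matrix with `A⁴ = κ² A²`, `κ ≠ 0`. -/
theorem exp_of_pow_four_eq_smul {A : Matrix n n ℝ} {κ : ℝ} (hκ : κ ≠ 0)
    (hA : A * (A * (A * A)) = κ ^ 2 • (A * A)) (t : ℝ) :
    NormedSpace.exp (t • A) = 1 + t • A + ((Real.cosh (κ * t) - 1) / κ ^ 2) • (A * A)
      + ((Real.sinh (κ * t) - κ * t) / κ ^ 3) • (A * (A * A)) := by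
  refine exp_smul_eq_of_hasDerivAt A (fun t => 1 + t • A
    + ((Real.cosh (κ * t) - 1) / κ ^ 2) • (A * A)
    + ((Real.sinh (κ * t) - κ * t) / κ ^ 3) • (A * (A * A))) (by simp) ?_ t
  intro t i j
  simp only [Matrix.mul_add, Matrix.mul_smul, hA, Matrix.add_apply, Matrix.smul_apply, smul_eq_mul,
    mul_one]
  have h0 := (hasDerivAt_id' t).const_mul κ
  have h1 := (hasDerivAt_id' t)
  have h2 := (h0.cosh.sub_const 1).div_const (κ ^ 2)
  have h3 := (h0.sinh.sub h0).div_const (κ ^ 3)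
  have := (((hasDerivAt_const t ((1 : Matrix n n ℝ) i j)).add (h1.mul_const (A i j))).add
    (h2.mul_const ((A * A) i j))).add (h3.mul_const ((A * (A * A)) i j))
  refine this.congr_deriv ?_
  field_simp
  ring

/-- A covector annihilated by `X²` sees only the linear part of the exponential. -/
theorem vecMul_exp_of_sq {X : Matrix n n ℝ} {u : n → ℝ}
    (hu : Matrix.vecMul (Matrix.vecMul u X) X = 0) :
    Matrix.vecMul u (NormedSpace.exp X) = u + Matrix.vecMul u X := by
  have hE : ∀ (x : n → ℝ) (t : ℝ) (i : n), HasDerivAt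
      (fun s : ℝ => Matrix.vecMul x (NormedSpace.exp (s • X)) i)
      (Matrix.vecMul (Matrix.vecMul x X) (NormedSpace.exp (t • X)) i) t := by
    intro x t i
    have h := hasDerivAt_pi.1 (hasDerivAt_exp_smul_const' X t)
    have h' : HasDerivAt (fun s : ℝ => ∑ j, x j * NormedSpace.exp (s • X) j i)
        (∑ j, x j * (X * NormedSpace.exp (t • X)) j i) t :=
      HasDerivAt.fun_sum fun j _ => ((hasDerivAt_pi.1 (h j)) i).const_mul (x j)
    rw [Matrix.vecMul_vecMul]
    exact h'
  -- The row `u X exp(tX)` has derivative `u X² exp(tX) = 0`, so it keeps its value `u X` at `t =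
  -- 0`; thus `u exp(tX)` is affine in `t`.
  have h1 : ∀ (t : ℝ) (i : n), Matrix.vecMul (Matrix.vecMul u X) (NormedSpace.exp (t • X)) i
      = Matrix.vecMul u X i := by
    intro t i
    have hd : ∀ t : ℝ, HasDerivAt
      (fun s : ℝ => Matrix.vecMul (Matrix.vecMul u X) (NormedSpace.exp (s • X)) i) 0 t := fun t =>
        (hE (Matrix.vecMul u X) t i).congr_deriv (by rw [hu]; simp)
    have := is_const_of_deriv_eq_zero (fun t => (hd t).differentiableAt) (fun t => (hd t).deriv) t 0
    simpa using this
  ext i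
  have hd : ∀ t : ℝ, HasDerivAt
      (fun s : ℝ => Matrix.vecMul u (NormedSpace.exp (s • X)) i - s * Matrix.vecMul u X i) 0 t :=
    fun t => ((hE u t i).sub ((hasDerivAt_id' t).mul_const _)).congr_deriv (by rw [h1]; simp)
  have := is_const_of_deriv_eq_zero (fun t => (hd t).differentiableAt) (fun t => (hd t).deriv) 1 0
  simp only [one_smul, one_mul, zero_smul, NormedSpace.exp_zero, Matrix.vecMul_one, zero_mul,
    sub_zero] at this
  simp only [Pi.add_apply]
  linarith

end

theorem hasDerivAt_sinhDiv (a t : ℝ) : HasDerivAt (sinhDiv a) (Real.cosh (a * t)) t := by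
  by_cases ha : a = 0
  · have : sinhDiv a = fun t => t := by ext t; simp [sinhDiv, ha]
    rw [this, ha]
    simpa using hasDerivAt_id' t
  · have : sinhDiv a = fun t => 1 / a * Real.sinh (a * t) := by ext t; simp [sinhDiv, ha]
    rw [this]
    refine ((((hasDerivAt_id' t).const_mul a).sinh).const_mul (1 / a)).congr_deriv ?_
    field_simp

theorem hasDerivAt_coshDiv (a t : ℝ) : HasDerivAt (coshDiv a) (Real.sinh (a * t)) t := by
  by_cases ha : a = 0
  · have : coshDiv a = fun t => 0 := by ext t; simp [coshDiv, ha]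
    rw [this, ha]
    simpa using hasDerivAt_const t (0 : ℝ)
  · have : coshDiv a = fun t => 1 / a * (Real.cosh (a * t) - 1) := by ext t; simp [coshDiv, ha]
    rw [this]
    refine (((((hasDerivAt_id' t).const_mul a).cosh).sub_const 1).const_mul (1 / a)).congr_deriv ?_
    field_simp

theorem mul_sinhDiv (a t : ℝ) : a * sinhDiv a t = Real.sinh (a * t) := by
  by_cases ha : a = 0
  · simp [sinhDiv, ha]
  · simp only [sinhDiv, ha, if_false]
    field_simp

theorem mul_coshDiv (a t : ℝ) : a * coshDiv a t = Real.cosh (a * t) - 1 := by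
  by_cases ha : a = 0
  · simp [coshDiv, ha]
  · simp only [coshDiv, ha, if_false]
    field_simp

/-- The differential equation is checked entry by entry; `sinhDiv` and `coshDiv` are primitives of
`cosh (a t)` and `sinh (a t)`, so `a = 0` needs no separate treatment here. -/
theorem exp_alignedGen (a ω τ : ℝ) : NormedSpace.exp (τ • alignedGen a ω) = matA a ω τ := by
  refine exp_smul_eq_of_hasDerivAt (alignedGen a ω) (matA a ω) ?_ ?_ τ
  · ext i j
    fin_cases i <;> fin_cases j <;> simp [matA, sinhDiv, coshDiv]
  · intro t i j
    have h1 := ((hasDerivAt_id' t).const_mul a).cosh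
    have h2 := ((hasDerivAt_id' t).const_mul a).sinh
    have h3 := ((hasDerivAt_id' t).const_mul ω).cos
    have h4 := ((hasDerivAt_id' t).const_mul ω).sin
    have h5 := hasDerivAt_sinhDiv a t
    have h6 := hasDerivAt_coshDiv a t
    have h7 := mul_sinhDiv a t
    have h8 := mul_coshDiv a t
    rw [alignedGen_eq]
    fin_cases i <;> fin_cases j <;>
      simp only [matA, Matrix.mul_apply, Fin.sum_univ_five, Fin.zero_eta, Fin.mk_one,
        Fin.reduceFinMk, Matrix.of_apply, Matrix.cons_val, zero_mul, mul_zero, add_zero,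
        zero_add, mul_one] <;>
      first
        | exact hasDerivAt_const _ _
        | exact h1.congr_deriv (by ring)
        | exact h3.congr_deriv (by ring)
        | exact h4.congr_deriv (by ring)
        | exact h2.neg.congr_deriv (by ring)
        | exact h4.neg.congr_deriv (by ring)
        | exact h5.neg.congr_deriv (by linarith)
        | exact h6.congr_deriv (by linarith)

/-- For equal parameters the generator is nilpotent with vanishing fourth power, so the exponential
is a cubic polynomial. -/
theorem exp_perpGen_of_eq (a τ : ℝ) : NormedSpace.exp (τ • perpGen a a) = matB a τ := by
  have h2 : perpGen a a * perpGen a a = !![a ^ 2, -a ^ 2, 0, 0, 0; a ^ 2, -a ^ 2, 0, 0, 0;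
      0, 0, 0, 0, a; 0, 0, 0, 0, 0; 0, 0, 0, 0, 0] := by
    rw [perpGen_eq]
    ext i j
    fin_cases i <;> fin_cases j <;> simp [Matrix.mul_apply, Fin.sum_univ_five] <;> ring
  have h3 : perpGen a a * (perpGen a a * perpGen a a) = !![0, 0, 0, 0, -a ^ 2; 0, 0, 0, 0, -a ^ 2;
      0, 0, 0, 0, 0; 0, 0, 0, 0, 0; 0, 0, 0, 0, 0] := by
    rw [h2, perpGen_eq]
    ext i j
    fin_cases i <;> fin_cases j <;> simp [Matrix.mul_apply, Fin.sum_univ_five] <;> ring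
  rw [exp_of_pow_four_eq_zero, h3, h2, perpGen_eq]
  · ext i j
    fin_cases i <;> fin_cases j <;> simp [matB] <;> ring
  · rw [h3, perpGen_eq]
    ext i j
    fin_cases i <;> fin_cases j <;> simp [Matrix.mul_apply, Fin.sum_univ_five]

/-- The generator satisfies `A⁴ = κ² A²` with `κ² = a² - ω² > 0`. The factor `γ` is `a / κ`, hence
`a τ / γ = κ τ`. -/
theorem exp_perpGen_of_lt {a ω : ℝ} (τ : ℝ) (hω : 0 ≤ ω) (ha : ω < a) :
    NormedSpace.exp (τ • perpGen a ω) = matC a ω τ := by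
  have ha0 : 0 < a := hω.trans_lt ha
  have hp : 0 < a ^ 2 - ω ^ 2 := by nlinarith
  obtain ⟨κ, hκ⟩ : ∃ κ, κ = √(a ^ 2 - ω ^ 2) := ⟨_, rfl⟩
  have hκ0 : 0 < κ := hκ ▸ Real.sqrt_pos.2 hp
  have hκ2 : κ ^ 2 = a ^ 2 - ω ^ 2 := hκ ▸ Real.sq_sqrt hp.le
  have hγ : gam a ω = a / κ := by
    rw [gam, show 1 - (ω / a) ^ 2 = (a ^ 2 - ω ^ 2) / a ^ 2 by field_simp,
      Real.sqrt_div hp.le, Real.sqrt_sq ha0.le, ← hκ]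
    field_simp
  have h2 : perpGen a ω * perpGen a ω = !![a ^ 2, -(a * ω), 0, 0, 0;
      a * ω, -ω ^ 2, 0, 0, 0; 0, 0, κ ^ 2, 0, a; 0, 0, 0, 0, 0; 0, 0, 0, 0, 0] := by
    rw [perpGen_eq, hκ2]
    ext i j
    fin_cases i <;> fin_cases j <;> simp [Matrix.mul_apply, Fin.sum_univ_five] <;> ring
  have h3 : perpGen a ω * (perpGen a ω * perpGen a ω) =
      !![0, 0, -a * κ ^ 2, 0, -a ^ 2; 0, 0, -ω * κ ^ 2, 0, -(a * ω);
      -a * κ ^ 2, ω * κ ^ 2, 0, 0, 0; 0, 0, 0, 0, 0; 0, 0, 0, 0, 0] := by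
    rw [h2, perpGen_eq, hκ2]
    ext i j
    fin_cases i <;> fin_cases j <;> simp [Matrix.mul_apply, Fin.sum_univ_five] <;> ring
  have h4 : perpGen a ω * (perpGen a ω * (perpGen a ω * perpGen a ω))
      = κ ^ 2 • (perpGen a ω * perpGen a ω) := by
    rw [h3, h2, perpGen_eq]
    ext i j
    fin_cases i <;> fin_cases j <;> simp [Matrix.mul_apply, Fin.sum_univ_five] <;>
      (try rw [hκ2]) <;> ring
  have hκt : a * τ / (a / κ) = κ * τ := by field_simp
  have hω2 : ω ^ 2 = a ^ 2 - κ ^ 2 := by linarith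
  rw [exp_of_pow_four_eq_smul hκ0.ne' h4, h3, h2, perpGen_eq]
  have hm : matC a ω τ = !![1 + (a / κ) ^ 2 * (Real.cosh (κ * τ) - 1),
        -(ω / a * (a / κ) ^ 2 * (Real.cosh (κ * τ) - 1)), -((a / κ) * Real.sinh (κ * τ)), 0,
        (ω / a) ^ 2 * (a / κ) ^ 2 * τ - 1 / a * (a / κ) ^ 3 * Real.sinh (κ * τ);
      ω / a * (a / κ) ^ 2 * (Real.cosh (κ * τ) - 1),
        1 - (ω / a) ^ 2 * (a / κ) ^ 2 * (Real.cosh (κ * τ) - 1),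
        -(ω / a * (a / κ) * Real.sinh (κ * τ)), 0,
        ω / a * (a / κ) ^ 2 * τ - ω / a ^ 2 * (a / κ) ^ 3 * Real.sinh (κ * τ);
      -((a / κ) * Real.sinh (κ * τ)), ω / a * (a / κ) * Real.sinh (κ * τ), Real.cosh (κ * τ), 0,
        1 / a * (a / κ) ^ 2 * (Real.cosh (κ * τ) - 1);
      0, 0, 0, 1, 0;
      0, 0, 0, 0, 1] := by
    simp only [matC, hγ, hκt]
  rw [hm]
  ext i j
  fin_cases i <;> fin_cases j <;> simp <;> field_simp <;> (try rw [hω2]) <;> ring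

end Chasles

namespace Chasles

/-! ### The invariants in terms of electric and magnetic components -/

/-- A polynomial in the entries, used to evaluate the Levi-Civita symbol and to feed determinants of
Lorentz matrices to `linear_combination`. -/
theorem det_fin_four (A : Matrix (Fin 4) (Fin 4) ℝ) : A.det =
   A 0 0 * (A 1 1 * (A 2 2 * A 3 3 - A 2 3 * A 3 2) - A 1 2 * (A 2 1 * A 3 3 - A 2 3 * A 3 1)
      + A 1 3 * (A 2 1 * A 3 2 - A 2 2 * A 3 1))
   - A 0 1 * (A 1 0 * (A 2 2 * A 3 3 - A 2 3 * A 3 2) - A 1 2 * (A 2 0 * A 3 3 - A 2 3 * A 3 0)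
      + A 1 3 * (A 2 0 * A 3 2 - A 2 2 * A 3 0))
   + A 0 2 * (A 1 0 * (A 2 1 * A 3 3 - A 2 3 * A 3 1) - A 1 1 * (A 2 0 * A 3 3 - A 2 3 * A 3 0)
      + A 1 3 * (A 2 0 * A 3 1 - A 2 1 * A 3 0))
   - A 0 3 * (A 1 0 * (A 2 1 * A 3 2 - A 2 2 * A 3 1) - A 1 1 * (A 2 0 * A 3 2 - A 2 2 * A 3 0)
      + A 1 2 * (A 2 0 * A 3 1 - A 2 1 * A 3 0)) := by
  rw [Matrix.det_succ_row_zero, Fin.sum_univ_four]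
  simp only [Matrix.det_fin_three, Matrix.submatrix_apply, Fin.succ_zero_eq_one, Fin.succ_one_eq_two]
  simp [Fin.succAbove, Fin.lt_def]
  ring

theorem dual_eq (F : Matrix (Fin 4) (Fin 4) ℝ) : dual F =
    !![0, (upper F 2 3 - upper F 3 2) / 2, (upper F 3 1 - upper F 1 3) / 2,
        (upper F 1 2 - upper F 2 1) / 2;
      (upper F 3 2 - upper F 2 3) / 2, 0, (upper F 0 3 - upper F 3 0) / 2,
        (upper F 2 0 - upper F 0 2) / 2;
      (upper F 1 3 - upper F 3 1) / 2, (upper F 3 0 - upper F 0 3) / 2, 0,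
        (upper F 0 1 - upper F 1 0) / 2;
      (upper F 2 1 - upper F 1 2) / 2, (upper F 0 2 - upper F 2 0) / 2,
        (upper F 1 0 - upper F 0 1) / 2, 0] := by
  ext c d
  fin_cases c <;> fin_cases d <;>
    simp [dual, leviCivita, det_fin_four, Fin.sum_univ_four] <;> ring

/-- The matrix of a Killing field with linear part of components `E`, `B` and value `w` at the
origin. -/
def fieldMat (E B : Fin 3 → ℝ) (w : Fin 4 → ℝ) : Matrix (Fin 5) (Fin 5) ℝ :=
  !![0, -E 0, -E 1, -E 2, -w 0;
     -E 0, 0, B 2, -B 1, -w 1;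
     -E 1, -B 2, 0, B 0, -w 2;
     -E 2, B 1, -B 0, 0, -w 3;
     0, 0, 0, 0, 0]

theorem linPart_fieldMat (E B : Fin 3 → ℝ) (w : Fin 4 → ℝ) : linPart (fieldMat E B w) =
    !![0, -E 0, -E 1, -E 2; -E 0, 0, B 2, -B 1; -E 1, -B 2, 0, B 0; -E 2, B 1, -B 0, 0] := by
  ext i j
  fin_cases i <;> fin_cases j <;> rfl

theorem wPart_fieldMat (E B : Fin 3 → ℝ) (w : Fin 4 → ℝ) : wPart (fieldMat E B w) = w := by
  ext i
  fin_cases i <;> exact neg_neg _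

theorem upper_fieldMat (E B : Fin 3 → ℝ) (w : Fin 4 → ℝ) : upper (linPart (fieldMat E B w)) =
    !![0, -E 0, -E 1, -E 2; E 0, 0, B 2, -B 1; E 1, -B 2, 0, B 0; E 2, B 1, -B 0, 0] := by
  rw [linPart_fieldMat, upper, etaMat]
  ext i j
  fin_cases i <;> fin_cases j <;> simp

theorem dual_fieldMat (E B : Fin 3 → ℝ) (w : Fin 4 → ℝ) : dual (linPart (fieldMat E B w)) =
    !![0, B 0, B 1, B 2; -B 0, 0, -E 2, E 1; -B 1, E 2, 0, -E 0; -B 2, -E 1, E 0, 0] := by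
  rw [dual_eq, upper_fieldMat]
  ext i j
  fin_cases i <;> fin_cases j <;> simp <;> ring

theorem linPart_fieldMat_eq_zero_iff {E B : Fin 3 → ℝ} {w : Fin 4 → ℝ} :
    linPart (fieldMat E B w) = 0 ↔ (∀ i, E i = 0) ∧ ∀ i, B i = 0 := by
  rw [linPart_fieldMat]
  constructor
  · intro h
    have h0 := congrFun (congrFun h 0)
    have h1 := congrFun (congrFun h 1)
    have h23 := congrFun (congrFun h 2) 3
    have h01 := h0 1
    have h02 := h0 2
    have h03 := h0 3
    have h12 := h1 2
    have h13 := h1 3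
    simp at h01 h02 h03 h12 h13 h23
    constructor <;> intro i <;> fin_cases i <;> assumption
  · rintro ⟨h, h'⟩
    ext i j
    fin_cases i <;> fin_cases j <;> simp [h, h']

theorem I1_fieldMat (E B : Fin 3 → ℝ) (w : Fin 4 → ℝ) : I1 (fieldMat E B w) =
    ((B 0 ^ 2 + B 1 ^ 2 + B 2 ^ 2) - (E 0 ^ 2 + E 1 ^ 2 + E 2 ^ 2)) / 2 := by
  rw [I1, linPart_fieldMat]
  simp [Matrix.trace, Fin.sum_univ_four]
  ring

theorem I2_fieldMat (E B : Fin 3 → ℝ) (w : Fin 4 → ℝ) : I2 (fieldMat E B w) =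
    E 0 * B 0 + E 1 * B 1 + E 2 * B 2 := by
  rw [I2, dual_fieldMat, upper_fieldMat]
  simp [Fin.sum_univ_four]
  ring

theorem I3_fieldMat (E B : Fin 3 → ℝ) (w : Fin 4 → ℝ) : I3 (fieldMat E B w) =
    -(B 0 * w 1 + B 1 * w 2 + B 2 * w 3) ^ 2 + (B 0 * w 0 + E 2 * w 2 - E 1 * w 3) ^ 2
      + (B 1 * w 0 + E 0 * w 3 - E 2 * w 1) ^ 2 + (B 2 * w 0 + E 1 * w 1 - E 0 * w 2) ^ 2 := by
  rw [I3, dual_fieldMat, wPart_fieldMat]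
  simp [Fin.sum_univ_four, etaMat, Matrix.mulVec, dotProduct]
  ring

theorem I4_fieldMat (E B : Fin 3 → ℝ) (w : Fin 4 → ℝ) : I4 (fieldMat E B w) =
    -w 0 ^ 2 + w 1 ^ 2 + w 2 ^ 2 + w 3 ^ 2 := by
  rw [I4, wPart_fieldMat]
  simp [Fin.sum_univ_four, etaMat]
  ring

theorem smul_alignedGen_eq (a ω τ : ℝ) : τ • alignedGen a ω =
    fieldMat ![a * τ, 0, 0] ![ω * τ, 0, 0] ![τ, 0, 0, 0] := by
  rw [alignedGen_eq]
  ext i j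
  fin_cases i <;> fin_cases j <;> simp [fieldMat, mul_comm]

theorem smul_perpGen_eq (a ω τ : ℝ) : τ • perpGen a ω =
    fieldMat ![0, a * τ, 0] ![0, 0, -(ω * τ)] ![τ, 0, 0, 0] := by
  rw [perpGen_eq]
  ext i j
  fin_cases i <;> fin_cases j <;> simp [fieldMat, mul_comm]

/-! ### Independence of the invariants from the frame -/

namespace Minkowski

variable {W : Type*} [AddCommGroup W] [Module ℝ W] {S : Minkowski W}

namespace Frame

variable {M : Type*} [AddTorsor W M]

theorem hcoord_vadd (f : S.Frame M) (x : W) : f.hcoord (x +ᵥ f.origin) =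
    ![f.basis.repr x 0, f.basis.repr x 1, f.basis.repr x 2, f.basis.repr x 3, 1] := by
  simp [hcoord, coord]

/-- The homogeneous coordinates of the origin and of its translates by the basis vectors span the
whole space of columns. This makes the matrix of a field in a frame unique. -/
theorem ext_mulVec_hcoord (f : S.Frame M) {A B : Matrix (Fin 5) (Fin 5) ℝ}
    (h : ∀ p, A.mulVec (f.hcoord p) = B.mulVec (f.hcoord p)) : A = B := by
  have h' : ∀ (i : Fin 5) (x : W), A.mulVec (f.hcoord (x +ᵥ f.origin)) i = B.mulVec (f.hcoord (x +ᵥ f.origin)) i :=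
    fun i x => congrFun (h _) i
  simp only [hcoord_vadd, Matrix.mulVec, dotProduct, Fin.sum_univ_five, Matrix.cons_val,
    mul_one] at h'
  ext i j
  have h0 := h' i 0
  have h1 := h' i (f.basis 0)
  have h2 := h' i (f.basis 1)
  have h3 := h' i (f.basis 2)
  have h4 := h' i (f.basis 3)
  simp at h0 h1 h2 h3 h4
  fin_cases j <;> simp <;> linarith

theorem representsField_iff {f : S.Frame M} {k : M → W} {F : W →ₗ[ℝ] W}
    (hk : ∀ (p : M) (w : W), k (w +ᵥ p) = F w + k p) {E B : Fin 3 → ℝ} (h : f.HasComp F E B)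
    {X : Matrix (Fin 5) (Fin 5) ℝ} :
    f.RepresentsField k X ↔ X = fieldMat E B (fun i => f.basis.repr (k f.origin) i) := by
  have hr : f.RepresentsField k (fieldMat E B (fun i => f.basis.repr (k f.origin) i)) := by
    intro p
    obtain ⟨x, rfl⟩ : ∃ x : W, p = x +ᵥ f.origin := ⟨p -ᵥ f.origin, by simp⟩
    obtain ⟨h0, h1, h2, h3⟩ := h x
    rw [hcoord_vadd, hk]
    ext i
    fin_cases i <;>
      simp [fieldMat, Matrix.mulVec, dotProduct, Fin.sum_univ_five, h0, h1, h2, h3] <;> ring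
  refine ⟨fun hX => f.ext_mulVec_hcoord fun p => (hX p).trans (hr p).symm, ?_⟩
  rintro rfl
  exact hr

variable {f g : S.Frame M} {F : W →ₗ[ℝ] W} {E B E' B' : Fin 3 → ℝ}

/-- Preservation of the metric gives square one, and the common orientation gives the sign. -/
theorem toMatrix_det_eq_one (f g : S.Frame M) : (f.basis.toMatrix g.basis).det = 1 := by
  set L := f.basis.toMatrix g.basis with hL
  have hpos : 0 < L.det := by
    have := (f.basis.orientation_eq_iff_det_pos g.basis).1 (f.oriented.trans g.oriented.symm)
    rwa [Module.Basis.det_apply] at this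
  have hη : L.transpose * etaMat * L = etaMat := by
    ext a b
    rw [← g.orthonormal a b, f.eta_apply]
    simp [Matrix.mul_apply, Fin.sum_univ_four, etaMat, hL, Module.Basis.toMatrix_apply,
      Matrix.diagonal_apply]
  have hdet := congrArg Matrix.det hη
  rw [Matrix.det_mul, Matrix.det_mul, Matrix.det_transpose] at hdet
  have hne : etaMat.det ≠ 0 := by simp [etaMat, Fin.prod_univ_four]
  have : L.det * L.det = 1 := mul_right_cancel₀ hne (by linarith)
  nlinarith

/-- Each side is half the trace of `F²`. -/
theorem HasComp.norm_sub_eq (hf : f.HasComp F E B) (hg : g.HasComp F E' B') :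
    (E 0 ^ 2 + E 1 ^ 2 + E 2 ^ 2) - (B 0 ^ 2 + B 1 ^ 2 + B 2 ^ 2)
      = (E' 0 ^ 2 + E' 1 ^ 2 + E' 2 ^ 2) - (B' 0 ^ 2 + B' 1 ^ 2 + B' 2 ^ 2) := by
  have key : ∀ {f : S.Frame M} {E B : Fin 3 → ℝ}, f.HasComp F E B →
      LinearMap.trace ℝ W (F ∘ₗ F)
        = 2 * ((E 0 ^ 2 + E 1 ^ 2 + E 2 ^ 2) - (B 0 ^ 2 + B 1 ^ 2 + B 2 ^ 2)) := by
    intro f E B h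
    rw [LinearMap.trace_eq_matrix_trace ℝ f.basis, Matrix.trace, Fin.sum_univ_four]
    simp only [Matrix.diag_apply, LinearMap.toMatrix_apply, LinearMap.comp_apply]
    rw [(h _).1, (h _).2.1, (h _).2.2.1, (h _).2.2.2]
    simp only [(h _).1, (h _).2.1, (h _).2.2.1, (h _).2.2.2, repr_basis, Fin.reduceEq, if_true,
      if_false]
    ring
  have h1 := key hf
  have h2 := key hg
  linarith

/-- Up to sign this is the Pfaffian of the two-form `η(·, F ·)`, which is multiplied by the
determinant of the change of basis, here `1`. -/
theorem HasComp.dot_eq (hf : f.HasComp F E B) (hg : g.HasComp F E' B') :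
    E' 0 * B' 0 + E' 1 * B' 1 + E' 2 * B' 2 = E 0 * B 0 + E 1 * B 1 + E 2 * B 2 := by
  have hdet := toMatrix_det_eq_one f g
  rw [det_fin_four] at hdet
  simp only [Module.Basis.toMatrix_apply] at hdet
  have key : ∀ i j, S.η (g.basis i) (F (g.basis j)) = _ := fun i j => f.eta_apply _ _
  have key' : ∀ i j, S.η (g.basis i) (F (g.basis j)) = _ := fun i j => g.eta_apply _ _
  simp only [(hf _).1, (hf _).2.1, (hf _).2.2.1, (hf _).2.2.2] at key
  simp only [(hg _).1, (hg _).2.1, (hg _).2.2.1, (hg _).2.2.2, repr_basis] at key'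
  have e0 := (key' 1 0).symm.trans (key 1 0)
  have e1 := (key' 2 0).symm.trans (key 2 0)
  have e2 := (key' 3 0).symm.trans (key 3 0)
  have b0 := (key' 3 2).symm.trans (key 3 2)
  have b1 := (key' 1 3).symm.trans (key 1 3)
  have b2 := (key' 2 1).symm.trans (key 2 1)
  simp only [Fin.reduceEq, if_true, if_false, mul_one, mul_zero, one_mul, zero_mul, add_zero,
    zero_add, sub_zero, neg_zero] at e0 e1 e2 b0 b1 b2
  rw [e0, e1, e2, b0, b1, b2]
  generalize f.basis.repr (g.basis 0) = l₀ at hdet ⊢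
  generalize f.basis.repr (g.basis 1) = l₁ at hdet ⊢
  generalize f.basis.repr (g.basis 2) = l₂ at hdet ⊢
  generalize f.basis.repr (g.basis 3) = l₃ at hdet ⊢
  linear_combination (E 0 * B 0 + E 1 * B 1 + E 2 * B 2) * hdet

/-- An identity between the squares of `F` and of its dual. The right side involves the frame only
through the difference of norms, already known to be invariant, so only the dependence of the value
`w` on the origin remains. -/
theorem I3_fieldMat_eq (hf : f.HasComp F E B) (w : W) :
    I3 (fieldMat E B (fun i => f.basis.repr w i)) = S.η (F w) (F w)
      + ((E 0 ^ 2 + E 1 ^ 2 + E 2 ^ 2) - (B 0 ^ 2 + B 1 ^ 2 + B 2 ^ 2)) * S.η w w := by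
  rw [I3_fieldMat, f.eta_apply, f.eta_apply, (hf w).1, (hf w).2.1, (hf w).2.2.1, (hf w).2.2.2]
  ring

/-- The product of the dual with `F` is a scalar, `E·B` up to sign. When it vanishes, the dual
annihilates the range of `F`, which is where changes of origin move `w`. -/
theorem I3_fieldMat_add (hf : f.HasComp F E B) (hEB : E 0 * B 0 + E 1 * B 1 + E 2 * B 2 = 0)
    (w x : W) : I3 (fieldMat E B (fun i => f.basis.repr (F x + w) i))
      = I3 (fieldMat E B (fun i => f.basis.repr w i)) := by
  rw [I3_fieldMat, I3_fieldMat]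
  simp only [map_add, Finsupp.add_apply, (hf x).1, (hf x).2.1, (hf x).2.2.1, (hf x).2.2.2]
  generalize f.basis.repr w = w
  generalize f.basis.repr x = x
  have key : ∀ {a a' b b' c c' d d' : ℝ}, a = a' → b = b' → c = c' → d = d' →
      -a ^ 2 + b ^ 2 + c ^ 2 + d ^ 2 = -a' ^ 2 + b' ^ 2 + c' ^ 2 + d' ^ 2 := by
    rintro _ _ _ _ _ _ _ _ rfl rfl rfl rfl
    rfl
  refine key ?_ ?_ ?_ ?_
  · linear_combination x 0 * hEB
  · linear_combination x 1 * hEB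
  · linear_combination x 2 * hEB
  · linear_combination x 3 * hEB

/-- The invariants do not depend on the frame. -/
theorem invariants_eq {k : M → W} {X Y : Matrix (Fin 5) (Fin 5) ℝ} (hk : S.IsKilling k)
    (hX : g.RepresentsField k X) (hY : f.RepresentsField k Y) :
    I1 Y = I1 X ∧ I2 Y = I2 X ∧ (I2 X = 0 → I3 Y = I3 X) ∧ (linPart Y = 0 ↔ linPart X = 0) ∧
      (linPart X = 0 → I4 Y = I4 X) := by
  obtain ⟨F, hF, hk⟩ := hk
  obtain ⟨E, B, hf⟩ := f.exists_hasComp hF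
  obtain ⟨E', B', hg⟩ := g.exists_hasComp hF
  obtain rfl := (representsField_iff hk hg).1 hX
  obtain rfl := (representsField_iff hk hf).1 hY
  have h1 := hf.norm_sub_eq hg
  have h2 := hf.dot_eq hg
  have h3 : ∀ {f : S.Frame M} {E B : Fin 3 → ℝ} {w : Fin 4 → ℝ}, f.HasComp F E B →
      (linPart (fieldMat E B w) = 0 ↔ F = 0) := by
    intro f E B w h
    rw [linPart_fieldMat_eq_zero_iff]
    constructor
    · rintro ⟨h0, h1⟩
      ext v
      obtain ⟨q0, q1, q2, q3⟩ := h v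
      apply ext_repr (f := f) <;> simp [q0, q1, q2, q3, h0, h1]
    · rintro rfl
      have a := h (f.basis 0)
      have b := h (f.basis 1)
      have c := h (f.basis 2)
      simp at a b c
      constructor <;> intro i <;> fin_cases i <;> simp <;> grind
  have h4 : k f.origin = F (f.origin -ᵥ g.origin) + k g.origin := by
    rw [← hk]; simp
  refine ⟨?_, ?_, ?_, ?_, ?_⟩
  · rw [I1_fieldMat, I1_fieldMat]; linarith
  · rw [I2_fieldMat, I2_fieldMat]; linarith
  · intro h
    rw [I2_fieldMat] at h
    -- The frame-free expression transports `I₃` to the components in `g`; the shift of origin is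
    -- then dropped by `I3_fieldMat_add`.
    rw [I3_fieldMat_eq hf, h1, ← I3_fieldMat_eq hg, h4, I3_fieldMat_add hg h]
  · rw [h3 hf, h3 hg]
  · intro h
    rw [h3 hg] at h
    have e1 := f.eta_apply (k f.origin) (k f.origin)
    have e2 := g.eta_apply (k g.origin) (k g.origin)
    rw [h4, h, LinearMap.zero_apply, zero_add] at e1
    rw [I4_fieldMat, I4_fieldMat, h4, h, LinearMap.zero_apply, zero_add]
    linarith

end Frame

end Minkowski

end Chasles

namespace Chasles

namespace Minkowski

variable {W : Type*} [AddCommGroup W] [Module ℝ W] {S : Minkowski W}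

namespace Frame

variable {M : Type*} [AddTorsor W M]

/-! ### Change of frame -/

/-- The matrix of the coordinate change from the frame `g` to the frame `f`. -/
noncomputable def transition (f g : S.Frame M) : Matrix (Fin 5) (Fin 5) ℝ :=
  let L : Fin 4 → Fin 4 → ℝ := fun i j => f.basis.repr (g.basis j) i
  let b := f.coord g.origin
  !![L 0 0, L 0 1, L 0 2, L 0 3, b 0;
     L 1 0, L 1 1, L 1 2, L 1 3, b 1;
     L 2 0, L 2 1, L 2 2, L 2 3, b 2;
     L 3 0, L 3 1, L 3 2, L 3 3, b 3;
     0, 0, 0, 0, 1]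

theorem repr_change (f g : S.Frame M) (v : W) (i : Fin 4) : f.basis.repr v i =
    f.basis.repr (g.basis 0) i * g.basis.repr v 0 + f.basis.repr (g.basis 1) i * g.basis.repr v 1
    + f.basis.repr (g.basis 2) i * g.basis.repr v 2
    + f.basis.repr (g.basis 3) i * g.basis.repr v 3 := by
  have h : v = g.basis.repr v 0 • g.basis 0 + g.basis.repr v 1 • g.basis 1
      + g.basis.repr v 2 • g.basis 2 + g.basis.repr v 3 • g.basis 3 := by
    rw [← Fin.sum_univ_four (fun i => g.basis.repr v i • g.basis i), g.basis.sum_repr]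
  conv_lhs => rw [h]
  simp only [map_add, map_smul, Finsupp.add_apply, Finsupp.smul_apply, smul_eq_mul]
  ring

theorem transition_mulVec_direction (f g : S.Frame M) (v : W) : (transition f g).mulVec
    ![g.basis.repr v 0, g.basis.repr v 1, g.basis.repr v 2, g.basis.repr v 3, 0]
      = ![f.basis.repr v 0, f.basis.repr v 1, f.basis.repr v 2, f.basis.repr v 3, 0] := by
  have h := fun i => repr_change f g v i
  ext i
  fin_cases i <;>
    simp [transition, Matrix.mulVec, dotProduct, Fin.sum_univ_five, h]

theorem transition_mulVec_hcoord (f g : S.Frame M) (p : M) :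
    (transition f g).mulVec (g.hcoord p) = f.hcoord p := by
  have h := fun i => repr_change f g (p -ᵥ g.origin) i
  have h' : ∀ i, f.coord p i = f.basis.repr (p -ᵥ g.origin) i + f.coord g.origin i := fun i => by
    rw [coord, coord, ← Finsupp.add_apply, ← map_add, vsub_add_vsub_cancel]
  ext i
  fin_cases i <;>
    simp [transition, Matrix.mulVec, dotProduct, Fin.sum_univ_five, hcoord, h', h,
      coord.eq_def g p]

theorem transition_mul_transition (f g : S.Frame M) : transition f g * transition g f = 1 := by
  refine f.ext_mulVec_hcoord fun p => ?_
  rw [← Matrix.mulVec_mulVec, transition_mulVec_hcoord, transition_mulVec_hcoord,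
    Matrix.one_mulVec]

/-- If `P` is the exponential of a Killing field in one frame, then it is in every frame. -/
theorem represents_exp_of_representsField {f g : S.Frame M} {P : M → M} {k : M → W}
    {X Y : Matrix (Fin 5) (Fin 5) ℝ} (hX : g.RepresentsField k X) (hY : f.RepresentsField k Y)
    (hP : g.Represents P (NormedSpace.exp X)) : f.Represents P (NormedSpace.exp Y) := by
  have hTX : transition f g * X = Y * transition f g := by
    refine g.ext_mulVec_hcoord fun p => ?_
    rw [← Matrix.mulVec_mulVec, ← Matrix.mulVec_mulVec, transition_mulVec_hcoord, hX, hY]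
    have := transition_mulVec_direction f g (-k p)
    simpa using this
  have hinv : (transition f g)⁻¹ = transition g f :=
    Matrix.inv_eq_right_inv (transition_mul_transition f g)
  have hunit : IsUnit (transition f g) :=
    IsUnit.of_mul_eq_one _ (transition_mul_transition f g)
  have hYX : Y = transition f g * X * (transition f g)⁻¹ := by
    rw [hTX, hinv, Matrix.mul_assoc, transition_mul_transition, Matrix.mul_one]
  intro p
  rw [hYX, Matrix.exp_conj _ _ hunit, hinv, ← transition_mulVec_hcoord f g p, hP p,
    ← Matrix.mulVec_mulVec, ← Matrix.mulVec_mulVec, transition_mulVec_hcoord]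

/-! ### Functionals constant along a Killing field -/

theorem ext_dotProduct_hcoord (f : S.Frame M) {u v : Fin 5 → ℝ}
    (h : ∀ p, u ⬝ᵥ f.hcoord p = v ⬝ᵥ f.hcoord p) : u = v := by
  have : Matrix.of (fun _ : Fin 5 => u) = Matrix.of (fun _ : Fin 5 => v) :=
    f.ext_mulVec_hcoord fun p => funext fun _ => h p
  exact congrFun this 0

/-- Linear functionals that vanish on the range of the linear part of a Killing field take the
same value on the field and on the displacements of its exponential. -/
theorem apply_displacement {g : S.Frame M} {P : M → M} {k : M → W} {F : W →ₗ[ℝ] W}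
    (hk : ∀ (p : M) (w : W), k (w +ᵥ p) = F w + k p) {X : Matrix (Fin 5) (Fin 5) ℝ}
    (hX : g.RepresentsField k X) (hP : g.Represents P (NormedSpace.exp X))
    (φ : Module.Dual ℝ W) (hφ : ∀ v, φ (F v) = 0) (p q : M) : φ (P q -ᵥ q) = φ (k p) := by
  have hconst : ∀ p q, φ (k p) = φ (k q) := fun p q => by
    have := hk q (p -ᵥ q)
    rw [vsub_vadd] at this
    rw [this, map_add, hφ, zero_add]
  set u : Fin 5 → ℝ := ![φ (g.basis 0), φ (g.basis 1), φ (g.basis 2), φ (g.basis 3), 0] with hu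
  have hφ' : ∀ v, φ v = φ (g.basis 0) * g.basis.repr v 0 + φ (g.basis 1) * g.basis.repr v 1
      + φ (g.basis 2) * g.basis.repr v 2 + φ (g.basis 3) * g.basis.repr v 3 := by
    intro v
    conv_lhs => rw [← g.basis.sum_repr v, Fin.sum_univ_four]
    simp only [map_add, map_smul, smul_eq_mul]
    ring
  have hu1 : ∀ p, u ⬝ᵥ g.hcoord p = φ (p -ᵥ g.origin) := fun p => by
    rw [hφ' (p -ᵥ g.origin)]
    simp [hu, dotProduct, Fin.sum_univ_five, hcoord, coord]
  have hu2 : ∀ p, Matrix.vecMul u X ⬝ᵥ g.hcoord p = -φ (k p) := fun p => by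
    rw [← Matrix.dotProduct_mulVec, hX, hφ' (k p)]
    simp [hu, dotProduct, Fin.sum_univ_five]
    ring
  -- The row `u X` takes the value `-φ(k)` at every point, a constant. The columns `X (x̄, 1)` are
  -- differences of homogeneous coordinates of two points, so `u X` annihilates them.
  have hu3 : Matrix.vecMul (Matrix.vecMul u X) X = 0 := by
    refine g.ext_dotProduct_hcoord fun p => ?_
    have : X.mulVec (g.hcoord p) = g.hcoord (-k p +ᵥ g.origin) - g.hcoord g.origin := by
      rw [hX]
      ext i
      fin_cases i <;> simp [hcoord, coord]
    rw [← Matrix.dotProduct_mulVec, this, dotProduct_sub, hu2, hu2, zero_dotProduct,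
      hconst _ g.origin, sub_self]
  have h := hu1 q
  -- The matrix of `P` sends the coordinates of `P q` to those of `q`, hence `φ(q - o) = φ(P q - o)
  -- - φ(k)`.
  rw [hP q, Matrix.dotProduct_mulVec, vecMul_exp_of_sq hu3, add_dotProduct, hu1, hu2] at h
  have h2 : P q -ᵥ q = (P q -ᵥ g.origin) - (q -ᵥ g.origin) := by simp
  rw [h2, map_sub, hconst p (P q)]
  linarith

end Frame

end Minkowski

end Chasles

/-! ### Values attained by a Killing field -/

namespace Chasles

namespace Minkowski

variable {W : Type*} [AddCommGroup W] [Module ℝ W] {S : Minkowski W}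

namespace Frame

variable {M : Type*} [AddTorsor W M]

/-- The frame with the same basis and another origin. -/
def withOrigin (f : S.Frame M) (o : M) : S.Frame M := { f with origin := o }

/-- The vector with given components. -/
noncomputable def vec (f : S.Frame M) (x : Fin 4 → ℝ) : W := ∑ i, x i • f.basis i

theorem repr_vec (f : S.Frame M) (x : Fin 4 → ℝ) (i : Fin 4) : f.basis.repr (f.vec x) i = x i := by
  rw [vec, f.basis.repr_sum_self]

/-- Lightlike `l` is allowed; the null case applies this to the null vector in the kernel of `F`. -/
theorem eta_neg_of_causal {f : S.Frame M} {l v : W} (hl0 : 0 < f.basis.repr l 0)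
    (hl : f.basis.repr l 1 ^ 2 + f.basis.repr l 2 ^ 2 + f.basis.repr l 3 ^ 2
      ≤ f.basis.repr l 0 ^ 2) (hv : v ∈ S.future) : S.η l v < 0 := by
  obtain ⟨h0, h1⟩ := (mem_future_iff (f := f)).1 hv
  have := spatial_lt hl0 hl h0 h1
  rw [f.eta_apply]
  linarith

end Frame

open Minkowski.Frame

variable {M : Type*} [AddTorsor W M]

/-- The vector field `k` is somewhere future directed of proper length `τ`. -/
def HasValue (S : Minkowski W) (k : M → W) (τ : ℝ) : Prop :=
  ∃ p, k p ∈ S.future ∧ S.η (k p) (k p) = -τ ^ 2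

theorem exists_frame_of_hasValue {k : M → W} {τ : ℝ} (hτ : 0 < τ) {p : M} (hp : k p ∈ S.future)
    (hp' : S.η (k p) (k p) = -τ ^ 2) :
    ∃ f : S.Frame M, f.origin = p ∧ k p = τ • f.basis 0 := by
  obtain ⟨f, -⟩ := S.exists_frame p
  obtain ⟨f', ho, h0⟩ := f.exists_frame_of_future p (t := τ⁻¹ • k p)
    (smul_mem_future hp (inv_pos.2 hτ)) (by
      simp only [map_smul, LinearMap.smul_apply, smul_eq_mul, hp']
      field_simp)
  exact ⟨f', ho, by rw [h0, smul_smul, mul_inv_cancel₀ hτ.ne', one_smul]⟩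

/-- `k` has, in some frame, parallel electric and magnetic parts `α`, `β` along the first axis,
and at the origin the value `τ e₀`. -/
def HasAligned (S : Minkowski W) (k : M → W) (F : W →ₗ[ℝ] W) (α β τ : ℝ) : Prop :=
  ∃ f : S.Frame M, f.HasComp F ![α, 0, 0] ![β, 0, 0] ∧ k f.origin = τ • f.basis 0

variable {k : M → W} {F : W →ₗ[ℝ] W}

/-- A null vector `l = F x` lies in the kernel of `F`, and by skewness `η(l, ·)` vanishes on the
range of `F`. Hence `η(l, k) = η(l, d) < 0` everywhere, while translation by `s x` adds `s l` to `k`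
and changes `η(k, k)` by a nonconstant affine function of `s`. -/
theorem hasValue_of_null (hk : ∀ (p : M) (w : W), k (w +ᵥ p) = F w + k p) (hF0 : F ≠ 0)
    {d : W} (hd : d ∈ S.future)
    (hφ : ∀ φ : Module.Dual ℝ W, (∀ v, φ (F v) = 0) → ∀ p, φ d = φ (k p))
    {g : S.Frame M} {E B : Fin 3 → ℝ} (h : g.HasComp F E B)
    (hEB : E 0 * B 0 + E 1 * B 1 + E 2 * B 2 = 0)
    (hE : E 0 ^ 2 + E 1 ^ 2 + E 2 ^ 2 = B 0 ^ 2 + B 1 ^ 2 + B 2 ^ 2) (τ : ℝ) (hτ : 0 < τ) :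
    S.HasValue k τ := by
  have hpos : 0 < E 0 ^ 2 + E 1 ^ 2 + E 2 ^ 2 := by
    refine lt_of_le_of_ne (by positivity) fun h0 => hF0 ?_
    have e0 : E 0 = 0 := by nlinarith [sq_nonneg (E 0), sq_nonneg (E 1), sq_nonneg (E 2)]
    have e1 : E 1 = 0 := by nlinarith [sq_nonneg (E 0), sq_nonneg (E 1), sq_nonneg (E 2)]
    have e2 : E 2 = 0 := by nlinarith [sq_nonneg (E 0), sq_nonneg (E 1), sq_nonneg (E 2)]
    have b0 : B 0 = 0 := by nlinarith [sq_nonneg (B 0), sq_nonneg (B 1), sq_nonneg (B 2)]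
    have b1 : B 1 = 0 := by nlinarith [sq_nonneg (B 0), sq_nonneg (B 1), sq_nonneg (B 2)]
    have b2 : B 2 = 0 := by nlinarith [sq_nonneg (B 0), sq_nonneg (B 1), sq_nonneg (B 2)]
    ext v
    obtain ⟨q0, q1, q2, q3⟩ := h v
    apply ext_repr (f := g) <;> simp [q0, q1, q2, q3, e0, e1, e2, b0, b1, b2]
  -- The image of the electric vector has time component `|E|² > 0`; nullity of `F` makes it
  -- lightlike and sends it to zero.
  obtain ⟨l0, l1, l2, l3⟩ := h (g.vec ![0, E 0, E 1, E 2])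
  obtain ⟨z0, z1, z2, z3⟩ := h (F (g.vec ![0, E 0, E 1, E 2]))
  simp only [repr_vec, Matrix.cons_val] at l0 l1 l2 l3
  set l := F (g.vec ![0, E 0, E 1, E 2]) with hl
  have hFl : F l = 0 := by
    apply ext_repr (f := g)
    · rw [z0, l1, l2, l3]; simp; ring
    · rw [z1, l0, l2, l3]; simp; linear_combination E 0 * hE + B 0 * hEB
    · rw [z2, l0, l1, l3]; simp; linear_combination E 1 * hE + B 1 * hEB
    · rw [z3, l0, l1, l2]; simp; linear_combination E 2 * hE + B 2 * hEB
  have hll : S.η l l = 0 := by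
    rw [hl, ← add_zero (S.η _ _), ← hl]
    have := h.isSkew l (g.vec ![0, E 0, E 1, E 2])
    rw [← hl, hFl] at this
    simpa using this
  have hl0 : 0 < g.basis.repr l 0 := by rw [l0]; linarith
  have hneg : ∀ v ∈ S.future, S.η l v < 0 := fun v hv => by
    refine eta_neg_of_causal (f := g) hl0 ?_ hv
    rw [g.eta_apply] at hll
    linarith
  have hηF : ∀ v, S.η l (F v) = 0 := fun v => by
    have := h.isSkew l v
    rw [hFl] at this
    simpa using this
  obtain ⟨o⟩ : Nonempty M := AddTorsor.nonempty
  have hw : S.η l (k o) < 0 := by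
    rw [← hφ (S.η l) hηF o]
    exact hneg d hd
  -- The solution of `η(w, w) + 2 s η(l, w) = -τ²`, where `w` is the value at `o`.
  set s := (-τ ^ 2 - S.η (k o) (k o)) / (2 * S.η l (k o)) with hs
  have hval : k (s • g.vec ![0, E 0, E 1, E 2] +ᵥ o) = s • l + k o := by rw [hk, map_smul]
  have hsq : S.η (s • l + k o) (s • l + k o) = -τ ^ 2 := by
    simp only [map_add, map_smul, LinearMap.add_apply, LinearMap.smul_apply, smul_eq_mul, hll,
      S.eta_symm (k o) l]
    have : s * (2 * S.η l (k o)) = -τ ^ 2 - S.η (k o) (k o) := by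
      have hw' := hw.ne
      rw [hs]
      field_simp
    linarith
  have hηl : S.η l (s • l + k o) = S.η l (k o) := by
    simp [hll]
  refine ⟨_, ?_, by rw [hval, hsq]⟩
  rw [hval]
  rcases mem_future_or_neg_mem (S := S) (v := s • l + k o) (by rw [hsq]; nlinarith) with h1 | h1
  · exact h1
  · have h2 := hneg _ h1
    rw [map_neg, hηl] at h2
    linarith

/-- With both parts nonzero `F` is invertible, so some translation `x` solves `F x = τ e₀ - w`,
where `w` is the value at the old origin. -/
theorem hasAligned_of_ne_zero (hk : ∀ (p : M) (w : W), k (w +ᵥ p) = F w + k p) {f : S.Frame M}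
    {α β : ℝ} (h : f.HasComp F ![α, 0, 0] ![β, 0, 0]) (hα : α ≠ 0) (hβ : β ≠ 0) (τ : ℝ) :
    S.HasAligned k F α β τ := by
  set w := f.basis.repr (k f.origin) with hw
  set x := f.vec ![-w 1 / α, (τ - w 0) / α, -w 3 / β, w 2 / β]
  refine ⟨f.withOrigin (x +ᵥ f.origin), h, ?_⟩
  change k (x +ᵥ f.origin) = τ • f.basis 0
  rw [hk]
  obtain ⟨h0, h1, h2, h3⟩ := h x
  apply ext_repr (f := f) <;> simp [h0, h1, h2, h3, x, repr_vec, ← hw] <;> field_simp <;> ring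

/-- The range of `F` is the plane of `e₀, e₁`, so these components of `k` can be made `(s, 0)` with
`s² = τ² + w₂² + w₃²`. The transverse components stay fixed; `I₃ = α² (w₂² + w₃²)` measures them,
and when it vanishes the value is exactly `τ e₀`. -/
theorem hasValue_of_boost (hk : ∀ (p : M) (w : W), k (w +ᵥ p) = F w + k p) {f : S.Frame M}
    {α : ℝ} (h : f.HasComp F ![α, 0, 0] ![0, 0, 0]) (hα : α ≠ 0) (τ : ℝ) (hτ : 0 < τ) :
    S.HasValue k τ ∧ (I3 (fieldMat ![α, 0, 0] ![0, 0, 0]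
      (fun i => f.basis.repr (k f.origin) i)) = 0 → S.HasAligned k F α 0 τ) := by
  set w := f.basis.repr (k f.origin) with hw
  obtain ⟨s, hs⟩ : ∃ s, s = √(τ ^ 2 + w 2 ^ 2 + w 3 ^ 2) := ⟨_, rfl⟩
  have hs0 : 0 < s := hs ▸ Real.sqrt_pos.2 (by positivity)
  have hs2 : s ^ 2 = τ ^ 2 + w 2 ^ 2 + w 3 ^ 2 := hs ▸ Real.sq_sqrt (by positivity)
  set x := f.vec ![-w 1 / α, (s - w 0) / α, 0, 0]
  have hv : k (x +ᵥ f.origin) = f.vec ![s, 0, w 2, w 3] := by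
    rw [hk]
    obtain ⟨h0, h1, h2, h3⟩ := h x
    apply ext_repr (f := f) <;> simp [h0, h1, h2, h3, x, repr_vec, ← hw] <;> field_simp <;> ring
  refine ⟨⟨x +ᵥ f.origin, ?_, ?_⟩, fun hI => ⟨f.withOrigin (x +ᵥ f.origin), h, ?_⟩⟩
  · rw [hv, mem_future_iff (f := f)]
    simp only [repr_vec, Matrix.cons_val]
    exact ⟨hs0, by nlinarith⟩
  · rw [hv, f.eta_apply]
    simp only [repr_vec, Matrix.cons_val]
    linarith
  · rw [I3_fieldMat] at hI
    simp only [Matrix.cons_val] at hI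
    have hα2 : 0 < α ^ 2 := by positivity
    have h23 : w 3 ^ 2 + w 2 ^ 2 = 0 := by
      have : α ^ 2 * (w 3 ^ 2 + w 2 ^ 2) = 0 := by linarith
      exact (mul_eq_zero.1 this).resolve_left hα2.ne'
    have h2 : w 2 = 0 := by nlinarith
    have h3 : w 3 = 0 := by nlinarith
    have hsτ : s = τ := by
      rw [h2, h3] at hs2
      exact (sq_eq_sq₀ hs0.le hτ.le).1 (by linarith)
    change k (x +ᵥ f.origin) = τ • f.basis 0
    rw [hv]
    apply ext_repr (f := f) <;> simp [repr_vec, h2, h3, hsτ]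

/-- The range of `F` is the plane of `e₂, e₃`, so the components of `k` along `e₀, e₁` are those of
`d` and form a timelike vector of some length `m`. A translation removes the other two; the value
then lies in the kernel of `F`, and a frame with this time direction sees a rotation only. -/
theorem hasAligned_of_rotation (hk : ∀ (p : M) (w : W), k (w +ᵥ p) = F w + k p)
    {d : W} (hd : d ∈ S.future)
    (hφ : ∀ φ : Module.Dual ℝ W, (∀ v, φ (F v) = 0) → ∀ p, φ d = φ (k p)) {f : S.Frame M}
    {β : ℝ} (h : f.HasComp F ![0, 0, 0] ![β, 0, 0]) (hβ : β ≠ 0) :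
    ∃ m β' : ℝ, 0 < m ∧ β' ≠ 0 ∧ S.HasAligned k F 0 β' m ∧
      ∀ τ, 0 < τ → τ ≤ m → S.HasValue k τ := by
  set w := f.basis.repr (k f.origin) with hw
  have hd' := (mem_future_iff (f := f)).1 hd
  have hw0 : f.basis.repr d 0 = w 0 := hφ (f.basis.coord 0)
    (fun v => by simp [(h v).1]) f.origin
  have hw1 : f.basis.repr d 1 = w 1 := hφ (f.basis.coord 1)
    (fun v => by simp [(h v).2.1]) f.origin
  rw [hw0, hw1] at hd'
  have hpos : 0 < w 0 ^ 2 - w 1 ^ 2 := by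
    nlinarith [hd'.2, sq_nonneg (f.basis.repr d 2), sq_nonneg (f.basis.repr d 3)]
  obtain ⟨m, hm⟩ : ∃ m, m = √(w 0 ^ 2 - w 1 ^ 2) := ⟨_, rfl⟩
  have hm0 : 0 < m := hm ▸ Real.sqrt_pos.2 hpos
  have hm2 : m ^ 2 = w 0 ^ 2 - w 1 ^ 2 := hm ▸ Real.sq_sqrt hpos.le
  set x := f.vec ![0, 0, -w 3 / β, w 2 / β]
  have hv : k (x +ᵥ f.origin) = f.vec ![w 0, w 1, 0, 0] := by
    rw [hk]
    obtain ⟨h0, h1, h2, h3⟩ := h x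
    apply ext_repr (f := f) <;> simp [h0, h1, h2, h3, x, repr_vec, ← hw] <;> field_simp <;> ring
  obtain ⟨f₁, ho₁, hf₁⟩ := exists_frame_of_hasValue (S := S) (k := k) hm0 (p := x +ᵥ f.origin)
    (by
      rw [hv, mem_future_iff (f := f)]
      simp only [repr_vec, Matrix.cons_val]
      exact ⟨hd'.1, by linarith⟩)
    (by
      rw [hv, f.eta_apply]
      simp only [repr_vec, Matrix.cons_val]
      linarith)
  have hF0 : F (f₁.basis 0) = 0 := by
    have h1 : F (k (x +ᵥ f.origin)) = 0 := by
      rw [hv]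
      obtain ⟨h0, h1, h2, h3⟩ := h (f.vec ![w 0, w 1, 0, 0])
      apply ext_repr (f := f) <;> simp [h0, h1, h2, h3, repr_vec]
    rw [hf₁, map_smul] at h1
    exact (smul_eq_zero.1 h1).resolve_left hm0.ne'
  obtain ⟨E, B, hEB⟩ := f₁.exists_hasComp h.isSkew
  obtain ⟨-, e1, e2, e3⟩ := hEB (f₁.basis 0)
  rw [hF0] at e1 e2 e3
  simp at e1 e2 e3
  obtain ⟨f₂, α', β', ho₂, hb₂, h₂⟩ := exists_aligned_of_parallel hEB
    (by rw [← e2, ← e3]; ring) (by rw [← e1, ← e3]; ring) (by rw [← e1, ← e2]; ring)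
  have hα' : α' = 0 := by
    have h3 := (h₂ (f₂.basis 0)).2.1
    rw [hb₂, hF0, ← hb₂] at h3
    simpa using h3.symm
  subst hα'
  have hβ' : β' ≠ 0 := by
    rintro rfl
    have := h.norm_sub_eq h₂
    simp at this
    exact hβ this
  have hk2 : k f₂.origin = m • f₂.basis 0 := by rw [ho₂, ho₁, hf₁, hb₂]
  refine ⟨m, β', hm0, hβ', ⟨f₂, h₂, hk2⟩, fun τ hτ hτm => ?_⟩
  -- Away from the axis `k` acquires a component of length `c` in the plane of rotation, which
  -- lowers its proper length from `m` to `τ`.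
  obtain ⟨c, hc⟩ : ∃ c, c = √(m ^ 2 - τ ^ 2) := ⟨_, rfl⟩
  have hc2 : c ^ 2 = m ^ 2 - τ ^ 2 := hc ▸ Real.sq_sqrt (by nlinarith)
  have hv2 : k (f₂.vec ![0, 0, c / β', 0] +ᵥ f₂.origin) = f₂.vec ![m, 0, 0, c] := by
    rw [hk, hk2]
    obtain ⟨h0, h1, h2, h3⟩ := h₂ (f₂.vec ![0, 0, c / β', 0])
    apply ext_repr (f := f₂) <;> simp [h0, h1, h2, h3, repr_vec]
    field_simp
  refine ⟨f₂.vec ![0, 0, c / β', 0] +ᵥ f₂.origin, ?_, ?_⟩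
  · rw [hv2, mem_future_iff (f := f₂)]
    simp only [repr_vec, Matrix.cons_val]
    exact ⟨hm0, by nlinarith⟩
  · rw [hv2, f₂.eta_apply]
    simp only [repr_vec, Matrix.cons_val]
    linarith

end Minkowski

end Chasles

namespace Chasles

namespace Minkowski

variable {W : Type*} [AddCommGroup W] [Module ℝ W] {S : Minkowski W} {M : Type*} [AddTorsor W M]
  {k : M → W} {F : W →ₗ[ℝ] W}

open Minkowski.Frame

/-! ### Normal forms of Killing fields -/

theorem representsField_of_value (hk : ∀ (p : M) (w : W), k (w +ᵥ p) = F w + k p) {f : S.Frame M}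
    {E B : Fin 3 → ℝ} (h : f.HasComp F E B) {τ : ℝ} (hτ : k f.origin = τ • f.basis 0) :
    f.RepresentsField k (fieldMat E B ![τ, 0, 0, 0]) := by
  rw [representsField_iff hk h, hτ]
  congr 1
  ext i
  fin_cases i <;> simp

theorem HasAligned.exists_representsField (hk : ∀ (p : M) (w : W), k (w +ᵥ p) = F w + k p)
    {α β τ : ℝ} (h : S.HasAligned k F α β τ) :
    ∃ f : S.Frame M, f.RepresentsField k (fieldMat ![α, 0, 0] ![β, 0, 0] ![τ, 0, 0, 0]) := by
  obtain ⟨f, hf, ho⟩ := h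
  exact ⟨f, representsField_of_value hk hf ho⟩

/-- The parameters of an aligned form can be changed to any others with the same invariants. -/
theorem HasAligned.of_eq {α β τ α' β' : ℝ} (h : S.HasAligned k F α β τ)
    (h1 : α' ^ 2 - β' ^ 2 = α ^ 2 - β ^ 2) (h2 : α' * β' = α * β) :
    S.HasAligned k F α' β' τ := by
  obtain ⟨f, hf, ho⟩ := h
  -- From `(α² + β²)² = (α² - β²)² + 4 (αβ)²`: the two invariants determine both squares, so only
  -- signs remain.
  have hsum : α' ^ 2 + β' ^ 2 = α ^ 2 + β ^ 2 := by
    refine (sq_eq_sq₀ (by positivity) (by positivity)).1 ?_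
    linear_combination (α' ^ 2 - β' ^ 2 + α ^ 2 - β ^ 2) * h1 + 4 * (α' * β' + α * β) * h2
  have hα : α' ^ 2 = α ^ 2 := by linarith
  have hβ : β' ^ 2 = β ^ 2 := by linarith
  by_cases hα0 : α = 0
  · subst hα0
    have hα' : α' = 0 := by nlinarith
    subst hα'
    obtain ⟨s, hs, hsβ⟩ : ∃ s : ℝ, s ^ 2 = 1 ∧ s * β = β' := by
      rcases sq_eq_sq_iff_eq_or_eq_neg.1 hβ with h | h
      · exact ⟨1, by norm_num, by simp [h]⟩
      · exact ⟨-1, by norm_num, by simp [h]⟩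
    -- The sign `s` is put on `e₃` to turn `β` into `β'`; the orientation is repaired on `e₁`, which
    -- a rotation does not involve.
    obtain ⟨f', ho', hb', -⟩ := exists_frame_of_orthonormal (S := S) f.origin
      (v := ![f.basis 0, f.basis 1, f.basis 2, s • f.basis 3]) (by
        intro a b
        fin_cases a <;> fin_cases b <;> simp [f.orthonormal, etaMat, ← sq, hs])
      f.future 1 (by decide)
    have hb0 : f'.basis 0 = f.basis 0 := hb' 0 (by decide)
    have hb2 : f'.basis 2 = f.basis 2 := hb' 2 (by decide)
    have hb3 : f'.basis 3 = s • f.basis 3 := hb' 3 (by decide)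
    obtain ⟨E, B, hEB⟩ := f'.exists_hasComp hf.isSkew
    have hF0 : F (f'.basis 0) = 0 := by
      rw [hb0]
      obtain ⟨q0, q1, q2, q3⟩ := hf (f.basis 0)
      apply ext_repr (f := f) <;> simp [q0, q1, q2, q3]
    have hF2 : F (f'.basis 2) = β' • f'.basis 3 := by
      rw [hb2, hb3, ← hsβ, smul_smul]
      obtain ⟨q0, q1, q2, q3⟩ := hf (f.basis 2)
      apply ext_repr (f := f) <;> simp [q0, q1, q2, q3]
      linear_combination -β * hs
    have hF3 : f'.basis.repr (F (f'.basis 3)) 1 = 0 := by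
      have hF3 : F (f'.basis 3) = -(s * β) • f'.basis 2 := by
        rw [hb2, hb3, map_smul]
        obtain ⟨q0, q1, q2, q3⟩ := hf (f.basis 3)
        apply ext_repr (f := f) <;> simp [q0, q1, q2, q3]
      simp [hF3]
    obtain ⟨-, p1, p2, p3⟩ := hEB (f'.basis 0)
    obtain ⟨-, r1, -, r3⟩ := hEB (f'.basis 2)
    obtain ⟨-, t1, -, -⟩ := hEB (f'.basis 3)
    rw [hF0] at p1 p2 p3
    rw [hF2] at r1 r3
    rw [hF3] at t1
    simp at p1 p2 p3 r1 r3 t1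
    refine ⟨f', ?_, by rw [ho', ho, hb0]⟩
    have hE' : E = ![0, 0, 0] := by
      ext i; fin_cases i <;> simp [← p1, ← p2, ← p3]
    have hB' : B = ![β', 0, 0] := by
      ext i; fin_cases i <;> simp [r1, ← r3, ← t1]
    rw [← hB', ← hE']
    exact hEB
  · obtain ⟨s, hs, hsα⟩ : ∃ s : ℝ, s ^ 2 = 1 ∧ s * α = α' := by
      rcases sq_eq_sq_iff_eq_or_eq_neg.1 hα with h | h
      · exact ⟨1, by norm_num, by simp [h]⟩
      · exact ⟨-1, by norm_num, by simp [h]⟩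
    -- The sign `s` is put on `e₁` to turn `α` into `α'`. The orientation is repaired on `e₃`, whose
    -- sign is not tracked: `B 0` is recovered from the invariance of `E·B`, as `α' ≠ 0`.
    obtain ⟨f', ho', hb', -⟩ := exists_frame_of_orthonormal (S := S) f.origin
      (v := ![f.basis 0, s • f.basis 1, f.basis 2, f.basis 3]) (by
        intro a b
        fin_cases a <;> fin_cases b <;> simp [f.orthonormal, etaMat, ← sq, hs])
      f.future 3 (by decide)
    have hb0 : f'.basis 0 = f.basis 0 := hb' 0 (by decide)
    have hb1 : f'.basis 1 = s • f.basis 1 := hb' 1 (by decide)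
    obtain ⟨E, B, hEB⟩ := f'.exists_hasComp hf.isSkew
    have hF0 : F (f'.basis 0) = α' • f'.basis 1 := by
      rw [hb0, hb1, ← hsα, smul_smul]
      obtain ⟨q0, q1, q2, q3⟩ := hf (f.basis 0)
      apply ext_repr (f := f) <;> simp [q0, q1, q2, q3]
      linear_combination -α * hs
    have hF1 : F (f'.basis 1) = α' • f'.basis 0 := by
      rw [hb0, hb1, ← hsα, map_smul]
      obtain ⟨q0, q1, q2, q3⟩ := hf (f.basis 1)
      apply ext_repr (f := f) <;> simp [q0, q1, q2, q3]
    obtain ⟨-, p1, p2, p3⟩ := hEB (f'.basis 0)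
    obtain ⟨-, -, r2, r3⟩ := hEB (f'.basis 1)
    rw [hF0] at p1 p2 p3
    rw [hF1] at r2 r3
    simp at p1 p2 p3 r2 r3
    refine ⟨f', ?_, by rw [ho', ho, hb0]⟩
    have hα'0 : α' ≠ 0 := fun h0 => hα0 (by rw [h0] at hα; nlinarith)
    have hdot := hf.dot_eq hEB
    simp [← p1, ← p2, ← p3, ← h2] at hdot
    have hE' : E = ![α', 0, 0] := by
      ext i; fin_cases i <;> simp [← p1, ← p2, ← p3]
    have hB' : B = ![β', 0, 0] := by
      ext i; fin_cases i <;> simp [← r2, r3]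
      exact hdot.resolve_right hα'0
    rw [← hB', ← hE']
    exact hEB

variable {g : S.Frame M} {X : Matrix (Fin 5) (Fin 5) ℝ}

/-- The invariants of an aligned form. -/
theorem invariants_of_aligned (hK : S.IsKilling k) (hX : g.RepresentsField k X) {f : S.Frame M}
    {α β τ : ℝ} (hf : f.RepresentsField k (fieldMat ![α, 0, 0] ![β, 0, 0] ![τ, 0, 0, 0])) :
    α ^ 2 - β ^ 2 = -2 * I1 X ∧ α * β = I2 X ∧ (I2 X = 0 → β ^ 2 * τ ^ 2 = I3 X) ∧
      (linPart X = 0 ↔ α = 0 ∧ β = 0) ∧ (linPart X = 0 → τ ^ 2 = -I4 X) := by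
  obtain ⟨h1, h2, h3, h0, h4⟩ := invariants_eq hK hX hf
  rw [I1_fieldMat] at h1
  rw [I2_fieldMat] at h2
  rw [I3_fieldMat] at h3
  rw [I4_fieldMat] at h4
  rw [linPart_fieldMat_eq_zero_iff] at h0
  simp only [Matrix.cons_val] at h1 h2 h3 h4
  refine ⟨by linarith, by linarith, fun h => by linarith [h3 h], ?_, fun h => by linarith [h4 h]⟩
  rw [← h0]
  simp [Fin.forall_fin_succ]

/-- The invariants of a perpendicular form. -/
theorem invariants_of_perp (hK : S.IsKilling k) (hX : g.RepresentsField k X) {f : S.Frame M}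
    {a ω τ : ℝ} (hf : f.RepresentsField k (τ • perpGen a ω)) :
    (a ^ 2 - ω ^ 2) * τ ^ 2 = -2 * I1 X ∧ I2 X = 0 ∧ ω ^ 2 * τ ^ 4 = I3 X ∧
      (linPart X = 0 → τ ^ 2 = -I4 X) := by
  rw [smul_perpGen_eq] at hf
  obtain ⟨h1, h2, h3, -, h4⟩ := invariants_eq hK hX hf
  rw [I1_fieldMat] at h1
  rw [I2_fieldMat] at h2
  rw [I3_fieldMat] at h3
  rw [I4_fieldMat] at h4
  simp only [Matrix.cons_val] at h1 h2 h3 h4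
  have h2' : I2 X = 0 := by linarith
  exact ⟨by linarith, h2', by linarith [h3 h2'], fun h => by linarith [h4 h]⟩

/-- At a point where `k = τ e₀` one has `I₃ = τ² |B|²`, so the prescribed invariants force `|B| =
|ω| τ`, `|E| = |a| τ` and `E·B = 0`; a spatial rotation then does the rest. -/
theorem exists_perp_of_hasValue (hK : S.IsKilling k) (hX : g.RepresentsField k X)
    {a ω τ : ℝ} (hτ : 0 < τ) (hv : S.HasValue k τ) (h1 : (a ^ 2 - ω ^ 2) * τ ^ 2 = -2 * I1 X)
    (h2 : I2 X = 0) (h3 : ω ^ 2 * τ ^ 4 = I3 X) :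
    ∃ f : S.Frame M, f.RepresentsField k (τ • perpGen a ω) := by
  obtain ⟨p, hp, hp'⟩ := hv
  obtain ⟨f, ho, hf⟩ := exists_frame_of_hasValue hτ hp hp'
  rw [← ho] at hf
  have hK' := hK
  obtain ⟨F, hF, hk⟩ := hK'
  obtain ⟨E, B, h⟩ := f.exists_hasComp hF
  obtain ⟨i1, i2, i3, -⟩ := invariants_eq hK hX (representsField_of_value hk h hf)
  have i3 := i3 h2
  rw [I1_fieldMat] at i1
  rw [I2_fieldMat] at i2
  rw [I3_fieldMat] at i3
  simp only [Matrix.cons_val] at i3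
  have hB : (ω * τ) ^ 2 = B 0 ^ 2 + B 1 ^ 2 + B 2 ^ 2 := by
    refine mul_right_cancel₀ (pow_ne_zero 2 hτ.ne') ?_
    linear_combination h3 - i3
  obtain ⟨f', ho', hb', h'⟩ := exists_perp_of_orthogonal h (i2.trans h2) (α := a * τ)
    (by linear_combination hB + h1 + 2 * i1) hB
  refine ⟨f', ?_⟩
  rw [smul_perpGen_eq]
  exact representsField_of_value hk h' (by rw [ho', hb', hf])

/-- The possible types of a Killing field whose exponential moves a point to its future. -/
theorem killing_cases (hF : S.IsSkew F) (hk : ∀ (p : M) (w : W), k (w +ᵥ p) = F w + k p)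
    (hX : g.RepresentsField k X) {d : W} (hd : d ∈ S.future)
    (hφ : ∀ φ : Module.Dual ℝ W, (∀ v, φ (F v) = 0) → ∀ p, φ d = φ (k p)) :
    (∃ τ, 0 < τ ∧ S.HasAligned k F 0 0 τ) ∨
    (linPart X ≠ 0 ∧ I1 X = 0 ∧ I2 X = 0 ∧ ∀ τ, 0 < τ → S.HasValue k τ) ∨
    (∃ α β : ℝ, α ≠ 0 ∧ β ≠ 0 ∧ ∀ τ, S.HasAligned k F α β τ) ∨
    (I1 X < 0 ∧ I2 X = 0 ∧ ∃ α : ℝ, ∀ τ, 0 < τ → S.HasValue k τ ∧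
      (I3 X = 0 → S.HasAligned k F α 0 τ)) ∨
    (∃ m β : ℝ, 0 < m ∧ β ≠ 0 ∧ S.HasAligned k F 0 β m ∧
      ∀ τ, 0 < τ → τ ≤ m → S.HasValue k τ) := by
  have hK : S.IsKilling k := ⟨F, hF, hk⟩
  by_cases hF0 : F = 0
  · left
    subst hF0
    -- Every functional vanishes on the zero range, so all components of `k` agree with those of
    -- `d`.
    have hval : ∀ p, k p = d := fun p => by
      refine ext_repr (f := g) ?_ ?_ ?_ ?_
      exacts [(hφ (g.basis.coord 0) (by simp) p).symm, (hφ (g.basis.coord 1) (by simp) p).symm,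
        (hφ (g.basis.coord 2) (by simp) p).symm, (hφ (g.basis.coord 3) (by simp) p).symm]
    have hdd := timelike_of_mem_future hd
    have hτ : 0 < √(-S.η d d) := Real.sqrt_pos.2 (by linarith)
    obtain ⟨f, ho, hf⟩ := exists_frame_of_hasValue (S := S) (k := k) hτ (p := g.origin)
      (by rwa [hval]) (by rw [hval, Real.sq_sqrt (by linarith)]; ring)
    rw [← ho] at hf
    exact ⟨_, hτ, f, fun v => by simp, hf⟩
  right
  obtain ⟨E, B, h⟩ := g.exists_hasComp hF
  have hXE := (representsField_iff hk h).1 hX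
  by_cases hn : E 0 * B 0 + E 1 * B 1 + E 2 * B 2 = 0 ∧
      E 0 ^ 2 + E 1 ^ 2 + E 2 ^ 2 = B 0 ^ 2 + B 1 ^ 2 + B 2 ^ 2
  · left
    refine ⟨?_, ?_, ?_, hasValue_of_null hk hF0 hd hφ h hn.1 hn.2⟩
    · intro h0
      rw [hXE, linPart_fieldMat_eq_zero_iff] at h0
      refine hF0 ?_
      ext v
      obtain ⟨q0, q1, q2, q3⟩ := h v
      apply ext_repr (f := g) <;> simp [q0, q1, q2, q3, h0.1, h0.2]
    · rw [hXE, I1_fieldMat, hn.2]; ring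
    · rw [hXE, I2_fieldMat, hn.1]
  right
  obtain ⟨f, α, β, -, hf⟩ := exists_aligned_of_not_null h hn g.origin
  by_cases hα : α = 0
  · right; right
    subst hα
    refine hasAligned_of_rotation hk hd hφ hf ?_
    rintro rfl
    refine hF0 ?_
    ext v
    obtain ⟨q0, q1, q2, q3⟩ := hf v
    apply ext_repr (f := f) <;> simp [q0, q1, q2, q3]
  · by_cases hβ : β = 0
    · right; left
      subst hβ
      obtain ⟨i1, i2, i3, -⟩ := invariants_eq hK hX ((representsField_iff hk hf).2 rfl)
      rw [I1_fieldMat] at i1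
      rw [I2_fieldMat] at i2
      simp only [Matrix.cons_val] at i1 i2
      have h2 : I2 X = 0 := by linarith
      have hα2 : 0 < α ^ 2 := by positivity
      refine ⟨by linarith, h2, α, fun τ hτ => ?_⟩
      have := hasValue_of_boost hk hf hα τ hτ
      rwa [i3 h2] at this
    · left
      exact ⟨α, β, hα, hβ, hasAligned_of_ne_zero hk hf hα hβ⟩

end Minkowski

end Chasles

/-! ### Canonical generators and the freedom in their parameters -/

namespace Chasles

namespace Minkowski

variable {W : Type*} [AddCommGroup W] [Module ℝ W] {S : Minkowski W} {M : Type*} [AddTorsor W M]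
  {k : M → W} {F : W →ₗ[ℝ] W} {g : S.Frame M} {X : Matrix (Fin 5) (Fin 5) ℝ}

open Minkowski.Frame

theorem HasAligned.exists_alignedGen (hk : ∀ (p : M) (w : W), k (w +ᵥ p) = F w + k p)
    {α β a ω τ : ℝ} (h : S.HasAligned k F α β τ) (hα : a * τ = α) (hβ : ω * τ = β) :
    ∃ f : S.Frame M, f.RepresentsField k (τ • alignedGen a ω) := by
  subst hα hβ
  rw [smul_alignedGen_eq]
  exact h.exists_representsField hk

theorem smul_alignedGen_zero (τ : ℝ) : τ • alignedGen 0 0 = τ • perpGen 0 0 := by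
  rw [alignedGen_eq, perpGen_eq]
  simp

theorem invariants_of_alignedGen (hK : S.IsKilling k) (hX : g.RepresentsField k X) {f : S.Frame M}
    {a ω τ : ℝ} (hf : f.RepresentsField k (τ • alignedGen a ω)) :
    (a ^ 2 - ω ^ 2) * τ ^ 2 = -2 * I1 X ∧ a * ω * τ ^ 2 = I2 X ∧
      (I2 X = 0 → ω ^ 2 * τ ^ 4 = I3 X) ∧ (linPart X = 0 → τ ^ 2 = -I4 X) := by
  rw [smul_alignedGen_eq] at hf
  obtain ⟨h1, h2, h3, -, h4⟩ := invariants_of_aligned hK hX hf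
  exact ⟨by linarith, by linarith, fun h => by linarith [h3 h], h4⟩

/-- The invariants of the canonical generators. -/
theorem invariants_of_isCanonical (hK : S.IsKilling k) (hX : g.RepresentsField k X)
    {f : S.Frame M} {Y : Matrix (Fin 5) (Fin 5) ℝ} {a ω τ : ℝ} (hY : IsCanonical a ω τ Y)
    (hf : f.RepresentsField k Y) :
    (a ^ 2 - ω ^ 2) * τ ^ 2 = -2 * I1 X ∧ (I2 X ≠ 0 → a * ω * τ ^ 2 = I2 X) ∧
      (I2 X = 0 → ω ^ 2 * τ ^ 4 = I3 X) ∧ (linPart X = 0 → τ ^ 2 = -I4 X) := by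
  rcases hY.2 with ⟨-, rfl⟩ | ⟨-, -, rfl⟩ | ⟨-, -, rfl⟩
  · obtain ⟨h1, h2, h3, h4⟩ := invariants_of_alignedGen hK hX hf
    exact ⟨h1, fun _ => h2, h3, h4⟩
  · obtain ⟨h1, h2, h3, h4⟩ := invariants_of_perp hK hX hf
    exact ⟨h1, fun h => absurd h2 h, fun _ => h3, h4⟩
  · obtain ⟨h1, h2, h3, h4⟩ := invariants_of_perp hK hX hf
    exact ⟨h1, fun h => absurd h2 h, fun _ => h3, h4⟩

theorem linPart_eq_zero_of_hasAligned (hF : S.IsSkew F)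
    (hk : ∀ (p : M) (w : W), k (w +ᵥ p) = F w + k p) (hX : g.RepresentsField k X) {τ : ℝ}
    (h : S.HasAligned k F 0 0 τ) :
    linPart X = 0 ∧ I1 X = 0 ∧ I2 X = 0 ∧ I3 X = 0 ∧ τ ^ 2 = -I4 X := by
  obtain ⟨f, hf⟩ := h.exists_representsField hk
  obtain ⟨h1, h2, h3, h0, h4⟩ := invariants_of_aligned ⟨F, hF, hk⟩ hX hf
  have hl := h0.2 ⟨rfl, rfl⟩
  have h2' : I2 X = 0 := by linarith
  exact ⟨hl, by linarith, h2', by linarith [h3 h2'], h4 hl⟩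

theorem not_perpGen_zero (hK : S.IsKilling k) (hX : g.RepresentsField k X) (h0 : linPart X ≠ 0)
    {τ : ℝ} : ¬ ∃ f : S.Frame M, f.RepresentsField k (τ • perpGen 0 0) := by
  rintro ⟨f, hf⟩
  rw [← smul_alignedGen_zero, smul_alignedGen_eq] at hf
  exact h0 ((invariants_of_aligned hK hX hf).2.2.2.1.2 (by simp))

/-- Necessity is the invariance of `I₁, …, I₄`. For sufficiency each type of field has an aligned
form of length `τ`, whose parameters `of_eq` adjusts; the exception is the null type, where the
conditions are contradictory. -/
theorem exists_alignedGen_iff (hF : S.IsSkew F) (hk : ∀ (p : M) (w : W), k (w +ᵥ p) = F w + k p)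
    (hX : g.RepresentsField k X) {d : W} (hd : d ∈ S.future)
    (hφ : ∀ φ : Module.Dual ℝ W, (∀ v, φ (F v) = 0) → ∀ p, φ d = φ (k p))
    (a ω τ : ℝ) (hτ : 0 < τ) :
    (∃ f : S.Frame M, f.RepresentsField k (τ • alignedGen a ω)) ↔
      ((a ^ 2 - ω ^ 2) * τ ^ 2 = -2 * I1 X ∧ a * ω * τ ^ 2 = I2 X ∧
        (I2 X = 0 → ω ^ 2 * τ ^ 4 = I3 X) ∧ (linPart X = 0 → τ ^ 2 = -I4 X)) := by
  have hK : S.IsKilling k := ⟨F, hF, hk⟩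
  have hτ2 : τ ^ 2 ≠ 0 := by positivity
  refine ⟨fun ⟨f, hf⟩ => invariants_of_alignedGen hK hX hf, ?_⟩
  rintro ⟨h1, h2, h3, h4⟩
  rcases killing_cases hF hk hX hd hφ with ⟨τ', hτ', h⟩ | ⟨h0, hI1, hI2, h⟩ |
    ⟨α, β, hα, hβ, h⟩ | ⟨hI1, hI2, α, h⟩ | ⟨m, β, hm, hβ, h, -⟩
  · obtain ⟨hl, hI1, hI2, -, hτ4⟩ := linPart_eq_zero_of_hasAligned hF hk hX h
    have hττ : τ = τ' := (sq_eq_sq₀ hτ.le hτ'.le).1 (by rw [hτ4, h4 hl])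
    subst hττ
    exact (h.of_eq (α' := a * τ) (β' := ω * τ) (by linarith) (by linarith)).exists_alignedGen hk
      rfl rfl
  · exfalso
    rw [hI1] at h1
    rw [hI2] at h2
    have h1' : a ^ 2 - ω ^ 2 = 0 := (mul_eq_zero.1 (by linarith)).resolve_right hτ2
    have h2' : a * ω = 0 := (mul_eq_zero.1 h2).resolve_right hτ2
    have hω : ω = 0 := by
      rcases mul_eq_zero.1 h2' with h | h
      · rw [h] at h1'
        nlinarith
      · exact h
    have h3' := h3 hI2
    rw [hω] at h3'
    -- The conditions force `a = ω = 0`, hence `I₃ = 0`; a perpendicular form with zero parameters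
    -- would then exist and give `F = 0`.
    exact not_perpGen_zero hK hX h0 (exists_perp_of_hasValue hK hX zero_lt_one (h 1 zero_lt_one)
      (a := 0) (ω := 0) (by rw [hI1]; ring) hI2 (by linarith))
  · obtain ⟨f, hf⟩ := (h τ).exists_representsField hk
    obtain ⟨i1, i2, -⟩ := invariants_of_aligned hK hX hf
    exact ((h τ).of_eq (α' := a * τ) (β' := ω * τ) (by linarith) (by linarith)).exists_alignedGen hk
      rfl rfl
  · rw [hI2] at h2
    have h2' : a * ω = 0 := (mul_eq_zero.1 h2).resolve_right hτ2
    have hω : ω = 0 := by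
      rcases mul_eq_zero.1 h2' with h | h
      · rw [h] at h1
        nlinarith [mul_nonneg (sq_nonneg ω) (sq_nonneg τ)]
      · exact h
    have h3' := h3 hI2
    rw [hω] at h3'
    have h := (h τ hτ).2 (by linarith)
    obtain ⟨f, hf⟩ := h.exists_representsField hk
    obtain ⟨i1, i2, -⟩ := invariants_of_aligned hK hX hf
    exact (h.of_eq (α' := a * τ) (β' := ω * τ) (by linarith) (by linarith)).exists_alignedGen hk
      rfl rfl
  · obtain ⟨f, hf⟩ := h.exists_representsField hk
    obtain ⟨i1, i2, i3, -⟩ := invariants_of_aligned hK hX hf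
    have hI2 : I2 X = 0 := by linarith
    have hβ2 : 0 < β ^ 2 := by positivity
    have h2' : a * ω = 0 := (mul_eq_zero.1 (h2.trans hI2)).resolve_right hτ2
    have ha : a = 0 := by
      rcases mul_eq_zero.1 h2' with h | h
      · exact h
      · rw [h] at h1
        nlinarith [mul_nonneg (sq_nonneg a) (sq_nonneg τ)]
    have hωτ : ω ^ 2 * τ ^ 2 = β ^ 2 := by
      rw [ha] at h1
      linarith
    have h3' := h3 hI2
    have i3' := i3 hI2
    -- Both `ω² τ⁴` and `β² m²` equal `I₃`, while `ω² τ² = β²`.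
    have hττ : τ = m := by
      refine (sq_eq_sq₀ hτ.le hm.le).1 (mul_left_cancel₀ hβ2.ne' ?_)
      rw [i3', ← h3', ← hωτ]
      ring
    subst hττ
    exact (h.of_eq (α' := a * τ) (β' := ω * τ) (by linarith) (by linarith)).exists_alignedGen hk
      rfl rfl

/-- Outside the case `F = 0`, only the attainability of the length `τ` is at stake. For a rotation
it requires `τ ≤ m`, which the conditions imply. -/
theorem exists_perpGen_iff (hF : S.IsSkew F) (hk : ∀ (p : M) (w : W), k (w +ᵥ p) = F w + k p)
    (hX : g.RepresentsField k X) {d : W} (hd : d ∈ S.future)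
    (hφ : ∀ φ : Module.Dual ℝ W, (∀ v, φ (F v) = 0) → ∀ p, φ d = φ (k p))
    (a ω τ : ℝ) (hτ : 0 < τ) :
    (∃ f : S.Frame M, f.RepresentsField k (τ • perpGen a ω)) ↔
      ((a ^ 2 - ω ^ 2) * τ ^ 2 = -2 * I1 X ∧ I2 X = 0 ∧ ω ^ 2 * τ ^ 4 = I3 X ∧
        (linPart X = 0 → τ ^ 2 = -I4 X)) := by
  have hK : S.IsKilling k := ⟨F, hF, hk⟩
  have hτ2 : τ ^ 2 ≠ 0 := by positivity
  refine ⟨fun ⟨f, hf⟩ => invariants_of_perp hK hX hf, ?_⟩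
  rintro ⟨h1, h2, h3, h4⟩
  rcases killing_cases hF hk hX hd hφ with ⟨τ', hτ', h⟩ | ⟨h0, hI1, hI2, h⟩ |
    ⟨α, β, hα, hβ, h⟩ | ⟨hI1, hI2, α, h⟩ | ⟨m, β, hm, hβ, h, hv⟩
  · obtain ⟨hl, hI1, hI2, hI3, hτ4⟩ := linPart_eq_zero_of_hasAligned hF hk hX h
    have hττ : τ = τ' := (sq_eq_sq₀ hτ.le hτ'.le).1 (by rw [hτ4, h4 hl])
    subst hττ
    have hω : ω = 0 := by
      have : ω ^ 2 = 0 := (mul_eq_zero.1 (h3.trans hI3)).resolve_right (by positivity)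
      nlinarith
    have ha : a = 0 := by
      rw [hI1, hω] at h1
      have : a ^ 2 - 0 ^ 2 = 0 := (mul_eq_zero.1 (h1.trans (by ring))).resolve_right hτ2
      nlinarith
    rw [hω, ha, ← smul_alignedGen_zero]
    exact h.exists_alignedGen hk (by simp) (by simp)
  · exact exists_perp_of_hasValue hK hX hτ (h τ hτ) h1 h2 h3
  · obtain ⟨f, hf⟩ := (h τ).exists_representsField hk
    obtain ⟨-, i2, -⟩ := invariants_of_aligned hK hX hf
    exact absurd (i2.trans h2) (mul_ne_zero hα hβ)
  · exact exists_perp_of_hasValue hK hX hτ (h τ hτ).1 h1 h2 h3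
  · obtain ⟨f, hf⟩ := h.exists_representsField hk
    obtain ⟨i1, -, i3, -⟩ := invariants_of_aligned hK hX hf
    have i3' := i3 h2
    have hβ2 : 0 < β ^ 2 := by positivity
    refine exists_perp_of_hasValue hK hX hτ (hv τ hτ ?_) h1 h2 h3
    refine (sq_le_sq₀ hτ.le hm.le).1 ?_
    refine le_of_mul_le_mul_left ?_ hβ2
    have : β ^ 2 * m ^ 2 = τ ^ 2 * (β ^ 2 + a ^ 2 * τ ^ 2) := by
      rw [i3', ← h3]
      linear_combination -τ ^ 2 * (h1 - i1)
    nlinarith [mul_nonneg (sq_nonneg τ) (mul_nonneg (sq_nonneg a) (sq_nonneg τ))]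

/-- If `F = 0` the invariants leave only the length of the constant field. Otherwise the field is a
rotation about an axis on which it has length `m`, and `I₃ = β² m²`, `2 I₁ = β²` recover `|β| / m`
and `m`. -/
theorem pureRotation_normal_form (hF : S.IsSkew F)
    (hk : ∀ (p : M) (w : W), k (w +ᵥ p) = F w + k p)
    (hX : g.RepresentsField k X) {d : W} (hd : d ∈ S.future)
    (hφ : ∀ φ : Module.Dual ℝ W, (∀ v, φ (F v) = 0) → ∀ p, φ d = φ (k p))
    (hR : IsPureRotation X) :
    ∃ ω τ : ℝ, 0 ≤ ω ∧ 0 < τ ∧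
      (∃ f : S.Frame M, f.RepresentsField k (τ • alignedGen 0 ω)) ∧
      (0 < I1 X → ω = 2 * I1 X / √(I3 X)) ∧
      ∀ (a' ω' τ' : ℝ) (f : S.Frame M) (Y : Matrix (Fin 5) (Fin 5) ℝ),
        IsCanonical a' ω' τ' Y → f.RepresentsField k Y → a' = 0 ∧ |ω'| = ω ∧ τ' = τ := by
  have hK : S.IsKilling k := ⟨F, hF, hk⟩
  have hR1 : 0 ≤ I1 X ∧ (linPart X ≠ 0 → 0 < I1 X) := by
    rcases hR with ⟨-, h⟩ | h
    · exact ⟨h.le, fun _ => h⟩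
    · exact ⟨by simp [I1, h], fun h' => absurd h h'⟩
  rcases killing_cases hF hk hX hd hφ with ⟨τ, hτ, h⟩ | ⟨h0, hI1, hI2, h⟩ |
    ⟨α, β, hα, hβ, h⟩ | ⟨hI1, hI2, α, h⟩ | ⟨m, β, hm, hβ, h, hv⟩
  · obtain ⟨hl, hI1, hI2, hI3, hτ4⟩ := linPart_eq_zero_of_hasAligned hF hk hX h
    refine ⟨0, τ, le_rfl, hτ, h.exists_alignedGen hk (by simp) (by simp),
      fun h => absurd hI1 h.ne', ?_⟩
    intro a' ω' τ' f Y hY hf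
    obtain ⟨h1, -, h3, h4⟩ := invariants_of_isCanonical hK hX hY hf
    have hτ' : 0 < τ' := hY.1
    have hω : ω' = 0 := by
      have : ω' ^ 2 = 0 := (mul_eq_zero.1 ((h3 hI2).trans hI3)).resolve_right (by positivity)
      nlinarith
    have ha : a' = 0 := by
      rw [hI1, hω] at h1
      have : a' ^ 2 - 0 ^ 2 = 0 :=
        (mul_eq_zero.1 (h1.trans (by ring))).resolve_right (by positivity)
      nlinarith
    exact ⟨ha, by simp [hω], (sq_eq_sq₀ hτ'.le hτ.le).1 (by rw [hτ4, h4 hl])⟩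
  · exact absurd hI1 (hR1.2 h0).ne'
  · exfalso
    obtain ⟨f, hf⟩ := (h 1).exists_representsField hk
    obtain ⟨-, i2, -, i0, -⟩ := invariants_of_aligned hK hX hf
    rcases hR with ⟨h, -⟩ | h
    · exact mul_ne_zero hα hβ (i2.trans h)
    · exact hα (i0.1 h).1
  · exact absurd hI1 (not_lt.2 hR1.1)
  · obtain ⟨f, hf⟩ := h.exists_representsField hk
    obtain ⟨i1, i2, i3, -⟩ := invariants_of_aligned hK hX hf
    have hI2 : I2 X = 0 := by linarith
    have i3' := i3 hI2
    have hβ2 : 0 < β ^ 2 := by positivity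
    have hβa : 0 < |β| := abs_pos.2 hβ
    refine ⟨|β| / m, m, by positivity, hm, ?_, fun _ => ?_, ?_⟩
    · refine (h.of_eq (α' := 0) (β' := |β|) (by simp) (by simp)).exists_alignedGen hk (by simp) ?_
      field_simp
    · have h1 : 2 * I1 X = |β| ^ 2 := by rw [sq_abs]; linarith
      have h3 : √(I3 X) = |β| * m := by
        rw [← i3', ← sq_abs β, ← mul_pow, Real.sqrt_sq (by positivity)]
      rw [h1, h3]
      field_simp
    · intro a' ω' τ' f Y hY hf
      have hτ' : 0 < τ' := hY.1
      obtain ⟨h1, -, h3, -⟩ := invariants_of_isCanonical hK hX hY hf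
      have hlt : (a' ^ 2 - ω' ^ 2) * τ' ^ 2 < 0 := by linarith
      -- Positivity of `I₁` excludes the ranges (b) and (c), where `|ω'| ≤ |a'|`; in (a), `I₂ = 0`
      -- then leaves only `a' = 0`.
      have hlt' : a' ^ 2 < ω' ^ 2 := by
        by_contra hcon
        nlinarith [mul_nonneg (sub_nonneg.2 (not_lt.1 hcon)) (sq_nonneg τ')]
      have ha : a' = 0 := by
        rcases hY.2 with ⟨-, rfl⟩ | ⟨h, -, -⟩ | ⟨h, h', -⟩
        · obtain ⟨-, j2, -⟩ := invariants_of_alignedGen hK hX hf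
          rw [hI2] at j2
          rcases mul_eq_zero.1 ((mul_eq_zero.1 j2).resolve_right (by positivity)) with h | h
          · exact h
          · rw [h] at hlt'
            nlinarith
        · rw [h] at hlt'
          exact absurd hlt' (lt_irrefl _)
        · nlinarith
      have hωτ : ω' ^ 2 * τ' ^ 2 = β ^ 2 := by
        rw [ha] at h1
        linarith
      have hττ : τ' = m := by
        refine (sq_eq_sq₀ hτ'.le hm.le).1 (mul_left_cancel₀ hβ2.ne' ?_)
        rw [i3', ← h3 hI2, ← hωτ]
        ring
      refine ⟨ha, ?_, hττ⟩
      rw [eq_div_iff hm.ne', ← hττ]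
      refine (sq_eq_sq₀ (by positivity) hβa.le).1 ?_
      rw [mul_pow, sq_abs, sq_abs, hωτ]

/-- The difference of the squares is always known. If `i₂ ≠ 0` the product gives the sum of the
squares as well; otherwise `i₃` gives `ω²` directly. -/
theorem abs_eq_of_invariants {a ω a' ω' τ i₁ i₂ i₃ : ℝ} (hτ : 0 < τ)
    (h1 : (a ^ 2 - ω ^ 2) * τ ^ 2 = -2 * i₁) (h2 : i₂ ≠ 0 → a * ω * τ ^ 2 = i₂)
    (h3 : i₂ = 0 → ω ^ 2 * τ ^ 4 = i₃) (h1' : (a' ^ 2 - ω' ^ 2) * τ ^ 2 = -2 * i₁)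
    (h2' : i₂ ≠ 0 → a' * ω' * τ ^ 2 = i₂) (h3' : i₂ = 0 → ω' ^ 2 * τ ^ 4 = i₃) :
    |a'| = |a| ∧ |ω'| = |ω| := by
  have hτ2 : τ ^ 2 ≠ 0 := by positivity
  have hsub : a' ^ 2 - ω' ^ 2 = a ^ 2 - ω ^ 2 := mul_right_cancel₀ hτ2 (h1'.trans h1.symm)
  have hω : ω' ^ 2 = ω ^ 2 := by
    by_cases h : i₂ = 0
    · exact mul_right_cancel₀ (b := τ ^ 4) (by positivity) ((h3' h).trans (h3 h).symm)
    · have hmul : a' * ω' = a * ω := mul_right_cancel₀ hτ2 ((h2' h).trans (h2 h).symm)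
      have hsum : a' ^ 2 + ω' ^ 2 = a ^ 2 + ω ^ 2 := by
        refine (sq_eq_sq₀ (by positivity) (by positivity)).1 ?_
        linear_combination (a' ^ 2 - ω' ^ 2 + a ^ 2 - ω ^ 2) * hsub
          + 4 * (a' * ω' + a * ω) * hmul
      linarith
  exact ⟨sq_eq_sq_iff_abs_eq_abs _ _ |>.1 (by linarith), sq_eq_sq_iff_abs_eq_abs _ _ |>.1 hω⟩

/-- At a point with `k = τ e₀` the invariant is `τ² |B|²`. This allows the choice `ω = √I₃ / τ²`. -/
theorem I3_nonneg_of_hasValue (hK : S.IsKilling k) (hX : g.RepresentsField k X) (h2 : I2 X = 0)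
    {τ : ℝ} (hτ : 0 < τ) (hv : S.HasValue k τ) : 0 ≤ I3 X := by
  obtain ⟨p, hp, hp'⟩ := hv
  obtain ⟨f, ho, hf⟩ := exists_frame_of_hasValue hτ hp hp'
  rw [← ho] at hf
  have hK' := hK
  obtain ⟨F, hF, hk⟩ := hK'
  obtain ⟨E, B, h⟩ := f.exists_hasComp hF
  obtain ⟨-, -, i3, -⟩ := invariants_eq hK hX (representsField_of_value hk h hf)
  rw [← i3 h2, I3_fieldMat]
  simp only [Matrix.cons_val, mul_zero, add_zero, sub_zero, ne_eq, OfNat.ofNat_ne_zero,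
    not_false_eq_true, zero_pow, neg_zero, zero_add]
  positivity

/-- Three types of field survive: null fields take form (b), those with both boost and rotation form
(a), and boosts form (c). All lengths are attained in each of them, and uniqueness follows from the
invariants. -/
theorem not_pureRotation_normal_form (hF : S.IsSkew F)
    (hk : ∀ (p : M) (w : W), k (w +ᵥ p) = F w + k p)
    (hX : g.RepresentsField k X) {d : W} (hd : d ∈ S.future)
    (hφ : ∀ φ : Module.Dual ℝ W, (∀ v, φ (F v) = 0) → ∀ p, φ d = φ (k p))
    (hR : ¬ IsPureRotation X) (τ : ℝ) (hτ : 0 < τ) :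
    ∃ a ω : ℝ, 0 ≤ a ∧
      (∃ (f : S.Frame M) (Y : Matrix (Fin 5) (Fin 5) ℝ),
        IsCanonical a ω τ Y ∧ f.RepresentsField k Y) ∧
      ∀ (a' ω' : ℝ) (f : S.Frame M) (Y : Matrix (Fin 5) (Fin 5) ℝ),
        IsCanonical a' ω' τ Y → f.RepresentsField k Y → |a'| = a ∧ |ω'| = |ω| := by
  have hK : S.IsKilling k := ⟨F, hF, hk⟩
  suffices h : ∃ a ω : ℝ, 0 ≤ a ∧ ∃ (f : S.Frame M) (Y : Matrix (Fin 5) (Fin 5) ℝ),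
      IsCanonical a ω τ Y ∧ f.RepresentsField k Y by
    obtain ⟨a, ω, ha, f, Y, hY, hf⟩ := h
    refine ⟨a, ω, ha, ⟨f, Y, hY, hf⟩, fun a' ω' f' Y' hY' hf' => ?_⟩
    obtain ⟨h1, h2, h3, -⟩ := invariants_of_isCanonical hK hX hY hf
    obtain ⟨h1', h2', h3', -⟩ := invariants_of_isCanonical hK hX hY' hf'
    have := abs_eq_of_invariants hτ h1 h2 h3 h1' h2' h3'
    rwa [abs_of_nonneg ha] at this
  rcases killing_cases hF hk hX hd hφ with ⟨τ', hτ', h⟩ | ⟨h0, hI1, hI2, h⟩ |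
    ⟨α, β, hα, hβ, h⟩ | ⟨hI1, hI2, α, h⟩ | ⟨m, β, hm, hβ, h, hv⟩
  · exact absurd (Or.inr (linPart_eq_zero_of_hasAligned hF hk hX h).1) hR
  · have hI3 := I3_nonneg_of_hasValue hK hX hI2 hτ (h τ hτ)
    obtain ⟨f, hf⟩ := exists_perp_of_hasValue hK hX hτ (h τ hτ) (a := √(I3 X) / τ ^ 2)
      (ω := √(I3 X) / τ ^ 2) (by rw [hI1]; ring) hI2 (by
        rw [div_pow, Real.sq_sqrt hI3]
        field_simp)
    refine ⟨_, _, by positivity, f, _, ⟨hτ, Or.inr (Or.inl ⟨rfl, fun h0' => ?_, rfl⟩)⟩, hf⟩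
    rw [h0'] at hf
    exact not_perpGen_zero hK hX h0 ⟨f, hf⟩
  -- Changing both signs together makes the acceleration nonnegative and keeps the invariants.
  · obtain ⟨s, hs, hsα⟩ : ∃ s : ℝ, s ^ 2 = 1 ∧ |α| = s * α := by
      rcases abs_choice α with h | h
      · exact ⟨1, by norm_num, by rw [h, one_mul]⟩
      · exact ⟨-1, by norm_num, by rw [h]; ring⟩
    obtain ⟨f, hf⟩ := ((h τ).of_eq (α' := |α|) (β' := s * β)
      (by rw [sq_abs, mul_pow, hs, one_mul])
      (by rw [hsα]; linear_combination α * β * hs)).exists_alignedGen hk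
      (a := |α| / τ) (ω := s * β / τ) (by field_simp) (by field_simp)
    have ha : 0 ≤ |α| / τ := by positivity
    exact ⟨_, _, ha, f, _, ⟨hτ, Or.inl ⟨ha, rfl⟩⟩, hf⟩
  · have hv := (h τ hτ).1
    have hI3 := I3_nonneg_of_hasValue hK hX hI2 hτ hv
    obtain ⟨ω, hω⟩ : ∃ ω, ω = √(I3 X) / τ ^ 2 := ⟨_, rfl⟩
    have hω0 : 0 ≤ ω := by rw [hω]; positivity
    have hω2 : ω ^ 2 * τ ^ 4 = I3 X := by
      rw [hω, div_pow, Real.sq_sqrt hI3]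
      field_simp
    have hpos : 0 < -2 * I1 X / τ ^ 2 := div_pos (by linarith) (by positivity)
    -- Solves `(a² - ω²) τ² = -2 I₁`; since `I₁ < 0`, this gives `a > ω`.
    obtain ⟨a, ha⟩ : ∃ a, a = √(ω ^ 2 + -2 * I1 X / τ ^ 2) := ⟨_, rfl⟩
    have ha0 : 0 ≤ a := ha ▸ Real.sqrt_nonneg _
    have ha2 : a ^ 2 = ω ^ 2 + -2 * I1 X / τ ^ 2 := ha ▸ Real.sq_sqrt (by positivity)
    obtain ⟨f, hf⟩ := exists_perp_of_hasValue hK hX hτ hv (a := a) (ω := ω)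
      (by rw [ha2]; field_simp; ring) hI2 hω2
    exact ⟨a, ω, ha0, f, _, ⟨hτ, Or.inr (Or.inr ⟨hω0, by nlinarith, rfl⟩)⟩, hf⟩
  · exfalso
    obtain ⟨f, hf⟩ := h.exists_representsField hk
    obtain ⟨i1, i2, -⟩ := invariants_of_aligned hK hX hf
    have hβ2 : 0 < β ^ 2 := by positivity
    exact hR (Or.inl ⟨by linarith, by linarith⟩)

end Minkowski

end Chasles

namespace Chasles

namespace Minkowski

variable {W : Type*} [AddCommGroup W] [Module ℝ W] {S : Minkowski W} {M : Type*} [AddTorsor W M]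

open Minkowski.Frame

/-! ### Normal forms of Lorentz transformations -/

theorem add_mem_future {u v : W} (hu : u ∈ S.future) (hv : v ∈ S.future) : u + v ∈ S.future := by
  obtain ⟨f, -⟩ := S.exists_frame (M := W) 0
  rw [mem_future_iff (f := f)] at hu hv ⊢
  have := spatial_lt hu.1 hu.2.le hv.1 hv.2
  simp only [map_add, Finsupp.add_apply]
  exact ⟨add_pos hu.1 hv.1, by linarith⟩

/-- A frame adapted to a pair of orthogonal vectors, both orthogonal to a timelike vector. -/
theorem exists_frame_of_orthogonal_pair (o : M) {t u v : W} (ht : t ∈ S.future)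
    (hu : S.η t u = 0) (hv : S.η t v = 0) (huv : S.η u v = 0) :
    ∃ (f : S.Frame M) (a b : ℝ), f.origin = o ∧ u = a • f.basis 2 ∧ v = b • f.basis 3 := by
  obtain ⟨g, -⟩ := S.exists_frame o
  have htt := timelike_of_mem_future ht
  obtain ⟨c, hc⟩ : ∃ c, c = √(-S.η t t) := ⟨_, rfl⟩
  have hc0 : 0 < c := hc ▸ Real.sqrt_pos.2 (by linarith)
  have hc2 : c ^ 2 = -S.η t t := hc ▸ Real.sq_sqrt (by linarith)
  obtain ⟨f, ho, h0⟩ := g.exists_frame_of_future o (smul_mem_future ht (inv_pos.2 hc0)) (by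
    have : S.η t t = -c ^ 2 := by linarith
    simp only [map_smul, LinearMap.smul_apply, smul_eq_mul, this]
    field_simp)
  have hz : ∀ x, S.η t x = 0 → f.basis.repr x 0 = 0 := fun x hx => by
    have h1 : S.η (f.basis 0) x = 0 := by rw [h0]; simp [hx]
    rw [f.eta_apply] at h1
    simpa using h1
  have hu0 := hz u hu
  have hv0 := hz v hv
  rw [f.eta_apply, hu0, hv0] at huv
  have hpos : ∀ E : Fin 3 → ℝ, √(E 0 ^ 2 + E 1 ^ 2 + E 2 ^ 2) ^ 2 = E 0 ^ 2 + E 1 ^ 2 + E 2 ^ 2 :=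
    fun E => Real.sq_sqrt (by positivity)
  obtain ⟨n, m, hn, hm, hnm, hE, hB⟩ := exists_orthonormal_pair
    (E := ![f.basis.repr u 1, f.basis.repr u 2, f.basis.repr u 3])
    (B := ![f.basis.repr v 1, f.basis.repr v 2, f.basis.repr v 3])
    (by simp only [Matrix.cons_val]; linarith) (hpos _) (hpos _)
  generalize √_ = a at hE
  generalize √_ = b at hB
  have hl := cross_orthonormal hn hm hnm
  obtain ⟨f', ho', -, -, he2, he3⟩ := f.exists_rotated
    (n := ![n 1 * m 2 - n 2 * m 1, n 2 * m 0 - n 0 * m 2, n 0 * m 1 - n 1 * m 0]) (m := n) (l := m)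
    (by simpa using hl) hn hm (by simp; ring) (by simp; ring) hnm
  obtain ⟨n0, n1, n2, n3⟩ := repr_spatial (f := f) n
  obtain ⟨m0, m1, m2, m3⟩ := repr_spatial (f := f) m
  have hE0 := hE 0
  have hE1 := hE 1
  have hE2 := hE 2
  have hB0 := hB 0
  have hB1 := hB 1
  have hB2 := hB 2
  simp only [Matrix.cons_val] at hE0 hE1 hE2 hB0 hB1 hB2
  have hu' : u = a • f.spatial n := by
    apply ext_repr (f := f) <;> simp [n0, n1, n2, n3, hE0, hE1, hE2, hu0]
  have hv' : v = b • f.spatial m := by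
    apply ext_repr (f := f) <;> simp [m0, m1, m2, m3, hB0, hB1, hB2, hv0]
  rcases he3 with he3 | he3
  · exact ⟨f', a, b, ho'.trans ho, by rw [he2, hu'], by rw [he3, hv']⟩
  · exact ⟨f', a, -b, ho'.trans ho, by rw [he2, hu'], by rw [he3, hv']; simp⟩

/-- The image of a frame under a Lorentz transformation. -/
noncomputable def Frame.map (f : S.Frame M) {Λ : W ≃ₗ[ℝ] W} (hΛ : S.IsLorentz Λ) : S.Frame M where
  origin := f.origin
  basis := f.basis.map Λ
  orthonormal a b := by simp [hΛ.1, f.orthonormal]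
  oriented := by rw [Module.Basis.orientation_map, f.oriented, hΛ.2.1]
  future := by simpa using hΛ.2.2 _ f.future

theorem IsLorentz.det_eq_one {Λ : W ≃ₗ[ℝ] W} (hΛ : S.IsLorentz Λ) (f : S.Frame M) :
    (Matrix.of fun i j => f.basis.repr (Λ (f.basis j)) i).det = 1 := by
  rw [← toMatrix_det_eq_one f (f.map hΛ)]
  congr 1

/-- `Λ` is the boost of rapidity `φ` along and the rotation of angle `θ` around the first axis. -/
def Frame.IsScrew (f : S.Frame M) (Λ : W ≃ₗ[ℝ] W) (φ θ : ℝ) : Prop :=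
  Λ (f.basis 0) = Real.cosh φ • f.basis 0 + Real.sinh φ • f.basis 1 ∧
  Λ (f.basis 1) = Real.sinh φ • f.basis 0 + Real.cosh φ • f.basis 1 ∧
  Λ (f.basis 2) = Real.cos θ • f.basis 2 + Real.sin θ • f.basis 3 ∧
  Λ (f.basis 3) = -Real.sin θ • f.basis 2 + Real.cos θ • f.basis 3

/-- A matrix preserving a nondegenerate form, of determinant `-1`, has the eigenvalue `-1`. -/
theorem det_add_one_eq_zero {n : Type*} [Fintype n] [DecidableEq n] {A η : Matrix n n ℝ}
    (hη : η * η = 1) (hA : A.transpose * η * A = η) (hdet : A.det = -1) : (A + 1).det = 0 := by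
  -- Uses `η Aᵀ η A = 1`. Taking determinants yields `det (A + 1) = -det (A + 1)`.
  have h1 : A + 1 = η * (A.transpose + 1) * η * A := by
    have h2 : η * A.transpose * η * A = 1 := by
      rw [Matrix.mul_assoc η, Matrix.mul_assoc η, hA, hη]
    rw [Matrix.mul_add, Matrix.add_mul, Matrix.add_mul, h2, Matrix.mul_one, hη, Matrix.one_mul,
      add_comm]
  have h3 : η.det * η.det = 1 := by rw [← Matrix.det_mul, hη, Matrix.det_one]
  have h4 : (A.transpose + 1).det = (A + 1).det := by
    rw [← Matrix.det_transpose (A + 1), Matrix.transpose_add, Matrix.transpose_one]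
  have h5 := congrArg Matrix.det h1
  rw [Matrix.det_mul, Matrix.det_mul, Matrix.det_mul, h4, hdet] at h5
  have h6 : (A + 1).det = -(η.det * η.det) * (A + 1).det := by linarith
  rw [h3] at h6
  linarith

/-- The orthogonal complement of `e₃` is invariant, and `Λ` preserves there a metric of signature
`(-,+,+)`. As the total determinant is `1`, the restriction has determinant `-1` and hence the
eigenvalue `-1`. -/
theorem IsLorentz.exists_second_eigenvector {Λ : W ≃ₗ[ℝ] W} (hΛ : S.IsLorentz Λ) {f : S.Frame M}
    (h3 : Λ (f.basis 3) = -f.basis 3) :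
    ∃ u : W, u ≠ 0 ∧ Λ u = -u ∧ f.basis.repr u 3 = 0 := by
  have hrow : ∀ j, j ≠ 3 → f.basis.repr (Λ (f.basis j)) 3 = 0 := fun j hj => by
    have h := hΛ.1 (f.basis 3) (f.basis j)
    rw [h3, f.eta_apply, f.orthonormal] at h
    simpa [etaMat, Matrix.diagonal_apply_ne _ hj.symm] using h
  set L := Matrix.of fun i j => f.basis.repr (Λ (f.basis j)) i with hL
  let A : Matrix (Fin 3) (Fin 3) ℝ := L.submatrix Fin.castSucc Fin.castSucc
  have hAL : ∀ i j, A i j = f.basis.repr (Λ (f.basis j.castSucc)) i.castSucc := fun i j => rfl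
  have hdet := hΛ.det_eq_one f
  rw [det_fin_four] at hdet
  have hη : (Matrix.diagonal ![-1, 1, 1] : Matrix (Fin 3) (Fin 3) ℝ) * Matrix.diagonal ![-1, 1, 1]
      = 1 := by
    ext i j
    fin_cases i <;> fin_cases j <;> simp
  have hA : A.transpose * Matrix.diagonal ![-1, 1, 1] * A = Matrix.diagonal ![-1, 1, 1] := by
    have h := fun i j => hΛ.1 (f.basis i) (f.basis j)
    simp only [f.eta_apply, repr_basis] at h
    have r0 := hrow 0 (by decide)
    have r1 := hrow 1 (by decide)
    have r2 := hrow 2 (by decide)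
    ext i j
    have hij := h i.castSucc j.castSucc
    fin_cases i <;> fin_cases j <;>
      simp [Matrix.mul_apply, Fin.sum_univ_three, hAL, r0, r1, r2] at hij ⊢ <;> linarith
  have hAdet : A.det = -1 := by
    simp only [Matrix.of_apply, hrow 0 (by decide), hrow 1 (by decide), hrow 2 (by decide), h3,
      map_neg, Finsupp.neg_apply, repr_basis, Fin.reduceEq, if_true, if_false] at hdet
    rw [Matrix.det_fin_three]
    simp only [hAL, Fin.castSucc_zero, Fin.castSucc_one, Fin.reduceCastSucc]
    linarith
  obtain ⟨x, hx0, hx⟩ := Matrix.exists_mulVec_eq_zero_iff.2 (det_add_one_eq_zero hη hA hAdet)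
  have hx' := fun i => congrFun hx i
  simp only [Matrix.mulVec, dotProduct, Fin.sum_univ_three, Matrix.add_apply, hAL,
    Pi.zero_apply] at hx'
  have hx0' := hx' 0
  have hx1' := hx' 1
  have hx2' := hx' 2
  simp at hx0' hx1' hx2'
  have hu := fun i => f.repr_vec ![x 0, x 1, x 2, 0] i
  refine ⟨f.vec ![x 0, x 1, x 2, 0], fun h0 => hx0 ?_, ?_, by simp [hu]⟩
  · rw [h0] at hu
    have h0 := hu 0
    have h1 := hu 1
    have h2 := hu 2
    simp at h0 h1 h2
    ext i
    fin_cases i <;> simp [← h0, ← h1, ← h2]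
  · have hexp := fun i => repr_expand f (Λ : W →ₗ[ℝ] W) (f.vec ![x 0, x 1, x 2, 0]) i
    simp only [LinearEquiv.coe_coe] at hexp
    apply ext_repr (f := f) <;> simp only [hexp, hu, map_neg, Finsupp.neg_apply, Matrix.cons_val]
    · linarith
    · linarith
    · linarith
    · rw [hrow 0 (by decide), hrow 1 (by decide), hrow 2 (by decide)]
      simp

/-- For future directed `t` the vector `t + Λ t` is timelike, so eigenvectors for `-1` are spacelike
and can be aligned with spatial axes. -/
theorem IsLorentz.add_orthogonal {Λ : W ≃ₗ[ℝ] W} (hΛ : S.IsLorentz Λ) {v : W} (hv : Λ v = -v)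
    (t : W) : S.η (t + Λ t) v = 0 := by
  have h := hΛ.1 t v
  rw [hv, map_neg] at h
  simp only [map_add, LinearMap.add_apply]
  linarith

theorem exists_rapidity {c s : ℝ} (hc : 0 < c) (h : c ^ 2 - s ^ 2 = 1) :
    ∃ φ, Real.cosh φ = c ∧ Real.sinh φ = s := by
  refine ⟨Real.arsinh s, ?_, Real.sinh_arsinh s⟩
  rw [Real.cosh_arsinh, show 1 + s ^ 2 = c ^ 2 by linarith, Real.sqrt_sq hc.le]

/-- A Lorentz transformation with eigenvalue `-1` is a boost and a half turn. -/
theorem IsLorentz.exists_isScrew_of_eigenvalue {Λ : W ≃ₗ[ℝ] W} (hΛ : S.IsLorentz Λ) (o : M) {v : W}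
    (hv0 : v ≠ 0) (hv : Λ v = -v) : ∃ (f : S.Frame M) (φ θ : ℝ), f.IsScrew Λ φ θ := by
  obtain ⟨g, -⟩ := S.exists_frame o
  have ht : g.basis 0 + Λ (g.basis 0) ∈ S.future := add_mem_future g.future (hΛ.2.2 _ g.future)
  obtain ⟨f, -, b, -, -, hvb⟩ := exists_frame_of_orthogonal_pair (u := 0) o ht (by simp)
    (hΛ.add_orthogonal hv _) (by simp)
  have hb0 : b ≠ 0 := by rintro rfl; exact hv0 (by simp [hvb])
  have h3 : Λ (f.basis 3) = -f.basis 3 := by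
    rw [hvb, map_smul, ← smul_neg] at hv
    exact smul_right_injective W hb0 hv
  obtain ⟨u, hu0, hu, hu3⟩ := hΛ.exists_second_eigenvector h3
  obtain ⟨f', a, b', -, hua, hvb'⟩ := exists_frame_of_orthogonal_pair o ht
    (hΛ.add_orthogonal hu _) (hΛ.add_orthogonal hv _) (by
      rw [hvb, map_smul, f.eta_apply]
      simp [hu3])
  have ha0 : a ≠ 0 := by rintro rfl; exact hu0 (by simp [hua])
  have hb0' : b' ≠ 0 := by rintro rfl; exact hv0 (by simp [hvb'])
  have h2' : Λ (f'.basis 2) = -f'.basis 2 := by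
    rw [hua, map_smul, ← smul_neg] at hu
    exact smul_right_injective W ha0 hu
  have h3' : Λ (f'.basis 3) = -f'.basis 3 := by
    rw [hvb', map_smul, ← smul_neg] at hv
    exact smul_right_injective W hb0' hv
  have hrow3 : ∀ j, j ≠ 3 → f'.basis.repr (Λ (f'.basis j)) 3 = 0 := fun j hj => by
    have h := hΛ.1 (f'.basis 3) (f'.basis j)
    rw [h3', f'.eta_apply, f'.orthonormal] at h
    simpa [etaMat, Matrix.diagonal_apply_ne _ hj.symm] using h
  have hrow2 : ∀ j, j ≠ 2 → f'.basis.repr (Λ (f'.basis j)) 2 = 0 := fun j hj => by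
    have h := hΛ.1 (f'.basis 2) (f'.basis j)
    rw [h2', f'.eta_apply, f'.orthonormal] at h
    simpa [etaMat, Matrix.diagonal_apply_ne _ hj.symm] using h
  have e02 := hrow2 0 (by decide)
  have e03 := hrow3 0 (by decide)
  have e12 := hrow2 1 (by decide)
  have e13 := hrow3 1 (by decide)
  have hpos := ((mem_future_iff (f := f')).1 (hΛ.2.2 _ f'.future)).1
  have h00 := hΛ.1 (f'.basis 0) (f'.basis 0)
  have h01 := hΛ.1 (f'.basis 0) (f'.basis 1)
  have hdet := hΛ.det_eq_one f'
  rw [det_fin_four] at hdet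
  rw [f'.orthonormal, f'.eta_apply, e02, e03] at h00
  rw [f'.orthonormal, f'.eta_apply, e02, e03, e12, e13] at h01
  simp only [Matrix.of_apply, e02, e03, e12, e13, h2', h3', map_neg, Finsupp.neg_apply, repr_basis,
    Fin.reduceEq, if_true, if_false] at hdet
  simp [etaMat] at h00 h01
  set c := f'.basis.repr (Λ (f'.basis 0)) 0
  set s := f'.basis.repr (Λ (f'.basis 0)) 1
  set p := f'.basis.repr (Λ (f'.basis 1)) 0
  set q := f'.basis.repr (Λ (f'.basis 1)) 1
  have hcs : c ^ 2 - s ^ 2 = 1 := by linarith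
  -- On the remaining plane of `e₀, e₁` the matrix is Lorentz with determinant `1` and first column
  -- `(c, s)`, which makes it a boost.
  have hdet' : c * q - s * p = 1 := by linarith
  have hq : q = c := by linear_combination (-q) * hcs - s * h01 + c * hdet'
  have hp : p = s := by linear_combination (-p) * hcs - c * h01 + s * hdet'
  obtain ⟨φ, hφc, hφs⟩ := exists_rapidity hpos hcs
  refine ⟨f', φ, Real.pi, ?_, ?_, ?_, ?_⟩
  · rw [hφc, hφs]
    apply ext_repr (f := f') <;> simp [e02, e03, c, s]
  · rw [hφc, hφs]
    apply ext_repr (f := f') <;> simp [e12, e13, ← hq, ← hp, p, q]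
  · simp [h2']
  · simp [h3']

/-- The Cayley transform of a Lorentz transformation without the eigenvalue `-1`. -/
theorem IsLorentz.exists_cayley {Λ : W ≃ₗ[ℝ] W} (hΛ : S.IsLorentz Λ)
    (h : ∀ v, Λ v = -v → v = 0) : ∃ C : W →ₗ[ℝ] W, S.IsSkew C ∧ (∀ v, C v = v → v = 0) ∧
      ∀ v, Λ v - C (Λ v) = v + C v := by
  have : FiniteDimensional ℝ W := FiniteDimensional.of_finrank_pos (by rw [S.finrank_eq]; simp)
  let T : W →ₗ[ℝ] W := (Λ : W →ₗ[ℝ] W) + LinearMap.id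
  have hT : ∀ v, T v = Λ v + v := fun v => rfl
  have hinj : Function.Injective T := by
    refine (injective_iff_map_eq_zero T).2 fun v hv => h v ?_
    rw [hT] at hv
    exact eq_neg_of_add_eq_zero_left hv
  let e := LinearEquiv.ofInjectiveEndo T hinj
  have he : ∀ v, e v = Λ v + v := fun v => rfl
  -- The Cayley transform `(Λ - 1)(Λ + 1)⁻¹`; skewness is tested on vectors of the form `Λ v + v`,
  -- where `C` is explicit.
  let C : W →ₗ[ℝ] W := ((Λ : W →ₗ[ℝ] W) - LinearMap.id) ∘ₗ (e.symm : W →ₗ[ℝ] W)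
  have hC : ∀ v, C (Λ v + v) = Λ v - v := fun v => by
    rw [← he]
    simp [C]
  have hsurj : ∀ w, ∃ v, w = Λ v + v := fun w => ⟨e.symm w, by rw [← he]; simp⟩
  refine ⟨C, ?_, ?_, ?_⟩
  · intro u v
    obtain ⟨u, rfl⟩ := hsurj u
    obtain ⟨v, rfl⟩ := hsurj v
    rw [hC, hC]
    simp only [map_add, map_sub, LinearMap.add_apply, LinearMap.sub_apply, hΛ.1]
    ring
  · intro w hw
    obtain ⟨v, rfl⟩ := hsurj w
    rw [hC] at hw
    have h2 : (2 : ℝ) • v = 0 := by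
      have : v + v = 0 := by
        have := congrArg (fun x => Λ v + v - x) hw
        simpa [add_sub_sub_cancel] using this
      rw [two_smul, this]
    have hv : v = 0 := (smul_eq_zero.1 h2).resolve_left two_ne_zero
    simp [hv]
  · intro v
    have := hC v
    rw [map_add] at this
    rw [← sub_eq_zero]
    have h' : Λ v - C (Λ v) - (v + C v) = Λ v - v - (C (Λ v) + C v) := by abel
    rw [h', this, sub_self]

/-- Every proper orthochronous Lorentz transformation is a boost and rotation along a common axis
or a null rotation. -/
theorem IsLorentz.normal_form {Λ : W ≃ₗ[ℝ] W} (hΛ : S.IsLorentz Λ) (o : M) :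
    (∃ (f : S.Frame M) (φ θ : ℝ), f.IsScrew Λ φ θ) ∨
    ∃ (f : S.Frame M) (C : W →ₗ[ℝ] W) (c : ℝ), f.HasComp C ![0, c, 0] ![0, 0, -c] ∧
      ∀ v, Λ v = v + (2 : ℝ) • C v + (2 : ℝ) • C (C v) := by
  by_cases h : ∀ v, Λ v = -v → v = 0
  swap
  · push Not at h
    obtain ⟨v, hv, hv0⟩ := h
    exact Or.inl (hΛ.exists_isScrew_of_eigenvalue o hv0 hv)
  obtain ⟨C, hC, hinj, hΛC⟩ := hΛ.exists_cayley h
  -- As `1 - C` is injective, `Λ v` is the only solution `w` of `(1 - C) w = (1 + C) v`, so a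
  -- candidate need only be verified.
  have huniq : ∀ v w, w - C w = v + C v → Λ v = w := fun v w hw => by
    have := hinj (Λ v - w) (by
      rw [map_sub]
      have h1 := hΛC v
      rw [← hw] at h1
      have h2 := sub_eq_zero.2 h1
      rw [eq_comm, ← sub_eq_zero, ← h2]
      abel)
    exact sub_eq_zero.1 this
  obtain ⟨g, -⟩ := S.exists_frame o
  obtain ⟨E, B, hEB⟩ := g.exists_hasComp hC
  by_cases hn : E 0 * B 0 + E 1 * B 1 + E 2 * B 2 = 0 ∧
      E 0 ^ 2 + E 1 ^ 2 + E 2 ^ 2 = B 0 ^ 2 + B 1 ^ 2 + B 2 ^ 2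
  · right
    have hs : √(E 0 ^ 2 + E 1 ^ 2 + E 2 ^ 2) ^ 2 = E 0 ^ 2 + E 1 ^ 2 + E 2 ^ 2 :=
      Real.sq_sqrt (by positivity)
    obtain ⟨f, -, -, hf⟩ := exists_perp_of_orthogonal hEB hn.1 hs (hs.trans hn.2)
    refine ⟨f, C, _, hf, fun v => huniq v _ ?_⟩
    -- With `C³ = 0` the quotient `(1 - C)⁻¹ (1 + C)` equals `1 + 2C + 2C²`.
    have hC3 : C (C (C v)) = 0 := by
      obtain ⟨a0, a1, a2, a3⟩ := hf v
      obtain ⟨b0, b1, b2, b3⟩ := hf (C v)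
      obtain ⟨c0, c1, c2, c3⟩ := hf (C (C v))
      rw [a1, a2, a3] at b0
      rw [a0, a2, a3] at b1
      rw [a0, a1, a3] at b2
      rw [a0, a1, a2] at b3
      rw [b1, b2, b3] at c0
      rw [b0, b2, b3] at c1
      rw [b0, b1, b3] at c2
      rw [b0, b1, b2] at c3
      apply ext_repr (f := f)
      · rw [c0]; simp
      · rw [c1]; simp
      · rw [c2]; simp
      · rw [c3]; simp
    simp only [map_add, map_smul, hC3, smul_zero]
    module
  · left
    obtain ⟨f, α, β, -, hf⟩ := exists_aligned_of_not_null hEB hn o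
    have hC0 : C (f.basis 0) = α • f.basis 1 := by
      obtain ⟨q0, q1, q2, q3⟩ := hf (f.basis 0)
      apply ext_repr (f := f) <;> simp [q0, q1, q2, q3]
    have hC1 : C (f.basis 1) = α • f.basis 0 := by
      obtain ⟨q0, q1, q2, q3⟩ := hf (f.basis 1)
      apply ext_repr (f := f) <;> simp [q0, q1, q2, q3]
    have hC2 : C (f.basis 2) = β • f.basis 3 := by
      obtain ⟨q0, q1, q2, q3⟩ := hf (f.basis 2)
      apply ext_repr (f := f) <;> simp [q0, q1, q2, q3]
    have hC3 : C (f.basis 3) = -β • f.basis 2 := by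
      obtain ⟨q0, q1, q2, q3⟩ := hf (f.basis 3)
      apply ext_repr (f := f) <;> simp [q0, q1, q2, q3]
    have hα : 1 - α ^ 2 ≠ 0 := by
      intro h0
      -- If `α² = 1`, the vector `e₀ + α e₁` would be fixed by `C`.
      have := hinj (f.basis 0 + α • f.basis 1) (by
        rw [map_add, map_smul, hC0, hC1, smul_smul, ← sq, show α ^ 2 = 1 by linarith, one_smul,
          add_comm])
      have := congrArg (fun v => f.basis.repr v 0) this
      simp at this
    have hβ : 1 + β ^ 2 ≠ 0 := by positivity
    have h0 : Λ (f.basis 0) = ((1 + α ^ 2) / (1 - α ^ 2)) • f.basis 0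
        + (2 * α / (1 - α ^ 2)) • f.basis 1 := by
      refine huniq _ _ ?_
      apply ext_repr (f := f) <;> simp [hC0, hC1] <;> field_simp <;> ring
    have h1 : Λ (f.basis 1) = (2 * α / (1 - α ^ 2)) • f.basis 0
        + ((1 + α ^ 2) / (1 - α ^ 2)) • f.basis 1 := by
      refine huniq _ _ ?_
      apply ext_repr (f := f) <;> simp [hC0, hC1] <;> field_simp <;> ring
    have h2 : Λ (f.basis 2) = ((1 - β ^ 2) / (1 + β ^ 2)) • f.basis 2
        + (2 * β / (1 + β ^ 2)) • f.basis 3 := by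
      refine huniq _ _ ?_
      apply ext_repr (f := f) <;> simp [hC2, hC3] <;> field_simp <;> ring
    have h3 : Λ (f.basis 3) = -(2 * β / (1 + β ^ 2)) • f.basis 2
        + ((1 - β ^ 2) / (1 + β ^ 2)) • f.basis 3 := by
      refine huniq _ _ ?_
      apply ext_repr (f := f) <;> simp [hC2, hC3] <;> field_simp <;> ring
    -- Preservation of time orientation makes the candidate for `cosh φ` positive. The parameters
    -- are `α = tanh (φ/2)` and `β = tan (θ/2)`.
    have hpos := ((mem_future_iff (f := f)).1 (hΛ.2.2 _ f.future)).1
    rw [h0] at hpos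
    simp at hpos
    obtain ⟨φ, hφc, hφs⟩ := exists_rapidity hpos (s := 2 * α / (1 - α ^ 2)) (by
      field_simp
      ring)
    have hr : √(1 + β ^ 2) ^ 2 = 1 + β ^ 2 := Real.sq_sqrt (by positivity)
    have hθc : Real.cos (2 * Real.arctan β) = (1 - β ^ 2) / (1 + β ^ 2) := by
      rw [Real.cos_two_mul, Real.cos_sq_arctan]
      field_simp
      ring
    have hθs : Real.sin (2 * Real.arctan β) = 2 * β / (1 + β ^ 2) := by
      rw [Real.sin_two_mul, Real.sin_arctan, Real.cos_arctan, show ∀ r : ℝ,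
        2 * (β / r) * (1 / r) = 2 * β / r ^ 2 from fun r => by ring, hr]
    refine ⟨f, φ, 2 * Real.arctan β, ?_, ?_, ?_, ?_⟩
    · rw [h0, hφc, hφs]
    · rw [h1, hφc, hφs]
    · rw [h2, hθc, hθs]
    · rw [h3, hθc, hθs]

end Minkowski

end Chasles

namespace Chasles

namespace Minkowski

variable {W : Type*} [AddCommGroup W] [Module ℝ W] {S : Minkowski W} {M : Type*} [AddTorsor W M]

open Minkowski.Frame

/-! ### Logarithms of Poincaré transformations -/

theorem exists_linearMap_hasComp (f : S.Frame M) (E B : Fin 3 → ℝ) :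
    ∃ F : W →ₗ[ℝ] W, f.HasComp F E B := by
  let F : W →ₗ[ℝ] W := f.basis.constr ℝ ![f.vec ![0, E 0, E 1, E 2], f.vec ![E 0, 0, B 2, -B 1],
    f.vec ![E 1, -B 2, 0, B 0], f.vec ![E 2, B 1, -B 0, 0]]
  have hF : ∀ j, F (f.basis j) = ![f.vec ![0, E 0, E 1, E 2], f.vec ![E 0, 0, B 2, -B 1],
    f.vec ![E 1, -B 2, 0, B 0], f.vec ![E 2, B 1, -B 0, 0]] j := fun j =>
      f.basis.constr_basis ℝ _ j
  refine ⟨F, fun v => ?_⟩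
  simp only [repr_expand f F v, hF, Matrix.cons_val, repr_vec]
  refine ⟨?_, ?_, ?_, ?_⟩ <;> ring

/-- The Killing field with given components in a frame. -/
theorem exists_killing_of_components (f : S.Frame M) (E B : Fin 3 → ℝ) (d : W) :
    ∃ k : M → W, S.IsKilling k ∧
      f.RepresentsField k (fieldMat E B (fun i => f.basis.repr d i)) := by
  obtain ⟨F, hF⟩ := exists_linearMap_hasComp f E B
  have hk : ∀ (p : M) (w : W), F ((w +ᵥ p) -ᵥ f.origin) + d = F w + (F (p -ᵥ f.origin) + d) :=
    fun p w => by rw [vadd_vsub_assoc, map_add, add_assoc]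
  refine ⟨fun p => F (p -ᵥ f.origin) + d, ⟨F, hF.isSkew, hk⟩, ?_⟩
  rw [representsField_iff (k := fun p => F (p -ᵥ f.origin) + d) hk hF]
  simp

/-- The hypotheses say that the linear part annihilates `d`, so the translation commutes with it and
enters linearly in time. -/
theorem exp_fieldMat_screw {φ θ : ℝ} {d : Fin 4 → ℝ} (h0 : φ * d 0 = 0) (h1 : φ * d 1 = 0)
    (h2 : θ * d 2 = 0) (h3 : θ * d 3 = 0) :
    NormedSpace.exp (fieldMat ![φ, 0, 0] ![θ, 0, 0] d) =
      !![Real.cosh φ, -Real.sinh φ, 0, 0, -d 0;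
         -Real.sinh φ, Real.cosh φ, 0, 0, -d 1;
         0, 0, Real.cos θ, Real.sin θ, -d 2;
         0, 0, -Real.sin θ, Real.cos θ, -d 3;
         0, 0, 0, 0, 1] := by
  have h := exp_smul_eq_of_hasDerivAt (fieldMat ![φ, 0, 0] ![θ, 0, 0] d) (fun t : ℝ =>
    !![Real.cosh (φ * t), -Real.sinh (φ * t), 0, 0, -(t * d 0);
       -Real.sinh (φ * t), Real.cosh (φ * t), 0, 0, -(t * d 1);
       0, 0, Real.cos (θ * t), Real.sin (θ * t), -(t * d 2);
       0, 0, -Real.sin (θ * t), Real.cos (θ * t), -(t * d 3);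
       0, 0, 0, 0, 1]) ?_ ?_ 1
  · simpa using h
  · ext i j
    fin_cases i <;> fin_cases j <;> simp
  · intro t i j
    have e1 := ((hasDerivAt_id' t).const_mul φ).cosh
    have e2 := ((hasDerivAt_id' t).const_mul φ).sinh
    have e3 := ((hasDerivAt_id' t).const_mul θ).cos
    have e4 := ((hasDerivAt_id' t).const_mul θ).sin
    have e5 := fun x : ℝ => ((hasDerivAt_id' t).mul_const x).neg
    fin_cases i <;> fin_cases j <;>
      simp only [fieldMat, Matrix.mul_apply, Fin.sum_univ_five, Fin.zero_eta, Fin.mk_one,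
        Fin.reduceFinMk, Matrix.of_apply, Matrix.cons_val, zero_mul, mul_zero, add_zero,
        zero_add, mul_one, neg_zero] <;>
      first
        | exact hasDerivAt_const _ _
        | exact e1.congr_deriv (by ring)
        | exact e3.congr_deriv (by ring)
        | exact e4.congr_deriv (by ring)
        | exact e2.neg.congr_deriv (by ring)
        | exact e4.neg.congr_deriv (by ring)
        | exact (e5 _).congr_deriv (by linear_combination -t * h0)
        | exact (e5 _).congr_deriv (by linear_combination -t * h1)
        | exact (e5 _).congr_deriv (by linear_combination t * h3)
        | exact (e5 _).congr_deriv (by linear_combination -t * h2)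

variable {P : M → M} {Λ : W ≃ₗ[ℝ] W}

/-- The displacement of the origin of a screw motion can be made invariant. -/
theorem exists_screw_frame (hP : ∀ (p : M) (w : W), P (w +ᵥ p) = Λ w +ᵥ P p) {f : S.Frame M}
    {φ θ : ℝ} (h : f.IsScrew Λ φ θ) :
    ∃ (f' : S.Frame M) (θ' : ℝ), f'.IsScrew Λ φ θ' ∧
      φ * f'.basis.repr (P f'.origin -ᵥ f'.origin) 0 = 0 ∧
      φ * f'.basis.repr (P f'.origin -ᵥ f'.origin) 1 = 0 ∧
      θ' * f'.basis.repr (P f'.origin -ᵥ f'.origin) 2 = 0 ∧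
      θ' * f'.basis.repr (P f'.origin -ᵥ f'.origin) 3 = 0 := by
  obtain ⟨d, hd⟩ : ∃ d, d = P f.origin -ᵥ f.origin := ⟨_, rfl⟩
  have hdisp : ∀ x : W, P (x +ᵥ f.origin) -ᵥ (x +ᵥ f.origin) = Λ x - x + d := fun x => by
    rw [hP, vadd_vsub_vadd_comm, ← hd]
  obtain ⟨h0, h1, h2, h3⟩ := h
  have hexp := fun (x : W) i => repr_expand f (Λ : W →ₗ[ℝ] W) x i
  simp only [LinearEquiv.coe_coe, h0, h1, h2, h3] at hexp
  have e0 := fun x : W => hexp x 0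
  have e1 := fun x : W => hexp x 1
  have e2 := fun x : W => hexp x 2
  have e3 := fun x : W => hexp x 3
  simp at e0 e1 e2 e3
  -- On the boost plane `Λ - 1` has determinant `2(1 - cosh φ)`, nonzero unless `φ = 0`, so Cramer's
  -- rule cancels the displacement there.
  obtain ⟨y, y', hy, hy'⟩ : ∃ y y' : ℝ,
      φ * ((Real.cosh φ - 1) * y + Real.sinh φ * y' + f.basis.repr d 0) = 0 ∧
      φ * (Real.sinh φ * y + (Real.cosh φ - 1) * y' + f.basis.repr d 1) = 0 := by
    by_cases hφ : φ = 0
    · exact ⟨0, 0, by simp [hφ], by simp [hφ]⟩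
    · have hc : 1 - Real.cosh φ ≠ 0 := by
        have := Real.one_lt_cosh.2 hφ
        linarith
      have hs := Real.cosh_sq_sub_sinh_sq φ
      refine ⟨(-(Real.cosh φ - 1) * f.basis.repr d 0 + Real.sinh φ * f.basis.repr d 1)
          / (2 * (1 - Real.cosh φ)), (Real.sinh φ * f.basis.repr d 0
          - (Real.cosh φ - 1) * f.basis.repr d 1) / (2 * (1 - Real.cosh φ)), ?_, ?_⟩
      · refine mul_eq_zero_of_right _ ?_
        field_simp
        linear_combination -f.basis.repr d 0 * hs
      · refine mul_eq_zero_of_right _ ?_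
        field_simp
        linear_combination -f.basis.repr d 1 * hs
  -- The same with determinant `2(1 - cos θ)`. If it vanishes, `θ` may be a nonzero multiple of `2π`
  -- with no way to cancel the displacement; the angle is then replaced by `0`.
  obtain ⟨θ', z, z', hc', hs', hz, hz'⟩ : ∃ θ' z z' : ℝ, Real.cos θ' = Real.cos θ ∧
      Real.sin θ' = Real.sin θ ∧
      θ' * ((Real.cos θ - 1) * z - Real.sin θ * z' + f.basis.repr d 2) = 0 ∧
      θ' * (Real.sin θ * z + (Real.cos θ - 1) * z' + f.basis.repr d 3) = 0 := by
    have hs := Real.sin_sq_add_cos_sq θ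
    by_cases hc : 1 - Real.cos θ = 0
    · have hc1 : Real.cos θ = 1 := by linarith
      refine ⟨0, 0, 0, by simp [hc1], ?_, by simp, by simp⟩
      rw [hc1] at hs
      rw [Real.sin_zero]
      nlinarith
    · refine ⟨θ, (-(Real.cos θ - 1) * f.basis.repr d 2 - Real.sin θ * f.basis.repr d 3)
          / (2 * (1 - Real.cos θ)), (Real.sin θ * f.basis.repr d 2
          - (Real.cos θ - 1) * f.basis.repr d 3) / (2 * (1 - Real.cos θ)), rfl, rfl, ?_, ?_⟩
      · refine mul_eq_zero_of_right _ ?_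
        field_simp
        linear_combination -f.basis.repr d 2 * hs
      · refine mul_eq_zero_of_right _ ?_
        field_simp
        linear_combination -f.basis.repr d 3 * hs
  obtain ⟨x, hx⟩ : ∃ x, x = f.vec ![y, y', z, z'] := ⟨_, rfl⟩
  have hrx := fun i => f.repr_vec ![y, y', z, z'] i
  rw [← hx] at hrx
  refine ⟨f.withOrigin (x +ᵥ f.origin), θ', ?_, ?_, ?_, ?_, ?_⟩
  · refine ⟨h0, h1, ?_, ?_⟩
    · rw [hc', hs']; exact h2
    · rw [hc', hs']; exact h3
  · change φ * f.basis.repr (P (x +ᵥ f.origin) -ᵥ (x +ᵥ f.origin)) 0 = 0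
    rw [hdisp]
    simp only [map_add, map_sub, Finsupp.add_apply, Finsupp.sub_apply, e0, hrx, Matrix.cons_val]
    linear_combination hy
  · change φ * f.basis.repr (P (x +ᵥ f.origin) -ᵥ (x +ᵥ f.origin)) 1 = 0
    rw [hdisp]
    simp only [map_add, map_sub, Finsupp.add_apply, Finsupp.sub_apply, e1, hrx, Matrix.cons_val]
    linear_combination hy'
  · change θ' * f.basis.repr (P (x +ᵥ f.origin) -ᵥ (x +ᵥ f.origin)) 2 = 0
    rw [hdisp]
    simp only [map_add, map_sub, Finsupp.add_apply, Finsupp.sub_apply, e2, hrx, Matrix.cons_val]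
    linear_combination hz
  · change θ' * f.basis.repr (P (x +ᵥ f.origin) -ᵥ (x +ᵥ f.origin)) 3 = 0
    rw [hdisp]
    simp only [map_add, map_sub, Finsupp.add_apply, Finsupp.sub_apply, e3, hrx, Matrix.cons_val]
    linear_combination hz'

/-- Every proper orthochronous Poincaré transformation is the exponential of a Killing field. -/
theorem IsPoincare.exists_log (hP : S.IsPoincare P) :
    ∃ (k : M → W) (g : S.Frame M) (X : Matrix (Fin 5) (Fin 5) ℝ), S.IsKilling k ∧
      g.RepresentsField k X ∧ g.Represents P (NormedSpace.exp X) := by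
  obtain ⟨Λ, hΛ, hP⟩ := hP
  obtain ⟨o⟩ : Nonempty M := AddTorsor.nonempty
  rcases hΛ.normal_form o with ⟨f₀, φ, θ₀, hf₀⟩ | ⟨f, C, c, hC, hΛC⟩
  · obtain ⟨f, θ, ⟨h0, h1, h2, h3⟩, d0, d1, d2, d3⟩ := exists_screw_frame hP hf₀
    obtain ⟨d, hd⟩ : ∃ d, d = P f.origin -ᵥ f.origin := ⟨_, rfl⟩
    rw [← hd] at d0 d1 d2 d3
    obtain ⟨k, hk, hX⟩ := exists_killing_of_components f ![φ, 0, 0] ![θ, 0, 0] d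
    refine ⟨k, f, _, hk, hX, ?_⟩
    rw [exp_fieldMat_screw d0 d1 d2 d3]
    intro p
    obtain ⟨x, rfl⟩ : ∃ x : W, p = x +ᵥ f.origin := ⟨p -ᵥ f.origin, by simp⟩
    have hPx : P (x +ᵥ f.origin) = (Λ x + d) +ᵥ f.origin := by
      rw [hP, hd, add_vadd, vsub_vadd]
    have hexp := fun i => repr_expand f (Λ : W →ₗ[ℝ] W) x i
    simp only [LinearEquiv.coe_coe, h0, h1, h2, h3] at hexp
    simp at hexp
    have hs := Real.cosh_sq_sub_sinh_sq φ
    have hs' := Real.sin_sq_add_cos_sq θ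
    have z01 : φ = 0 ∨ f.basis.repr d 0 = 0 ∧ f.basis.repr d 1 = 0 := by
      rcases mul_eq_zero.1 d0 with h | h
      · exact Or.inl h
      · exact (mul_eq_zero.1 d1).imp id fun h' => ⟨h, h'⟩
    have z23 : θ = 0 ∨ f.basis.repr d 2 = 0 ∧ f.basis.repr d 3 = 0 := by
      rcases mul_eq_zero.1 d2 with h | h
      · exact Or.inl h
      · exact (mul_eq_zero.1 d3).imp id fun h' => ⟨h, h'⟩
    -- The matrix of `P` has blocks `Λ⁻¹` and `-Λ⁻¹ d` in these coordinates; the four identities say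
    -- that `Λ⁻¹ d = d`.
    have t0 : Real.cosh φ * f.basis.repr d 0 - Real.sinh φ * f.basis.repr d 1
        = f.basis.repr d 0 := by
      rcases z01 with h | ⟨h, h'⟩
      · simp [h]
      · simp [h, h']
    have t1 : -Real.sinh φ * f.basis.repr d 0 + Real.cosh φ * f.basis.repr d 1
        = f.basis.repr d 1 := by
      rcases z01 with h | ⟨h, h'⟩
      · simp [h]
      · simp [h, h']
    have t2 : Real.cos θ * f.basis.repr d 2 + Real.sin θ * f.basis.repr d 3
        = f.basis.repr d 2 := by
      rcases z23 with h | ⟨h, h'⟩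
      · simp [h]
      · simp [h, h']
    have t3 : -Real.sin θ * f.basis.repr d 2 + Real.cos θ * f.basis.repr d 3
        = f.basis.repr d 3 := by
      rcases z23 with h | ⟨h, h'⟩
      · simp [h]
      · simp [h, h']
    rw [hPx, hcoord_vadd, hcoord_vadd]
    ext i
    fin_cases i <;> simp [Matrix.mulVec, dotProduct, Fin.sum_univ_five, hexp]
    · linear_combination -f.basis.repr x 0 * hs - t0
    · linear_combination -f.basis.repr x 1 * hs - t1
    · linear_combination -f.basis.repr x 2 * hs' - t2
    · linear_combination -f.basis.repr x 3 * hs' - t3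
  · obtain ⟨d, hd⟩ : ∃ d, d = P f.origin -ᵥ f.origin := ⟨_, rfl⟩
    -- The field `F x + w` with `F = 2C` displaces the origin in unit time by `(1 + F/2 + F²/6) w =
    -- (1 + C + 2C²/3) w`. Since `C³ = 0`, setting this equal to `d` gives `w = d - C d + C² d / 3`.
    obtain ⟨k, hk, hX⟩ := exists_killing_of_components f ![0, 2 * c, 0] ![0, 0, -(2 * c)]
      (d - C d + (3⁻¹ : ℝ) • C (C d))
    have comp : ∀ v, f.basis.repr (C v) 0 = c * f.basis.repr v 2 ∧
        f.basis.repr (C v) 1 = c * f.basis.repr v 2 ∧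
        f.basis.repr (C v) 2 = c * f.basis.repr v 0 - c * f.basis.repr v 1 ∧
        f.basis.repr (C v) 3 = 0 := fun v => by
      obtain ⟨q0, q1, q2, q3⟩ := hC v
      simp at q0 q1 q2 q3
      exact ⟨q0, q1, by linarith, q3⟩
    set w : Fin 4 → ℝ := fun i => f.basis.repr (d - C d + (3⁻¹ : ℝ) • C (C d)) i with hw
    have w0 : w 0 = f.basis.repr d 0 - c * f.basis.repr d 2
        + 3⁻¹ * (c ^ 2 * f.basis.repr d 0 - c ^ 2 * f.basis.repr d 1) := by
      simp [hw, comp]; ring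
    have w1 : w 1 = f.basis.repr d 1 - c * f.basis.repr d 2
        + 3⁻¹ * (c ^ 2 * f.basis.repr d 0 - c ^ 2 * f.basis.repr d 1) := by
      simp [hw, comp]; ring
    have w2 : w 2 = f.basis.repr d 2 - (c * f.basis.repr d 0 - c * f.basis.repr d 1) := by
      simp [hw, comp]
    have w3 : w 3 = f.basis.repr d 3 := by
      simp [hw, comp]
    refine ⟨k, f, _, hk, hX, ?_⟩
    have hXm : fieldMat ![0, 2 * c, 0] ![0, 0, -(2 * c)] w = !![0, 0, -(2 * c), 0, -w 0;
        0, 0, -(2 * c), 0, -w 1; -(2 * c), 2 * c, 0, 0, -w 2; 0, 0, 0, 0, -w 3;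
        0, 0, 0, 0, 0] := by
      ext i j
      fin_cases i <;> fin_cases j <;> simp [fieldMat]
    have hX2 : fieldMat ![0, 2 * c, 0] ![0, 0, -(2 * c)] w *
        fieldMat ![0, 2 * c, 0] ![0, 0, -(2 * c)] w = !![4 * c ^ 2, -(4 * c ^ 2), 0, 0, 2 * c * w 2;
        4 * c ^ 2, -(4 * c ^ 2), 0, 0, 2 * c * w 2; 0, 0, 0, 0, 2 * c * (w 0 - w 1);
        0, 0, 0, 0, 0; 0, 0, 0, 0, 0] := by
      rw [hXm]
      ext i j
      fin_cases i <;> fin_cases j <;> simp [Matrix.mul_apply, Fin.sum_univ_five] <;> ring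
    have hX3 : fieldMat ![0, 2 * c, 0] ![0, 0, -(2 * c)] w *
        (fieldMat ![0, 2 * c, 0] ![0, 0, -(2 * c)] w * fieldMat ![0, 2 * c, 0] ![0, 0, -(2 * c)] w)
        = !![0, 0, 0, 0, -(4 * c ^ 2 * (w 0 - w 1)); 0, 0, 0, 0, -(4 * c ^ 2 * (w 0 - w 1));
        0, 0, 0, 0, 0; 0, 0, 0, 0, 0; 0, 0, 0, 0, 0] := by
      rw [hX2, hXm]
      ext i j
      fin_cases i <;> fin_cases j <;> simp [Matrix.mul_apply, Fin.sum_univ_five] <;> ring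
    have hX4 : fieldMat ![0, 2 * c, 0] ![0, 0, -(2 * c)] w *
        (fieldMat ![0, 2 * c, 0] ![0, 0, -(2 * c)] w * (fieldMat ![0, 2 * c, 0] ![0, 0, -(2 * c)] w *
        fieldMat ![0, 2 * c, 0] ![0, 0, -(2 * c)] w)) = 0 := by
      rw [hX3, hXm]
      ext i j
      fin_cases i <;> fin_cases j <;> simp [Matrix.mul_apply, Fin.sum_univ_five]
    have hexp := exp_of_pow_four_eq_zero hX4 1
    rw [one_smul, hX3, hX2, hXm] at hexp
    rw [hXm, hexp]
    intro p
    obtain ⟨x, rfl⟩ : ∃ x : W, p = x +ᵥ f.origin := ⟨p -ᵥ f.origin, by simp⟩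
    have hPx : P (x +ᵥ f.origin) = (Λ x + d) +ᵥ f.origin := by
      rw [hP, hd, add_vadd, vsub_vadd]
    rw [hPx, hcoord_vadd, hcoord_vadd, hΛC]
    ext i
    fin_cases i <;> simp [Matrix.mulVec, dotProduct, Fin.sum_univ_five, comp, w0, w1, w2, w3] <;>
      ring

end Minkowski

end Chasles

/-! ### Assembly of the theorem -/

theorem theorem4p12 {W M : Type*} [AddCommGroup W] [Module ℝ W] [AddTorsor W M]
    (S : Chasles.Minkowski W) (P : M → M) (hP : S.IsPoincare P)
    (hq : ∃ q, P q ∈ S.chronologicalFuture q) :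
    -- in a suitable reference frame, `P` takes one of the canonical forms (a), (b), (c)
    (∃ (f : S.Frame M) (a ω τ : ℝ), 0 < τ ∧
      ((0 ≤ a ∧ f.Represents P (NormedSpace.exp (τ • Chasles.alignedGen a ω)) ∧
          f.Represents P (Chasles.matA a ω τ)) ∨
       (a = ω ∧ a ≠ 0 ∧ f.Represents P (NormedSpace.exp (τ • Chasles.perpGen a ω)) ∧
          f.Represents P (Chasles.matB a τ)) ∨
       (0 ≤ ω ∧ ω < a ∧ f.Represents P (NormedSpace.exp (τ • Chasles.perpGen a ω)) ∧
          f.Represents P (Chasles.matC a ω τ)))) ∧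
    -- the generators and their exponentials, in matrix form
    (∀ a ω : ℝ,
      Chasles.alignedGen a ω =
        !![0, -a, 0, 0, -1; -a, 0, 0, 0, 0; 0, 0, 0, ω, 0; 0, 0, -ω, 0, 0; 0, 0, 0, 0, 0] ∧
      Chasles.perpGen a ω =
        !![0, 0, -a, 0, -1; 0, 0, -ω, 0, 0; -a, ω, 0, 0, 0; 0, 0, 0, 0, 0; 0, 0, 0, 0, 0]) ∧
    (∀ a ω τ : ℝ, 0 < τ →
      (0 ≤ a → NormedSpace.exp (τ • Chasles.alignedGen a ω) = Chasles.matA a ω τ) ∧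
      (a = ω → a ≠ 0 → NormedSpace.exp (τ • Chasles.perpGen a ω) = Chasles.matB a τ) ∧
      (0 ≤ ω → ω < a → NormedSpace.exp (τ • Chasles.perpGen a ω) = Chasles.matC a ω τ)) ∧
    -- the freedom in `a`, `ω`, `τ`, for every logarithm `k` of `P`, with matrix `X` in a frame `g`
    (∀ (k : M → W) (g : S.Frame M) (X : Matrix (Fin 5) (Fin 5) ℝ), S.IsKilling k →
      g.RepresentsField k X → g.Represents P (NormedSpace.exp X) →
      (∀ a ω τ : ℝ, 0 < τ →
        ((∃ f : S.Frame M, f.RepresentsField k (τ • Chasles.alignedGen a ω)) ↔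
          ((a ^ 2 - ω ^ 2) * τ ^ 2 = -2 * Chasles.I1 X ∧ a * ω * τ ^ 2 = Chasles.I2 X ∧
            (Chasles.I2 X = 0 → ω ^ 2 * τ ^ 4 = Chasles.I3 X) ∧
            (Chasles.linPart X = 0 → τ ^ 2 = -Chasles.I4 X)))) ∧
      (∀ a ω τ : ℝ, 0 < τ →
        ((∃ f : S.Frame M, f.RepresentsField k (τ • Chasles.perpGen a ω)) ↔
          ((a ^ 2 - ω ^ 2) * τ ^ 2 = -2 * Chasles.I1 X ∧ Chasles.I2 X = 0 ∧
            ω ^ 2 * τ ^ 4 = Chasles.I3 X ∧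
            (Chasles.linPart X = 0 → τ ^ 2 = -Chasles.I4 X)))) ∧
      -- pure rotation: `τ` and `|ω|` are uniquely determined
      (Chasles.IsPureRotation X →
        ∃ ω τ : ℝ, 0 ≤ ω ∧ 0 < τ ∧
          (∃ f : S.Frame M, f.RepresentsField k (τ • Chasles.alignedGen 0 ω)) ∧
          (0 < Chasles.I1 X → ω = 2 * Chasles.I1 X / √(Chasles.I3 X)) ∧
          ∀ (a' ω' τ' : ℝ) (f : S.Frame M) (Y : Matrix (Fin 5) (Fin 5) ℝ),
            Chasles.IsCanonical a' ω' τ' Y → f.RepresentsField k Y →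
              a' = 0 ∧ |ω'| = ω ∧ τ' = τ) ∧
      -- otherwise `τ > 0` is arbitrary, and once chosen it determines `|a|` and `|ω|`
      (¬ Chasles.IsPureRotation X → ∀ τ : ℝ, 0 < τ →
        ∃ a ω : ℝ, 0 ≤ a ∧
          (∃ (f : S.Frame M) (Y : Matrix (Fin 5) (Fin 5) ℝ),
            Chasles.IsCanonical a ω τ Y ∧ f.RepresentsField k Y) ∧
          ∀ (a' ω' : ℝ) (f : S.Frame M) (Y : Matrix (Fin 5) (Fin 5) ℝ),
            Chasles.IsCanonical a' ω' τ Y → f.RepresentsField k Y →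
              |a'| = a ∧ |ω'| = |ω|)) := by
  -- The point moved to its future enters only through its displacement `d`, which constrains every
  -- logarithm of `P`.
  have parts : ∀ (k : M → W) (g : S.Frame M) (X : Matrix (Fin 5) (Fin 5) ℝ), S.IsKilling k →
      g.RepresentsField k X → g.Represents P (NormedSpace.exp X) →
      ∃ (F : W →ₗ[ℝ] W) (d : W), S.IsSkew F ∧ (∀ (p : M) (w : W), k (w +ᵥ p) = F w + k p) ∧
        d ∈ S.future ∧
        ∀ φ : Module.Dual ℝ W, (∀ v, φ (F v) = 0) → ∀ p, φ d = φ (k p) := by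
    rintro k g X ⟨F, hF, hk⟩ hX hPX
    obtain ⟨q, hq⟩ := hq
    exact ⟨F, _, hF, hk, Chasles.Minkowski.sub_mem_future_of_mem_chronologicalFuture hq,
      fun φ hφ p => Chasles.Minkowski.Frame.apply_displacement hk hX hPX φ hφ p q⟩
  refine ⟨?_, fun a ω => ⟨Chasles.alignedGen_eq a ω, Chasles.perpGen_eq a ω⟩,
    fun a ω τ _ => ⟨fun _ => Chasles.exp_alignedGen a ω τ, ?_,
      fun h0 h1 => Chasles.exp_perpGen_of_lt τ h0 h1⟩, fun k g X hK hX hPX => ?_⟩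
  · obtain ⟨k, g, X, hK, hX, hPX⟩ := hP.exists_log
    obtain ⟨F, d, hF, hk, hd, hφ⟩ := parts k g X hK hX hPX
    have key : ∃ (f : S.Frame M) (a ω τ : ℝ) (Y : Matrix (Fin 5) (Fin 5) ℝ),
        Chasles.IsCanonical a ω τ Y ∧ f.RepresentsField k Y := by
      by_cases hR : Chasles.IsPureRotation X
      · obtain ⟨ω, τ, -, hτ, ⟨f, hf⟩, -⟩ :=
          Chasles.Minkowski.pureRotation_normal_form hF hk hX hd hφ hR
        exact ⟨f, 0, ω, τ, _, ⟨hτ, Or.inl ⟨le_rfl, rfl⟩⟩, hf⟩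
      · obtain ⟨a, ω, -, ⟨f, Y, hY, hf⟩, -⟩ :=
          -- Any positive length would serve; `τ = 1` is chosen.
          Chasles.Minkowski.not_pureRotation_normal_form hF hk hX hd hφ hR 1 zero_lt_one
        exact ⟨f, a, ω, 1, Y, hY, hf⟩
    obtain ⟨f, a, ω, τ, Y, ⟨hτ, hY⟩, hf⟩ := key
    have hPY := Chasles.Minkowski.Frame.represents_exp_of_representsField hX hf hPX
    refine ⟨f, a, ω, τ, hτ, ?_⟩
    rcases hY with ⟨ha, rfl⟩ | ⟨rfl, ha, rfl⟩ | ⟨hω, ha, rfl⟩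
    · exact Or.inl ⟨ha, hPY, by rwa [← Chasles.exp_alignedGen]⟩
    · exact Or.inr (Or.inl ⟨rfl, ha, hPY, by rwa [← Chasles.exp_perpGen_of_eq]⟩)
    · exact Or.inr (Or.inr ⟨hω, ha, hPY, by rwa [← Chasles.exp_perpGen_of_lt τ hω ha]⟩)
  · rintro rfl -
    exact Chasles.exp_perpGen_of_eq a τ
  · obtain ⟨F, d, hF, hk, hd, hφ⟩ := parts k g X hK hX hPX
    exact ⟨Chasles.Minkowski.exists_alignedGen_iff hF hk hX hd hφ,
      Chasles.Minkowski.exists_perpGen_iff hF hk hX hd hφ,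
      Chasles.Minkowski.pureRotation_normal_form hF hk hX hd hφ,
      Chasles.Minkowski.not_pureRotation_normal_form hF hk hX hd hφ⟩
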